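/- For $m\ge 0$ let $(\cdot,\cdot)$ be the standard symmetric bilinear form of signature $(2,m)$ on $\mathbb R^{2+m}$, extended bilinearly to $\mathbb C^{2+m}$, let $SO(2,m)\subset SL_{2+m}(\mathbb R)$ be the group of matrices of determinant one preserving it, let $SO_0(2,m)$ be its identity component, and let $$\mathcal D_m=\{[z]\in\mathbb P(\mathbb C^{2+m}) : (z,z)=0,\ (\bar z,z)>0\}$$ be its symmetric space (a Hermitian symmetric domain together with its complex conjugate), with the action $g[z]=[gz]$. A homomorphism $\rho:SO_0(2,\ell)\to SO(2,n)$ is said to induce a map of (Hermitian) symmetric spaces if there is a holomorphic map $f:\mathcal D_\ell\to\mathcal D_n$ with $f(gx)=\rho(g)f(x)$ for all $g\in SO_0(2,\ell)$ and $x\in\mathcal D_\ell$. A homomorphism $\rho$ from $G=SO_0(2,\ell)$ or $G=SO(2,\ell)$ to $SO(2,n)$ is said to come from the standard representation if there is a linear map $\varphi:\mathbb R^{2+\ell}\to\mathbb R^{2+n}$ with $(\varphi x,\varphi y)=(x,y)$ and $\rho(g)\varphi(x)=\varphi(gx)$ for all $x,y\in\mathbb R^{2+\ell}$ and $g\in G$,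 and such that $\rho(g)w=w$ for all $g\in G$ and all $w$ orthogonal to the image of $\varphi$. **Corollary.** Let $\ell>1$ and $n\ge 0$ be integers. 1. Let $\rho:SO_0(2,\ell)\to SO(2,n)$ be a non-trivial continuous homomorphism, with finite kernel if $\ell=2$, which induces a map of symmetric spaces. Then $\rho$ comes from the standard representation. 2. Let $\rho:SO(2,\ell)\to SO(2,n)$ be a non-trivial homomorphism of real algebraic groups (that is, the entries of $\rho(g)$ are polynomials in the entries of $g$), with finite kernel if $\ell=2$, whose restriction to $SO_0(2,\ell)$ induces a map of symmetric spaces. Then $\rho$ comes from the standard representation. -/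

import Mathlib

open scoped Matrix LinearAlgebra.Projectivization

noncomputable section

namespace SOTwo

/-- The index set of the coordinates of a quadratic space of signature `(2, n)`. -/
abbrev Idx (n : ℕ) : Type := Fin 2 ⊕ Fin n

/-- The Gram matrix `diag(1, 1, -1, …, -1)` of the standard form of signature `(2, n)`. -/
abbrev gram (n : ℕ) (R : Type*) [CommRing R] : Matrix (Idx n) (Idx n) R :=
  LieAlgebra.Orthogonal.indefiniteDiagonal (Fin 2) (Fin n) R

/-- The standard symmetric bilinear form of signature `(2, n)`, for `R = ℝ`, and its bilinear
extension for `R = ℂ`. -/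
def form {n : ℕ} {R : Type*} [CommRing R] (x y : Idx n → R) : R :=
  x ⬝ᵥ (gram n R *ᵥ y)

/-- The group `SO(2, n)` of real matrices of determinant one that preserve the standard form of
signature `(2, n)`, with the topology of real matrices. -/
def SO (n : ℕ) : Subgroup (Matrix.SpecialLinearGroup (Idx n) ℝ) where
  carrier := {g | (g : Matrix (Idx n) (Idx n) ℝ)ᵀ * gram n ℝ * (g : Matrix (Idx n) (Idx n) ℝ)
    = gram n ℝ}
  one_mem' := by simp
  mul_mem' := by
    intro a b ha hb
    simp only [Set.mem_ofPred_eq, Matrix.SpecialLinearGroup.coe_mul, Matrix.transpose_mul] at *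
    calc _ = (b : Matrix (Idx n) (Idx n) ℝ)ᵀ * ((a : Matrix (Idx n) (Idx n) ℝ)ᵀ * gram n ℝ
          * (a : Matrix (Idx n) (Idx n) ℝ)) * (b : Matrix (Idx n) (Idx n) ℝ) := by
            simp only [Matrix.mul_assoc]
      _ = _ := by rw [ha, hb]
  inv_mem' := by
    intro a ha
    simp only [Set.mem_ofPred_eq] at *
    have h : (a : Matrix (Idx n) (Idx n) ℝ)
        * ((a⁻¹ : Matrix.SpecialLinearGroup (Idx n) ℝ) : Matrix (Idx n) (Idx n) ℝ) = 1 := by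
      rw [← Matrix.SpecialLinearGroup.coe_mul, mul_inv_cancel, Matrix.SpecialLinearGroup.coe_one]
    have h2 : (((a⁻¹ : Matrix.SpecialLinearGroup (Idx n) ℝ)) : Matrix (Idx n) (Idx n) ℝ)ᵀ
        * (a : Matrix (Idx n) (Idx n) ℝ)ᵀ = 1 := by
      rw [← Matrix.transpose_mul, h, Matrix.transpose_one]
    generalize ((a⁻¹ : Matrix.SpecialLinearGroup (Idx n) ℝ) : Matrix (Idx n) (Idx n) ℝ) = b at *
    calc bᵀ * gram n ℝ * b
        = (bᵀ * (a : Matrix (Idx n) (Idx n) ℝ)ᵀ) * gram n ℝ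
          * ((a : Matrix (Idx n) (Idx n) ℝ) * b) := by
            conv_lhs => rw [← ha]
            simp only [Matrix.mul_assoc]
      _ = gram n ℝ := by rw [h, h2]; simp

/-- The underlying real matrix of an element of `SO(2, n)`. -/
abbrev mat {n : ℕ} (g : SO n) : Matrix (Idx n) (Idx n) ℝ :=
  ((g : Matrix.SpecialLinearGroup (Idx n) ℝ) : Matrix (Idx n) (Idx n) ℝ)

/-- The identity component `SO₀(2, n)` of the Lie group `SO(2, n)`. -/
abbrev SOId (n : ℕ) : Subgroup (SO n) := Subgroup.connectedComponentOfOne (SO n)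

/-- The set of `z ∈ ℂ^{2+n}` with `(z, z) = 0` and `(z̄, z) > 0`. -/
def cone (n : ℕ) : Set (Idx n → ℂ) :=
  {z | form z z = 0 ∧ 0 < (form (star z) z).re}

theorem ne_zero_of_mem_cone {n : ℕ} {z : Idx n → ℂ} (hz : z ∈ cone n) : z ≠ 0 := by
  rintro rfl
  simp [cone, form] at hz

theorem smul_mem_cone_iff {n : ℕ} (a : ℂˣ) (z : Idx n → ℂ) : a • z ∈ cone n ↔ z ∈ cone n := by
  have h1 : form (a • z) (a • z) = (a : ℂ) * a * form z z := by
    simp only [form, Units.smul_def, Matrix.mulVec_smul, dotProduct_smul, smul_dotProduct,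
      smul_eq_mul]
    ring
  have h2 : (form (star (a • z)) (a • z)).re = Complex.normSq a * (form (star z) z).re := by
    have : form (star (a • z)) (a • z) = (Complex.normSq a : ℂ) * form (star z) z := by
      rw [Complex.normSq_eq_conj_mul_self]
      simp only [form, Units.smul_def, star_smul, Matrix.mulVec_smul, dotProduct_smul,
        smul_dotProduct, smul_eq_mul, Complex.star_def]
      ring
    rw [this, Complex.re_ofReal_mul]
  have h3 : 0 < Complex.normSq a := Complex.normSq_pos.mpr a.ne_zero
  simp only [cone, Set.mem_ofPred_eq, h1, h2, mul_pos_iff_of_pos_left h3]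
  simp

/-- The symmetric space attached to `SO(2, n)`: the set of lines `[z] ∈ ℙ(ℂ^{2+n})` with
`(z, z) = 0` and `(z̄, z) > 0`. Equivalently, the space of oriented positive definite planes in
`ℝ^{2,n}`, with the plane spanned by the real and imaginary parts of `z` corresponding to `[z]`.
It is the union of the Hermitian symmetric domain of `SO(2, n)` and its complex conjugate. -/
def Dom (n : ℕ) : Set (ℙ ℂ (Idx n → ℂ)) := {p | p.rep ∈ cone n}

theorem mk_mem_Dom_iff {n : ℕ} (z : Idx n → ℂ) (hz : z ≠ 0) :
    Projectivization.mk ℂ z hz ∈ Dom n ↔ z ∈ cone n := by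
  obtain ⟨a, ha⟩ := Projectivization.exists_smul_eq_mk_rep ℂ z hz
  rw [Dom, Set.mem_ofPred_eq, ← ha, smul_mem_cone_iff]

/-- The point `[z]` of the symmetric space. -/
def pt {n : ℕ} {z : Idx n → ℂ} (hz : z ∈ cone n) : Dom n :=
  ⟨Projectivization.mk ℂ z (ne_zero_of_mem_cone hz), (mk_mem_Dom_iff z _).mpr hz⟩

/-- An element of `SO(2, n)` seen as a complex matrix. -/
def toComplex {n : ℕ} : SO n →* Matrix.SpecialLinearGroup (Idx n) ℂ :=
  (Matrix.SpecialLinearGroup.map Complex.ofRealHom).comp (SO n).subtype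

theorem form_toComplex {n : ℕ} (g : SO n) (x y : Idx n → ℂ) :
    form (toComplex g • x) (toComplex g • y) = form x y := by
  have h : ((mat g).map Complex.ofRealHom)ᵀ * gram n ℂ * (mat g).map Complex.ofRealHom
      = gram n ℂ := by
    have hg : (mat g)ᵀ * gram n ℝ * mat g = gram n ℝ := g.2
    have hG : (gram n ℝ).map Complex.ofRealHom = gram n ℂ := by
      ext i j
      rcases i with i | i <;> rcases j with j | j <;>
        simp [gram, LieAlgebra.Orthogonal.indefiniteDiagonal, Matrix.diagonal_apply] <;>
        split_ifs <;> simp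
    rw [← hG, ← Matrix.transpose_map, ← Matrix.map_mul, ← Matrix.map_mul, hg]
  change ((mat g).map Complex.ofRealHom *ᵥ x) ⬝ᵥ (gram n ℂ *ᵥ
    ((mat g).map Complex.ofRealHom *ᵥ y)) = x ⬝ᵥ (gram n ℂ *ᵥ y)
  conv_rhs => rw [← h]
  rw [← Matrix.vecMul_transpose, ← Matrix.dotProduct_mulVec, Matrix.mulVec_mulVec,
    Matrix.mulVec_mulVec, Matrix.mul_assoc]

theorem star_toComplex {n : ℕ} (g : SO n) (x : Idx n → ℂ) :
    star (toComplex g • x) = toComplex g • star x := by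
  ext i
  change star (((mat g).map Complex.ofRealHom *ᵥ x) i) = ((mat g).map Complex.ofRealHom *ᵥ star x) i
  simp [Matrix.mulVec, dotProduct]

theorem toComplex_smul_mem_cone {n : ℕ} (g : SO n) {z : Idx n → ℂ} (hz : z ∈ cone n) :
    toComplex g • z ∈ cone n := by
  simpa only [cone, Set.mem_ofPred_eq, star_toComplex, form_toComplex] using hz

/-- The action of `SO(2, n)` on its symmetric space, `g • [z] = [g z]`. -/
instance actionDom (n : ℕ) : MulAction (SO n) (Dom n) where
  smul g p := ⟨toComplex g • (p : ℙ ℂ (Idx n → ℂ)), by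
    obtain ⟨p, hp⟩ := p
    induction p using Projectivization.ind with
    | h z hz =>
      rw [Projectivization.smul_mk, mk_mem_Dom_iff]
      exact toComplex_smul_mem_cone g ((mk_mem_Dom_iff z hz).mp hp)⟩
  one_smul p := Subtype.ext (by
    change toComplex 1 • (p : ℙ ℂ (Idx n → ℂ)) = p
    rw [map_one, one_smul])
  mul_smul g h p := Subtype.ext (by
    change toComplex (g * h) • (p : ℙ ℂ (Idx n → ℂ)) = toComplex g • toComplex h • (p : ℙ ℂ _)
    rw [map_mul, mul_smul])

theorem smul_pt {n : ℕ} (g : SO n) {z : Idx n → ℂ} (hz : z ∈ cone n) :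
    g • pt hz = pt (toComplex_smul_mem_cone g hz) := rfl

/-- Holomorphy of a map between the symmetric spaces, which are complex submanifolds of projective
spaces: near every point `[z₀]` the map is of the form `[z] ↦ [φ z]` with `φ` holomorphic on an
open subset of the ambient vector space. -/
def IsHolomorphic {l n : ℕ} (f : Dom l → Dom n) : Prop :=
  ∀ z₀ ∈ cone l, ∃ U : Set (Idx l → ℂ), IsOpen U ∧ z₀ ∈ U ∧
    ∃ φ : (Idx l → ℂ) → (Idx n → ℂ), DifferentiableOn ℂ φ U ∧
      ∀ z, z ∈ U → ∀ hz : z ∈ cone l, ∃ hφ : φ z ∈ cone n, f (pt hz) = pt hφ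

/-- A homomorphism `ρ : SO₀(2, l) → SO(2, n)` induces a map of Hermitian symmetric spaces if there
is a `ρ`-equivariant holomorphic map between the symmetric spaces. -/
def InducesMap {l n : ℕ} (ρ : SOId l →* SO n) : Prop :=
  ∃ f : Dom l → Dom n, IsHolomorphic f ∧
    ∀ (g : SOId l) (x : Dom l), f ((g : SO l) • x) = ρ g • f x

/-- A homomorphism `ρ : SO(2, l) → SO(2, n)` is a morphism of real algebraic groups if the entries
of `ρ g` are polynomials in the entries of `g`. -/
def IsAlgebraic {l n : ℕ} (ρ : SO l →* SO n) : Prop :=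
  ∀ i j : Idx n, ∃ P : MvPolynomial (Idx l × Idx l) ℝ,
    ∀ g : SO l, mat (ρ g) i j = MvPolynomial.eval (fun p => mat g p.1 p.2) P

/-- Let `G` be a subgroup of `SO(2, l)`, included by `ι`. A homomorphism `ρ : G → SO(2, n)` comes
from the standard representation if there is an isometric linear embedding
`φ : ℝ^{2,l} → ℝ^{2,n}` which is `G`-equivariant (for the standard action on the source and for
`ρ` on the target), such that `ρ` is trivial on the orthogonal complement of the image of `φ`. -/
def ComesFromStandard {l n : ℕ} {G : Type*} [Group G] (ι : G →* SO l) (ρ : G →* SO n) : Prop :=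
  ∃ φ : (Idx l → ℝ) →ₗ[ℝ] (Idx n → ℝ),
    (∀ x y, form (φ x) (φ y) = form x y) ∧
    (∀ (g : G) (x : Idx l → ℝ), mat (ρ g) *ᵥ φ x = φ (mat (ι g) *ᵥ x)) ∧
    (∀ (g : G) (w : Idx n → ℝ), (∀ x, form (φ x) w = 0) → mat (ρ g) *ᵥ w = w)

end SOTwo

end

-- Fix a hyperbolic pair `e₀`, `e₁` and a unit vector `p` orthogonal to it. The points `[e₀ + Z -
-- (Z, Z)/2 e₁]`, with `Im Z` in the positive cone around `p`, form a tube domain in the source on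
-- which the Eichler transformations along `e₁` act as real translations. Under `ρ` these become
-- exponentials of commuting skew operators that depend linearly on the direction; `gen Z` is the
-- complex linear extension. For a local lift `φ` of `f`, the vector `exp(-gen Z) φ` keeps its
-- direction under real translations, hence by holomorphy under all small changes of `Z`. So `f` is
-- `Z ↦ [exp(gen Z) w]` on the whole tube, with one fixed `w` (`exists_flat_vector`).
--
-- Elements preserving both lines of the hyperbolic pair multiply `w` by scalars. For the dilation
-- of the tube, each application of a generator doubles the eigenvalue, and invariance of the form
-- lets degrees `k` and `m` pair only if `k + m = j` for one `j` (`IsFlat.exists_grading`).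
-- Signature `(2, n)` forces three mutually orthogonal vectors of nonnegative norm to be dependent
-- (`exists_relation_of_orthogonal`), and this single fact pins down `j`. Degrees three and above
-- are excluded directly. In degree one all `gen b w` would be proportional, against the action of a
-- boost. In degree zero `f` is constant and `ρ` is trivial. The finite kernel for `l = 2` serves to
-- keep `gen` in an isotropic direction from killing `w` (`IsFlat.gen_p_eq_zero`).
--
-- In degree two `w` can be taken real, and `b ↦ gen b w` is a similitude (`Grading.form_realGen`).
-- The exponential series then stops after the quadratic term and coincides with a linear isometric
-- embedding applied to the point of the quadric (`Grading.exp_gen_apply`). Equivariance of this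
-- embedding holds up to a scalar, which is constant on the domain, squares to one and is continuous
-- in the group, hence equals one (`act_complexification`).
--
-- Triviality, both of `ρ` in degree zero and of the action on the negative definite complement,
-- rests on a contraction argument: an isometric action on a definite space kills every `h` with
-- `g⁻ᵏ h gᵏ → 1` (`cact_eq_self_of_contracted`), and no proper normal subgroup contains all such
-- `h` (`eq_top_of_containsContracted`). The second statement follows from the first by Zariski
-- density of the identity component (`eval_mat_eq_zero`).

noncomputable section

namespace SOTwo

-- The standard form as a nondegenerate bilinear form

section Form

variable {n : ℕ} {R : Type*} [CommRing R]

theorem form_eq_sum (x y : Idx n → R) :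
    form x y = ∑ i, x (Sum.inl i) * y (Sum.inl i) - ∑ j, x (Sum.inr j) * y (Sum.inr j) := by
  simp [form, gram, LieAlgebra.Orthogonal.indefiniteDiagonal, dotProduct, Matrix.mulVec_diagonal,
    Fintype.sum_sum_type, sub_eq_add_neg]

theorem form_comm (x y : Idx n → R) : form x y = form y x := by
  simp only [form_eq_sum, mul_comm]

@[simp] theorem form_add_left (x y z : Idx n → R) : form (x + y) z = form x z + form y z := by
  simp [form, add_dotProduct]

@[simp] theorem form_smul_left (a : R) (x z : Idx n → R) : form (a • x) z = a * form x z := by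
  simp [form]

@[simp] theorem form_add_right (x y z : Idx n → R) : form z (x + y) = form z x + form z y := by
  simp [form, Matrix.mulVec_add]

@[simp] theorem form_smul_right (a : R) (x z : Idx n → R) : form z (a • x) = a * form z x := by
  simp [form, Matrix.mulVec_smul]

@[simp] theorem form_zero_left (z : Idx n → R) : form 0 z = 0 := by simp [form]

@[simp] theorem form_zero_right (z : Idx n → R) : form z 0 = 0 := by simp [form]

@[simp] theorem form_neg_left (x z : Idx n → R) : form (-x) z = -form x z := by simp [form]

@[simp] theorem form_neg_right (x z : Idx n → R) : form z (-x) = -form z x := by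
  simp [form, Matrix.mulVec_neg]

@[simp] theorem form_sub_left (x y z : Idx n → R) : form (x - y) z = form x z - form y z := by
  simp [sub_eq_add_neg]

@[simp] theorem form_sub_right (x y z : Idx n → R) : form z (x - y) = form z x - form z y := by
  simp [sub_eq_add_neg]

/-- The standard form as a bilinear map. -/
def formₗ : (Idx n → R) →ₗ[R] (Idx n → R) →ₗ[R] R :=
  LinearMap.mk₂ R form form_add_left form_smul_left (fun z x y => form_add_right x y z)
    (fun a z x => form_smul_right a x z)

@[simp] theorem formₗ_apply (x y : Idx n → R) : formₗ x y = form x y := rfl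

theorem form_sum_left {ι : Type*} (s : Finset ι) (x : ι → Idx n → R) (z : Idx n → R) :
    form (∑ i ∈ s, x i) z = ∑ i ∈ s, form (x i) z := by
  simp_rw [← formₗ_apply]; simp

theorem form_sum_right {ι : Type*} (s : Finset ι) (x : ι → Idx n → R) (z : Idx n → R) :
    form z (∑ i ∈ s, x i) = ∑ i ∈ s, form z (x i) := by
  simp_rw [← formₗ_apply]; simp

theorem form_single_inl (x : Idx n → R) (i : Fin 2) :
    form x (Pi.single (Sum.inl i) 1) = x (Sum.inl i) := by
  simp [form_eq_sum, Pi.single_apply]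

theorem form_single_inr (x : Idx n → R) (i : Fin n) :
    form x (Pi.single (Sum.inr i) 1) = -x (Sum.inr i) := by
  simp [form_eq_sum, Pi.single_apply]

theorem eq_zero_of_form_eq_zero {x : Idx n → R} (h : ∀ y, form x y = 0) : x = 0 := by
  ext (i | i)
  · simpa [form_single_inl] using h (Pi.single (Sum.inl i) 1)
  · simpa [form_single_inr] using h (Pi.single (Sum.inr i) 1)

theorem form_star [StarRing R] (x y : Idx n → R) : form (star x) (star y) = star (form x y) := by
  simp [form_eq_sum]

end Form

-- Real structure, and linear algebra in signature `(2, n)`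

section Complexify

variable {n : ℕ}

/-- A real vector seen as a complex vector. -/
def cvec : (Idx n → ℝ) →ₗ[ℝ] (Idx n → ℂ) where
  toFun x i := x i
  map_add' x y := by ext i; simp
  map_smul' a x := by ext i; simp

@[simp] theorem cvec_apply (x : Idx n → ℝ) (i : Idx n) : cvec x i = x i := rfl

@[simp] theorem form_cvec (x y : Idx n → ℝ) : form (cvec x) (cvec y) = form x y := by
  simp [form_eq_sum]

@[simp] theorem star_cvec (x : Idx n → ℝ) : star (cvec x) = cvec x := by
  ext i; simp

theorem cvec_injective : Function.Injective (cvec (n := n)) := fun x y h => by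
  ext i; simpa using congrFun h i

@[simp] theorem cvec_eq_zero {x : Idx n → ℝ} : cvec x = 0 ↔ x = 0 := by
  rw [← map_zero cvec, cvec_injective.eq_iff]

@[simp] theorem cvec_smul (a : ℝ) (x : Idx n → ℝ) : cvec (a • x) = (a : ℂ) • cvec x := by
  ext i; simp

/-- The imaginary part of a complex vector. -/
def imv : (Idx n → ℂ) →ₗ[ℝ] (Idx n → ℝ) where
  toFun z i := (z i).im
  map_add' x y := by ext i; simp
  map_smul' a x := by ext i; simp

/-- The real part of a complex vector. -/
def rev : (Idx n → ℂ) →ₗ[ℝ] (Idx n → ℝ) where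
  toFun z i := (z i).re
  map_add' x y := by ext i; simp
  map_smul' a x := by ext i; simp

@[simp] theorem imv_apply (z : Idx n → ℂ) (i : Idx n) : imv z i = (z i).im := rfl

@[simp] theorem rev_apply (z : Idx n → ℂ) (i : Idx n) : rev z i = (z i).re := rfl

theorem eq_rev_add_imv (z : Idx n → ℂ) : z = cvec (rev z) + Complex.I • cvec (imv z) := by
  ext i; simp [mul_comm Complex.I, Complex.re_add_im]

theorem sub_star_eq (z : Idx n → ℂ) : z - star z = (2 * Complex.I) • cvec (imv z) := by
  ext i
  apply Complex.ext <;> simp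
  ring

theorem eq_cvec_of_star_eq {z : Idx n → ℂ} (h : star z = z) : z = cvec (rev z) := by
  ext i
  have := congrFun h i
  exact (Complex.conj_eq_iff_re.mp this).symm

/-- Two complex linear maps that agree on real vectors are equal. -/
theorem linear_ext_real {M F : Type*} [AddCommGroup M] [Module ℂ M] [FunLike F (Idx n → ℂ) M]
    [LinearMapClass F ℂ (Idx n → ℂ) M] {f g : F} (h : ∀ x, f (cvec x) = g (cvec x))
    (z : Idx n → ℂ) : f z = g z := by
  rw [eq_rev_add_imv z, map_add, map_add, map_smul, map_smul, h, h]

theorem herm_symm (u v : Idx n → ℂ) : form (star v) u = star (form (star u) v) := by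
  rw [← form_star, star_star, form_comm]

theorem exists_ne_zero_form_eq_zero {K : Type*} [Field K] {r : ℕ} (v : Fin r → Idx n → K)
    (hr : r < 2 + n) : ∃ x : Idx n → K, x ≠ 0 ∧ ∀ i, form x (v i) = 0 := by
  let L : (Idx n → K) →ₗ[K] (Fin r → K) := LinearMap.pi fun i => formₗ.flip (v i)
  have hL : LinearMap.ker L ≠ ⊥ := L.ker_ne_bot_of_finrank_lt (by simpa using hr)
  obtain ⟨x, hx, hx0⟩ := Submodule.exists_mem_ne_zero_of_ne_bot hL
  exact ⟨x, hx0, fun i => congrFun hx i⟩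

/-- In signature `(2, n)` a positive semidefinite subspace has dimension at most two: three
mutually orthogonal vectors of nonnegative norm are linearly dependent. -/
theorem exists_relation_of_orthogonal {u v w : Idx n → ℂ}
    (huv : form (star u) v = 0) (huw : form (star u) w = 0) (hvw : form (star v) w = 0)
    (hu : 0 ≤ (form (star u) u).re) (hv : 0 ≤ (form (star v) v).re)
    (hw : 0 ≤ (form (star w) w).re) :
    ∃ a b c : ℂ, (a ≠ 0 ∨ b ≠ 0 ∨ c ≠ 0) ∧ a • u + b • v + c • w = 0 := by
  have hvu : form (star v) u = 0 := by rw [herm_symm, huv, star_zero]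
  have hwu : form (star w) u = 0 := by rw [herm_symm, huw, star_zero]
  have hwv : form (star w) v = 0 := by rw [herm_symm, hvw, star_zero]
  -- Only two coordinates are positive, so some nontrivial combination of the three vectors has no
  -- positive coordinates. Its norm is then both nonpositive and, by orthogonality, nonnegative.
  let L : (Fin 3 → ℂ) →ₗ[ℂ] (Fin 2 → ℂ) :=
    LinearMap.pi fun i => (LinearMap.proj 0 : (Fin 3 → ℂ) →ₗ[ℂ] ℂ).smulRight (u (Sum.inl i))
      + (LinearMap.proj 1 : (Fin 3 → ℂ) →ₗ[ℂ] ℂ).smulRight (v (Sum.inl i))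
      + (LinearMap.proj 2 : (Fin 3 → ℂ) →ₗ[ℂ] ℂ).smulRight (w (Sum.inl i))
  have hL : LinearMap.ker L ≠ ⊥ := L.ker_ne_bot_of_finrank_lt (by simp)
  obtain ⟨c, hc, hc0⟩ := Submodule.exists_mem_ne_zero_of_ne_bot hL
  refine ⟨c 0, c 1, c 2, ?_, ?_⟩
  · by_contra! h
    exact hc0 (by ext i; fin_cases i <;> simp [h])
  set x := c 0 • u + c 1 • v + c 2 • w with hx
  have hx0 : ∀ i, x (Sum.inl i) = 0 := fun i => by simpa [L, hx] using congrFun hc i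
  have h1 : form (star x) x = Complex.normSq (c 0) * form (star u) u
      + Complex.normSq (c 1) * form (star v) v + Complex.normSq (c 2) * form (star w) w := by
    simp only [hx, star_add, star_smul, form_add_left, form_add_right, form_smul_left,
      form_smul_right, huv, huw, hvw, hvu, hwu, hwv, Complex.normSq_eq_conj_mul_self,
      Complex.star_def]
    ring
  have h2 : 0 ≤ (form (star x) x).re := by
    rw [h1]
    simp only [Complex.add_re, Complex.re_ofReal_mul]
    have := Complex.normSq_nonneg (c 0)
    have := Complex.normSq_nonneg (c 1)
    have := Complex.normSq_nonneg (c 2)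
    positivity
  have h3 : (form (star x) x).re = -∑ j, Complex.normSq (x (Sum.inr j)) := by
    simp only [form_eq_sum, hx0, mul_zero, Finset.sum_const_zero, zero_sub, Complex.neg_re,
      Complex.re_sum, Pi.star_apply, Complex.star_def, ← Complex.normSq_eq_conj_mul_self,
      Complex.ofReal_re]
  have h4 : ∑ j, Complex.normSq (x (Sum.inr j)) = 0 :=
    le_antisymm (by linarith) (Finset.sum_nonneg fun _ _ => Complex.normSq_nonneg _)
  ext (i | j)
  · exact hx0 i
  · exact Complex.normSq_eq_zero.mp
      ((Finset.sum_eq_zero_iff_of_nonneg fun _ _ => Complex.normSq_nonneg _).mp h4 j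
        (Finset.mem_univ j))

/-- A nonzero vector orthogonal to two orthogonal vectors of positive norm has negative norm. -/
theorem herm_neg_of_orthogonal {u v w : Idx n → ℂ} (huv : form (star u) v = 0)
    (hu : 0 < (form (star u) u).re) (hv : 0 < (form (star v) v).re)
    (huw : form (star u) w = 0) (hvw : form (star v) w = 0) (hw0 : w ≠ 0) :
    (form (star w) w).re < 0 := by
  by_contra! hw
  obtain ⟨a, b, c, hne, h⟩ := exists_relation_of_orthogonal huv huw hvw hu.le hv.le hw
  have hvu : form (star v) u = 0 := by rw [herm_symm, huv, star_zero]
  have hu' : form (star u) u ≠ 0 := fun h => by simp [h] at hu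
  have hv' : form (star v) v ≠ 0 := fun h => by simp [h] at hv
  have ha : a = 0 := by simpa [huv, huw, hu'] using congrArg (form (star u)) h
  have hb : b = 0 := by simpa [hvu, hvw, hv'] using congrArg (form (star v)) h
  have hc : c = 0 := by simpa [ha, hb, hw0] using h
  simp [ha, hb, hc] at hne

/-- The real version of `exists_relation_of_orthogonal`, for an isotropic vector, a positive vector
and a third vector orthogonal to both. -/
theorem form_neg_of_orthogonal {e p x : Idx n → ℝ} (he : form e e = 0) (he0 : e ≠ 0)
    (hp : 0 < form p p) (hep : form e p = 0) (hex : form e x = 0) (hpx : form p x = 0)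
    (hx : ∀ c : ℝ, x ≠ c • e) : form x x < 0 := by
  by_contra! hxx
  have h1 : 0 ≤ (form (star (cvec e)) (cvec e)).re := by simp [he]
  have h2 : 0 ≤ (form (star (cvec p)) (cvec p)).re := by simp [hp.le]
  have h3 : 0 ≤ (form (star (cvec x)) (cvec x)).re := by simp [hxx]
  obtain ⟨a, b, c, hne, h⟩ := exists_relation_of_orthogonal (u := cvec e) (v := cvec p)
    (w := cvec x) (by simp [hep]) (by simp [hex]) (by simp [hpx]) h1 h2 h3
  have hb : b = 0 := by
    simpa [form_comm p e, hep, hpx, hp.ne'] using congrArg (form (cvec p)) h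
  subst hb
  obtain ⟨i, hi⟩ := Function.ne_iff.mp he0
  have hc : c ≠ 0 := by
    rintro rfl
    have : a = 0 := by simpa [he0] using h
    simp [this] at hne
  refine hx (-(a / c)).re ?_
  ext i
  have hi : a * e i + c * x i = 0 := by simpa using congrFun h i
  have h5 : ((x i : ℝ) : ℂ) = -(a / c) * e i := by
    field_simp
    linear_combination hi
  have h6 := congrArg Complex.re h5
  simpa using h6

end Complexify

-- The linear actions, and one-parameter groups of isometries

section Action

variable {n : ℕ}

/-- The action of `SO(2, n)` on real vectors. -/
def act : SO n →* Module.End ℝ (Idx n → ℝ) where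
  toFun g := Matrix.toLin' (mat g)
  map_one' := by simp [mat, Module.End.one_eq_id]
  map_mul' g h := by simp [mat, Matrix.toLin'_mul, Module.End.mul_eq_comp]

theorem act_apply (g : SO n) (x : Idx n → ℝ) : act g x = mat g *ᵥ x := Matrix.toLin'_apply _ _

theorem act_mul_apply (g h : SO n) (x : Idx n → ℝ) : act (g * h) x = act g (act h x) := by
  rw [map_mul, Module.End.mul_apply]

theorem act_injective : Function.Injective (act (n := n)) := fun g h hgh => by
  apply Subtype.ext
  apply Subtype.ext
  exact Matrix.toLin'.injective hgh

theorem SO_ext {g h : SO n} (H : ∀ x, act g x = act h x) : g = h :=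
  act_injective (LinearMap.ext H)

theorem SOId_ext {g h : SOId n} (H : ∀ x, act (g : SO n) x = act (h : SO n) x) : g = h :=
  Subtype.ext (SO_ext H)

theorem det_act (g : SO n) : LinearMap.det (act g) = 1 := by
  change LinearMap.det (Matrix.toLin' (mat g)) = 1
  rw [LinearMap.det_toLin']
  exact (g : Matrix.SpecialLinearGroup (Idx n) ℝ).2

/-- The action of `SO(2, n)` on complex vectors. -/
def cact : SO n →* ((Idx n → ℂ) →L[ℂ] (Idx n → ℂ)) where
  toFun g := LinearMap.toContinuousLinearMap (Matrix.toLin' ((mat g).map Complex.ofRealHom))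
  map_one' := by ext; simp [mat]
  map_mul' g h := by
    ext1 x
    simp [mat, Matrix.toLin'_mul, Matrix.map_mul]

theorem cact_mul_apply (g h : SO n) (x : Idx n → ℂ) : cact (g * h) x = cact g (cact h x) := by
  rw [map_mul]; rfl

@[simp] theorem cact_inv_apply_self (g : SO n) (x : Idx n → ℂ) : cact g⁻¹ (cact g x) = x := by
  rw [← cact_mul_apply]; simp

@[simp] theorem cact_apply_inv_self (g : SO n) (x : Idx n → ℂ) : cact g (cact g⁻¹ x) = x := by
  rw [← cact_mul_apply]; simp

@[simp] theorem form_cact (g : SO n) (x y : Idx n → ℂ) : form (cact g x) (cact g y) = form x y :=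
  form_toComplex g x y

theorem form_cact_left (g : SO n) (x y : Idx n → ℂ) :
    form (cact g x) y = form x (cact g⁻¹ y) := by
  rw [← form_cact g x (cact g⁻¹ y), cact_apply_inv_self]

theorem star_cact (g : SO n) (x : Idx n → ℂ) : star (cact g x) = cact g (star x) :=
  star_toComplex g x

@[simp] theorem cact_cvec (g : SO n) (x : Idx n → ℝ) : cact g (cvec x) = cvec (act g x) := by
  ext i
  change ((mat g).map Complex.ofRealHom *ᵥ cvec x) i = _
  rw [cvec_apply, act_apply]
  simp [Matrix.mulVec, dotProduct]

@[simp] theorem form_act (g : SO n) (x y : Idx n → ℝ) : form (act g x) (act g y) = form x y := by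
  have := form_cact g (cvec x) (cvec y)
  rw [cact_cvec, cact_cvec, form_cvec, form_cvec] at this
  exact_mod_cast this

theorem continuous_mat : Continuous (mat : SO n → Matrix (Idx n) (Idx n) ℝ) :=
  Continuous.comp continuous_subtype_val continuous_subtype_val

theorem continuous_cact : Continuous (cact : SO n → ((Idx n → ℂ) →L[ℂ] (Idx n → ℂ))) := by
  let L : Matrix (Idx n) (Idx n) ℂ →ₗ[ℂ] ((Idx n → ℂ) →L[ℂ] (Idx n → ℂ)) :=
    LinearMap.toContinuousLinearMap.toLinearMap ∘ₗ Matrix.toLin'.toLinearMap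
  have hL : Continuous L := L.continuous_of_finiteDimensional
  exact hL.comp (Continuous.matrix_map continuous_mat Complex.continuous_ofReal)

theorem continuous_act (x : Idx n → ℝ) : Continuous fun g : SO n => act g x := by
  simp_rw [act_apply]
  exact continuous_mat.matrix_mulVec continuous_const

theorem transpose_mul_gram_mul {T : Module.End ℝ (Idx n → ℝ)}
    (hT : ∀ x y, form (T x) (T y) = form x y) :
    (LinearMap.toMatrix' T)ᵀ * gram n ℝ * (LinearMap.toMatrix' T) = gram n ℝ := by
  have key : ∀ x y : Idx n → ℝ, x ⬝ᵥ (((LinearMap.toMatrix' T)ᵀ * gram n ℝ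
      * (LinearMap.toMatrix' T)) *ᵥ y) = x ⬝ᵥ (gram n ℝ *ᵥ y) := fun x y => by
    have := hT x y
    rw [form, form, ← LinearMap.toMatrix'_mulVec T x, ← LinearMap.toMatrix'_mulVec T y] at this
    rw [← this, ← Matrix.vecMul_transpose (LinearMap.toMatrix' T) x, ← Matrix.dotProduct_mulVec,
      Matrix.mulVec_mulVec, Matrix.mulVec_mulVec, Matrix.mul_assoc]
  ext i j
  simpa using key (Pi.single i 1) (Pi.single j 1)

/-- The element of `SO(2, n)` given by a linear isometry of determinant one. -/
def mkSO (T : Module.End ℝ (Idx n → ℝ)) (hT : ∀ x y, form (T x) (T y) = form x y)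
    (hdet : LinearMap.det T = 1) : SO n :=
  ⟨⟨LinearMap.toMatrix' T, by rw [LinearMap.det_toMatrix', hdet]⟩, by
    exact transpose_mul_gram_mul hT⟩

@[simp] theorem act_mkSO (T : Module.End ℝ (Idx n → ℝ)) (hT) (hdet) :
    act (mkSO T hT hdet) = T := by
  change Matrix.toLin' (LinearMap.toMatrix' T) = T
  simp

theorem isometry_det_sq {T : Module.End ℝ (Idx n → ℝ)}
    (hT : ∀ x y, form (T x) (T y) = form x y) : LinearMap.det T ^ 2 = 1 := by
  have h := transpose_mul_gram_mul hT
  have hg : (gram n ℝ).det ≠ 0 := by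
    simp [gram, LieAlgebra.Orthogonal.indefiniteDiagonal, Matrix.det_diagonal,
      Fintype.prod_sum_type]
  have := congrArg Matrix.det h
  rw [Matrix.det_mul, Matrix.det_mul, Matrix.det_transpose, LinearMap.det_toMatrix'] at this
  have h2 : (gram n ℝ).det * (LinearMap.det T ^ 2 - 1) = 0 := by linear_combination this
  rcases mul_eq_zero.mp h2 with h3 | h3
  · exact absurd h3 hg
  · linear_combination h3

theorem mem_SOId_of_path {γ : ℝ → SO n} (hγ : Continuous γ) (h0 : γ 0 = 1) (t : ℝ) :
    γ t ∈ SOId n := by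
  have h : IsPreconnected (Set.range γ) := isPreconnected_range hγ
  exact h.subset_connectedComponent ⟨0, h0⟩ ⟨t, rfl⟩

/-- A continuous one-parameter group of linear isometries lifts to the identity component. -/
theorem exists_one_parameter (T : ℝ → Module.End ℝ (Idx n → ℝ))
    (hT : ∀ t x y, form (T t x) (T t y) = form x y) (h0 : T 0 = 1)
    (hadd : ∀ s t, T (s + t) = T s * T t) (hc : ∀ x, Continuous fun t => T t x) :
    ∃ γ : ℝ → SOId n, Continuous γ ∧ ∀ t, act (γ t : SO n) = T t := by
  -- Halving the parameter writes the determinant as a square of `±1`.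
  have hdet : ∀ t, LinearMap.det (T t) = 1 := fun t => by
    have h1 := isometry_det_sq (hT (t / 2))
    rw [← add_halves t, hadd, map_mul, ← sq, h1]
  let γ : ℝ → SO n := fun t => mkSO (T t) (hT t) (hdet t)
  have hγ : Continuous γ := by
    refine Continuous.subtype_mk (Continuous.subtype_mk ?_ _) _
    refine continuous_matrix fun i j => ?_
    simp only [LinearMap.toMatrix'_apply]
    exact (continuous_apply i).comp (hc _)
  have hγ0 : γ 0 = 1 := SO_ext fun x => by simp [γ, h0]
  exact ⟨fun t => ⟨γ t, mem_SOId_of_path hγ hγ0 t⟩, hγ.subtype_mk _, fun t => act_mkSO _ (hT t) (hdet t)⟩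

end Action

-- Eichler transformations, dilations and swaps

section Elements

variable {n : ℕ}

/-- The Eichler transformation `x ↦ x + (x, e) b - (x, b) e - (b, b) (x, e) e / 2`. -/
def eichLin (e b : Idx n → ℝ) : Module.End ℝ (Idx n → ℝ) :=
  1 + (formₗ.flip e).smulRight b - (formₗ.flip b).smulRight e
    - (form b b / 2) • (formₗ.flip e).smulRight e

theorem eichLin_apply (e b x : Idx n → ℝ) : eichLin e b x
    = x + form x e • b - form x b • e - (form b b / 2 * form x e) • e := by
  simp [eichLin, mul_smul]

/-- For a fixed isotropic `e` the Eichler transformations compose by adding multiples of `b`, which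
makes them a one-parameter group through the identity. -/
theorem exists_eichler_family {e b : Idx n → ℝ} (he : form e e = 0) (hb : form b e = 0) :
    ∃ γ : ℝ → SOId n, Continuous γ ∧ ∀ t, act (γ t : SO n) = eichLin e (t • b) := by
  have hb' : form e b = 0 := by rw [form_comm, hb]
  apply exists_one_parameter
  · intro t x y
    simp only [eichLin_apply, form_add_left, form_sub_left, form_add_right, form_sub_right,
      form_smul_left, form_smul_right, he, hb, hb', form_comm e y, form_comm b y]
    ring
  · refine LinearMap.ext fun x => ?_
    simp [eichLin_apply]
  · intro s t
    refine LinearMap.ext fun x => funext fun i => ?_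
    simp only [eichLin_apply, Module.End.mul_apply, form_add_left, form_sub_left, form_smul_left,
      form_smul_right, he, hb, hb', Pi.add_apply, Pi.sub_apply, Pi.smul_apply, smul_eq_mul]
    ring
  · intro x
    simp only [eichLin_apply, form_smul_left, form_smul_right]
    fun_prop

theorem exists_eichler {e b : Idx n → ℝ} (he : form e e = 0) (hb : form b e = 0) :
    ∃ g : SOId n, act (g : SO n) = eichLin e b := by
  obtain ⟨γ, -, hγ⟩ := exists_eichler_family he hb
  exact ⟨γ 1, by rw [hγ, one_smul]⟩

/-- The transformation that multiplies `e` by `a` and `e'` by `a⁻¹`, for isotropic vectors with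
`(e, e') = 1`, and that fixes their orthogonal complement. -/
def dilLin (e e' : Idx n → ℝ) (a : ℝ) : Module.End ℝ (Idx n → ℝ) :=
  1 + (a - 1) • (formₗ.flip e').smulRight e + (a⁻¹ - 1) • (formₗ.flip e).smulRight e'

theorem dilLin_apply (e e' : Idx n → ℝ) (a : ℝ) (x : Idx n → ℝ) : dilLin e e' a x
    = x + ((a - 1) * form x e') • e + ((a⁻¹ - 1) * form x e) • e' := by
  simp [dilLin, mul_smul]

/-- A hyperbolic pair: isotropic vectors `e` and `e'` with `(e, e') = 1`. -/
structure IsHyp (e e' : Idx n → ℝ) : Prop where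
  left : form e e = 0
  right : form e' e' = 0
  pair : form e e' = 1

namespace IsHyp

variable {e e' : Idx n → ℝ}

theorem pair' (h : IsHyp e e') : form e' e = 1 := by rw [form_comm, h.pair]

theorem symm (h : IsHyp e e') : IsHyp e' e := ⟨h.right, h.left, h.pair'⟩

theorem left_ne_zero (h : IsHyp e e') : e ≠ 0 := by
  rintro rfl
  simpa using h.pair

theorem form_dilLin (h : IsHyp e e') {a : ℝ} (ha : a ≠ 0) (x y : Idx n → ℝ) :
    form (dilLin e e' a x) (dilLin e e' a y) = form x y := by
  simp only [dilLin_apply, form_add_left, form_add_right, form_smul_left, form_smul_right, h.left,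
    h.right, h.pair, h.pair', form_comm e y, form_comm e' y]
  field_simp
  ring

theorem dilLin_mul (h : IsHyp e e') {a b : ℝ} (ha : a ≠ 0) (hb : b ≠ 0) :
    dilLin e e' (a * b) = dilLin e e' a * dilLin e e' b := by
  refine LinearMap.ext fun x => funext fun i => ?_
  simp only [dilLin_apply, Module.End.mul_apply, form_add_left, form_smul_left, h.left,
    h.right, h.pair, h.pair', Pi.add_apply, Pi.smul_apply, smul_eq_mul]
  field_simp
  ring

/-- With `a = exp t` the dilations form a one-parameter group; only positive factors are reached in
this way. -/
theorem exists_dilation (h : IsHyp e e') {a : ℝ} (ha : 0 < a) :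
    ∃ g : SOId n, act (g : SO n) = dilLin e e' a := by
  obtain ⟨γ, -, hγ⟩ := exists_one_parameter (fun t => dilLin e e' (Real.exp t))
    (fun t x y => h.form_dilLin (Real.exp_pos t).ne' x y) (LinearMap.ext fun x => by simp [dilLin_apply])
    (fun s t => by
      rw [Real.exp_add, h.dilLin_mul (Real.exp_pos s).ne' (Real.exp_pos t).ne'])
    (fun x => by
      simp only [dilLin_apply, ← Real.exp_neg]
      fun_prop)
  exact ⟨γ (Real.log a), by rw [hγ, Real.exp_log ha]⟩

theorem dilLin_left (h : IsHyp e e') (a : ℝ) : dilLin e e' a e = a • e := by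
  simp [dilLin_apply, h.left, h.pair, sub_smul]

theorem dilLin_right (h : IsHyp e e') (a : ℝ) : dilLin e e' a e' = a⁻¹ • e' := by
  simp [dilLin_apply, h.right, h.pair', sub_smul]

end IsHyp

theorem dilLin_of_orthogonal {e e' x : Idx n → ℝ} (a : ℝ) (h : form x e = 0)
    (h' : form x e' = 0) : dilLin e e' a x = x := by
  simp [dilLin_apply, h, h']

theorem eichLin_smul_left (e b : Idx n → ℝ) (c : ℝ) : eichLin (c • e) b = eichLin e (c • b) := by
  refine LinearMap.ext fun x => funext fun i => ?_
  simp only [eichLin_apply, form_smul_left, form_smul_right, Pi.add_apply, Pi.sub_apply,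
    Pi.smul_apply, smul_eq_mul]
  ring

theorem act_conj_eichLin (g : SO n) (e b x : Idx n → ℝ) :
    act g (eichLin e b x) = eichLin (act g e) (act g b) (act g x) := by
  simp [eichLin_apply]

theorem act_conj_dilLin (g : SO n) (e e' x : Idx n → ℝ) (a : ℝ) :
    act g (dilLin e e' a x) = dilLin (act g e) (act g e') a (act g x) := by
  simp [dilLin_apply]

theorem dilLin_smul (e e' : Idx n → ℝ) (a : ℝ) {c : ℝ} (hc : c ≠ 0) :
    dilLin (c • e) (c⁻¹ • e') a = dilLin e e' a := by
  refine LinearMap.ext fun x => funext fun i => ?_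
  simp only [dilLin_apply, form_smul_right, Pi.add_apply, Pi.smul_apply, smul_eq_mul]
  field_simp

theorem dilLin_swap (e e' : Idx n → ℝ) (a : ℝ) : dilLin e' e a = dilLin e e' a⁻¹ := by
  refine LinearMap.ext fun x => ?_
  simp only [dilLin_apply, inv_inv]
  abel

/-- A product of three Eichler transformations that exchanges the lines of a hyperbolic pair. -/
theorem IsHyp.exists_swap {e e' b : Idx n → ℝ} (h : IsHyp e e') (hbe : form b e = 0)
    (hbe' : form b e' = 0) (hb : form b b ≠ 0) :
    ∃ g₁ g₂ : SOId n, act (g₁ : SO n) = eichLin e b ∧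
      act (g₂ : SO n) = eichLin e' ((2 / form b b) • b) ∧
      act ((g₁ * g₂ * g₁ : SOId n) : SO n) e = (-(2 / form b b)) • e' ∧
      act ((g₁ * g₂ * g₁ : SOId n) : SO n) e' = (-(2 / form b b))⁻¹ • e ∧
      ∀ x, form x e = 0 → form x e' = 0 → form x b = 0 →
        act ((g₁ * g₂ * g₁ : SOId n) : SO n) x = x := by
  obtain ⟨g₁, h₁⟩ := exists_eichler h.left hbe
  -- The factor `2 / (b, b)` is the one for which the product of opposite unipotents lands exactly
  -- on the Weyl element, as in `SL₂`.
  obtain ⟨g₂, h₂⟩ := exists_eichler (b := (2 / form b b) • b) h.right (by simp [hbe'])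
  have heb : form e b = 0 := by rw [form_comm, hbe]
  have heb' : form e' b = 0 := by rw [form_comm, hbe']
  refine ⟨g₁, g₂, h₁, h₂, ?_, ?_, fun x hx hx' hxb => ?_⟩
  · ext i
    simp only [Subgroup.coe_mul, act_mul_apply, h₁, h₂, eichLin_apply, form_add_left,
      form_sub_left, form_smul_left, form_smul_right, h.left, h.pair, h.pair', hbe, hbe',
      heb, heb', Pi.add_apply, Pi.sub_apply, Pi.smul_apply, smul_eq_mul]
    field_simp
    ring
  · ext i
    simp only [Subgroup.coe_mul, act_mul_apply, h₁, h₂, eichLin_apply, form_add_left,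
      form_sub_left, form_smul_left, form_smul_right, h.left, h.right, h.pair, h.pair', hbe, hbe',
      heb, heb', Pi.add_apply, Pi.sub_apply, Pi.smul_apply, smul_eq_mul]
    field_simp
    ring
  · simp [h₁, h₂, eichLin_apply, hx, hx', hxb]

end Elements

-- Reflections and their products

section Reflections

variable {l : ℕ}

/-- If the complement of the hyperbolic plane were totally isotropic, polarization would put any of
its nonzero vectors in the radical of the form. -/
theorem IsHyp.exists_orthogonal {e e' : Idx l → ℝ} (h : IsHyp e e') (hl : 1 < l) :
    ∃ b, form b e = 0 ∧ form b e' = 0 ∧ form b b ≠ 0 := by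
  by_contra! H
  obtain ⟨x, hx0, hx⟩ := exists_ne_zero_form_eq_zero ![e, e'] (show 2 < 2 + l by omega)
  have hxe : form x e = 0 := hx 0
  have hxe' : form x e' = 0 := hx 1
  refine hx0 (eq_zero_of_form_eq_zero fun y => ?_)
  set y' := y - form y e' • e - form y e • e' with hy'
  have h1 : form y' e = 0 := by simp [hy', h.left, h.pair']
  have h2 : form y' e' = 0 := by simp [hy', h.right, h.pair]
  have h3 := H (x + y') (by simp [hxe, h1]) (by simp [hxe', h2])
  have h4 := H x hxe hxe'
  have h5 := H y' h1 h2
  have h6 : form x y' = form x y := by simp [hy', hxe, hxe']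
  simp only [form_add_left, form_add_right, form_comm y' x] at h3
  linarith

/-- The reflection in the hyperplane orthogonal to `u`. -/
def reflLin (u : Idx l → ℝ) : Module.End ℝ (Idx l → ℝ) :=
  1 - (2 / form u u) • (formₗ.flip u).smulRight u

theorem reflLin_apply (u x : Idx l → ℝ) :
    reflLin u x = x - (2 / form u u * form x u) • u := by
  simp [reflLin, mul_smul]

theorem form_reflLin {u : Idx l → ℝ} (hu : form u u ≠ 0) (x y : Idx l → ℝ) :
    form (reflLin u x) (reflLin u y) = form x y := by
  simp only [reflLin_apply, form_sub_left, form_sub_right, form_smul_left, form_smul_right,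
    form_comm u y]
  field_simp
  ring

theorem reflLin_mul_self {u : Idx l → ℝ} (hu : form u u ≠ 0) : reflLin u * reflLin u = 1 := by
  refine LinearMap.ext fun x => funext fun i => ?_
  simp only [reflLin_apply, Module.End.mul_apply, form_sub_left, form_smul_left, Pi.sub_apply,
    Pi.smul_apply, smul_eq_mul, Module.End.one_apply]
  field_simp
  ring

theorem mul_reflLin {T : Module.End ℝ (Idx l → ℝ)} (hT : ∀ x y, form (T x) (T y) = form x y)
    (u : Idx l → ℝ) : T * reflLin u = reflLin (T u) * T := by
  refine LinearMap.ext fun x => ?_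
  simp [reflLin_apply, hT]

theorem reflLin_self {u : Idx l → ℝ} (hu : form u u ≠ 0) : reflLin u u = -u := by
  rw [reflLin_apply, div_mul_cancel₀ _ hu, two_smul]
  abel

theorem reflLin_of_orthogonal {u x : Idx l → ℝ} (h : form x u = 0) : reflLin u x = x := by
  simp [reflLin_apply, h]

theorem reflLin_sub_apply {x v : Idx l → ℝ} (h : form x x = form v v)
    (hn : form (x - v) (x - v) ≠ 0) : reflLin (x - v) x = v := by
  have h1 : form (x - v) (x - v) = 2 * form x (x - v) := by
    simp only [form_sub_left, form_sub_right, form_comm v x]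
    linarith
  have h2 : form x (x - v) ≠ 0 := fun h0 => hn (by rw [h1, h0, mul_zero])
  rw [reflLin_apply, h1, div_mul_eq_mul_div, mul_comm 2 (form x (x - v)), div_self (by positivity),
    one_smul, sub_sub_cancel]

/-- Every isometry is a product of reflections. -/
theorem mem_closure_reflLin (T : Module.End ℝ (Idx l → ℝ))
    (hT : ∀ x y, form (T x) (T y) = form x y) :
    T ∈ Submonoid.closure {S | ∃ u : Idx l → ℝ, form u u ≠ 0 ∧ S = reflLin u} := by
  set P := Submonoid.closure {S | ∃ u : Idx l → ℝ, form u u ≠ 0 ∧ S = reflLin u}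
  have hP : ∀ u : Idx l → ℝ, form u u ≠ 0 → reflLin u ∈ P := fun u hu =>
    Submonoid.subset_closure ⟨u, hu, rfl⟩
  let v : Idx l → Idx l → ℝ := fun i => Pi.single i 1
  have hvv : ∀ i, form (v i) (v i) ≠ 0 := by
    rintro (i | i)
    · simp [v, form_single_inl]
    · simp [v, form_single_inr]
  have hvo : ∀ i j, i ≠ j → form (v i) (v j) = 0 := by
    rintro i (j | j) hij
    · simp [v, form_single_inl, hij.symm]
    · simp [v, form_single_inr, hij.symm]
  -- Here `s` contains all basis vectors not yet known to be fixed; the induction removes them one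
  -- at a time.
  suffices H : ∀ s : Finset (Idx l), ∀ T : Module.End ℝ (Idx l → ℝ),
      (∀ x y, form (T x) (T y) = form x y) → (∀ i ∉ s, T (v i) = v i) → T ∈ P from
    H Finset.univ T hT fun i hi => absurd (Finset.mem_univ i) hi
  intro s
  induction s using Finset.induction_on with
  | empty =>
    intro T _ hfix
    have : T = 1 := by
      refine LinearMap.pi_ext' fun i => LinearMap.ext_ring ?_
      simpa [v] using hfix i (Finset.notMem_empty i)
    rw [this]
    exact one_mem _
  | insert i s his ih =>
    intro T hT hfix
    have horth : ∀ j ∉ insert i s, form (v j) (T (v i)) = 0 ∧ form (v j) (v i) = 0 := by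
      intro j hj
      have hji : j ≠ i := fun h => hj (by simp [h])
      have h1 := hT (v j) (v i)
      rw [hfix j hj] at h1
      exact ⟨h1.trans (hvo j i hji), hvo j i hji⟩
    have step : ∀ S : Module.End ℝ (Idx l → ℝ), (∀ x y, form (S x) (S y) = form x y) →
        S (T (v i)) = v i → (∀ j ∉ insert i s, S (v j) = v j) → S * T ∈ P := by
      intro S hS hSi hSf
      refine ih (S * T) (fun x y => by simp [hS, hT]) fun j hj => ?_
      by_cases hji : j = i
      · subst hji; simpa using hSi
      · have hj' : j ∉ insert i s := by simp [hji, hj]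
        simp [hfix j hj', hSf j hj']
    -- The norms of `T v - v` and `T v + v` add up to `4 (v, v) ≠ 0`, so at least one of them can be
    -- used for a reflection. The sum sends `T v` to `-v`, which a second reflection corrects.
    by_cases hn : form (T (v i) - v i) (T (v i) - v i) = 0
    · have hn' : form (T (v i) + v i) (T (v i) + v i) ≠ 0 := by
        intro h0
        have h1 := hT (v i) (v i)
        simp only [form_sub_left, form_sub_right, form_add_left, form_add_right] at hn h0
        exact hvv i (by linarith)
      have hp := step (reflLin (v i) * reflLin (T (v i) + v i))
        (fun x y => by simp [form_reflLin (hvv i), form_reflLin hn']) (by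
          have := reflLin_sub_apply (x := T (v i)) (v := -v i) (by simp [hT])
            (by simpa using hn')
          rw [sub_neg_eq_add] at this
          rw [Module.End.mul_apply, this, map_neg, reflLin_self (hvv i), neg_neg])
        (fun j hj => by
          obtain ⟨h1, h2⟩ := horth j hj
          rw [Module.End.mul_apply, reflLin_of_orthogonal (u := T (v i) + v i) (by simp [h1, h2]),
            reflLin_of_orthogonal h2])
      have : T = reflLin (T (v i) + v i) * (reflLin (v i)
          * (reflLin (v i) * reflLin (T (v i) + v i) * T)) := by
        rw [← mul_assoc (reflLin (v i)), ← mul_assoc (reflLin (v i)), reflLin_mul_self (hvv i),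
          one_mul, ← mul_assoc, reflLin_mul_self hn', one_mul]
      rw [this]
      exact mul_mem (hP _ hn') (mul_mem (hP _ (hvv i)) hp)
    · have hp := step (reflLin (T (v i) - v i)) (form_reflLin hn)
        (reflLin_sub_apply (hT _ _) hn) (fun j hj => by
          obtain ⟨h1, h2⟩ := horth j hj
          rw [reflLin_of_orthogonal (by simp [h1, h2])])
      have : T = reflLin (T (v i) - v i) * (reflLin (T (v i) - v i) * T) := by
        rw [← mul_assoc, reflLin_mul_self hn, one_mul]
      rw [this]
      exact mul_mem (hP _ hn) hp

/-- In a hyperbolic plane the product of two reflections in vectors of the same sign is a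
dilation. -/
theorem exists_reflLin_mul_eq_dilLin {u v : Idx l → ℝ} (hs : 0 < form u u * form v v)
    (hg : form u u * form v v < form u v ^ 2) :
    ∃ (e e' : Idx l → ℝ) (a : ℝ), IsHyp e e' ∧ 0 < a ∧
      reflLin u * reflLin v = dilLin e e' a := by
  set q := form u u with hq
  set q' := form v v with hq'
  set p := form u v with hp
  have hvu : form v u = p := by rw [form_comm]
  obtain ⟨d, hd0, hd⟩ : ∃ d : ℝ, 0 < d ∧ d ^ 2 = p ^ 2 - q * q' :=
    ⟨√(p ^ 2 - q * q'), Real.sqrt_pos.mpr (by linarith), Real.sq_sqrt (by linarith)⟩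
  have hq0 : q ≠ 0 := left_ne_zero_of_mul hs.ne'
  have hq0' : q' ≠ 0 := right_ne_zero_of_mul hs.ne'
  -- The numbers `x` and `y` are the roots of the norm of `u + t v` as a quadratic in `t`, so they
  -- give the two isotropic lines. They have the same sign because their product is `q / q'`, and
  -- the factor of the dilation is their ratio.
  set x := (-p + d) / q' with hx
  set y := (-p - d) / q' with hy
  have hxy : x * y = q / q' := by
    rw [hx, hy]; field_simp; linear_combination -hd
  have hxy0 : 0 < x * y := by
    rw [hxy]
    rw [show q / q' = (q * q') / q' ^ 2 by field_simp]
    positivity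
  have hx0 : x ≠ 0 := left_ne_zero_of_mul hxy0.ne'
  have hy0 : y ≠ 0 := right_ne_zero_of_mul hxy0.ne'
  have hqx : q + 2 * x * p + x ^ 2 * q' = 0 := by
    rw [hx]; field_simp; linear_combination hd
  have hqy : q + 2 * y * p + y ^ 2 * q' = 0 := by
    rw [hy]; field_simp; linear_combination hd
  have hdxy : y - x = -(2 * d / q') := by rw [hx, hy]; field_simp; ring
  have hne : y - x ≠ 0 := by rw [hdxy]; exact neg_ne_zero.mpr (by positivity)
  set m := q + (x + y) * p + x * y * q' with hm
  have hmd : m = -2 * d ^ 2 / q' := by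
    rw [hm, hxy, show x + y = -2 * p / q' by rw [hx, hy]; field_simp; ring, hd]
    field_simp
    ring
  have hm0 : m ≠ 0 := by rw [hmd]; simp [hq0', hd0.ne']
  refine ⟨u + x • v, m⁻¹ • (u + y • v), y / x, ⟨?_, ?_, ?_⟩, ?_, ?_⟩
  · simp only [form_add_left, form_add_right, form_smul_left, form_smul_right, hvu, ← hq, ← hq',
      ← hp]
    linear_combination hqx
  · simp only [form_add_left, form_add_right, form_smul_left, form_smul_right, hvu, ← hq, ← hq',
      ← hp]
    linear_combination m⁻¹ ^ 2 * hqy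
  · simp only [form_add_left, form_add_right, form_smul_left, form_smul_right, hvu, ← hq, ← hq',
      ← hp]
    have : m⁻¹ * m = 1 := inv_mul_cancel₀ hm0
    rw [hm] at this ⊢
    linear_combination this
  · rw [show y / x = (x * y) / x ^ 2 by field_simp]
    positivity
  · refine LinearMap.ext fun z => funext fun i => ?_
    simp only [reflLin_apply, dilLin_apply, Module.End.mul_apply, form_sub_left, form_add_right,
      form_smul_left, form_smul_right, Pi.add_apply, Pi.sub_apply, Pi.smul_apply, smul_eq_mul,
      ← hq, ← hq', hvu]
    generalize form z u = zu
    generalize form z v = zv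
    generalize z i = zi
    generalize u i = ui
    generalize v i = vi
    have h1 : q = x * y * q' := by rw [hxy]; field_simp
    have h2 : p = -(x + y) * q' / 2 := by rw [hx, hy]; field_simp; ring
    have h3 : m = -(y - x) ^ 2 * q' / 2 := by
      rw [hmd, hdxy]; field_simp
    rw [h1, h2, h3]
    clear_value x y q'
    field_simp
    ring

end Reflections

-- Contracted elements, and reflections modulo a normal subgroup

section Normal

open Filter Topology

variable {l : ℕ}

/-- Conjugation by `g` rescales the parameter by `c`, so conjugating back `k` times moves it to `c⁻ᵏ
t`, which tends to zero. -/
theorem tendsto_conj_pow {γ : ℝ → SOId l} (hγ : Continuous γ) (h0 : γ 0 = 1) {g : SOId l} {c : ℝ}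
    (hc : 1 < c) (hg : ∀ t, g * γ t = γ (c * t) * g) (t : ℝ) :
    Tendsto (fun k : ℕ => (g ^ k)⁻¹ * γ t * g ^ k) atTop (𝓝 1) := by
  have hc0 : c ≠ 0 := by positivity
  have h1 : ∀ k : ℕ, (g ^ k)⁻¹ * γ t * g ^ k = γ (c⁻¹ ^ k * t) := by
    intro k
    induction k with
    | zero => simp
    | succ k ih =>
      have h2 := hg (c⁻¹ ^ (k + 1) * t)
      rw [show c * (c⁻¹ ^ (k + 1) * t) = c⁻¹ ^ k * t by rw [pow_succ]; field_simp] at h2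
      calc (g ^ (k + 1))⁻¹ * γ t * g ^ (k + 1) = g⁻¹ * ((g ^ k)⁻¹ * γ t * g ^ k) * g := by group
        _ = g⁻¹ * (γ (c⁻¹ ^ k * t) * g) := by rw [ih, mul_assoc]
        _ = _ := by rw [← h2, inv_mul_cancel_left]
  simp_rw [h1]
  have h3 : Tendsto (fun k : ℕ => c⁻¹ ^ k * t) atTop (𝓝 (0 * t)) :=
    (tendsto_pow_atTop_nhds_zero_of_lt_one (by positivity) (inv_lt_one_of_one_lt₀ hc)).mul_const t
  rw [zero_mul] at h3
  have h4 := (hγ.tendsto 0).comp h3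
  rwa [h0] at h4

/-- The subgroup contains every element that some conjugation contracts to the identity. -/
def ContainsContracted (K : Subgroup (SOId l)) : Prop :=
  ∀ g h : SOId l, Tendsto (fun k : ℕ => (g ^ k)⁻¹ * h * g ^ k) atTop (𝓝 1) → h ∈ K

/-- The dilation by two of the same hyperbolic pair expands the family containing `g`, so its
inverse powers contract `g`. -/
theorem IsHyp.eichler_mem {e e' b : Idx l → ℝ} (h : IsHyp e e') (hbe : form b e = 0)
    (hbe' : form b e' = 0) {K : Subgroup (SOId l)} (hK : ContainsContracted K) {g : SOId l}
    (hg : act (g : SO l) = eichLin e b) : g ∈ K := by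
  obtain ⟨γ, hγ, hγb⟩ := exists_eichler_family h.left hbe
  obtain ⟨d, hd⟩ := h.exists_dilation (a := 2) two_pos
  have hg1 : g = γ 1 := SOId_ext fun x => by rw [hg, hγb, one_smul]
  have hγ0 : γ 0 = 1 := SOId_ext fun x => by simp [hγb, eichLin_apply]
  rw [hg1]
  refine hK d _ (tendsto_conj_pow hγ hγ0 one_lt_two (fun t => SOId_ext fun x => ?_) 1)
  have h1 : act (d : SO l) e = (2 : ℝ) • e := by rw [hd, h.dilLin_left]
  have h2 : act (d : SO l) b = b := by rw [hd, dilLin_of_orthogonal _ hbe hbe']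
  simp only [Subgroup.coe_mul, act_mul_apply, hγb]
  rw [act_conj_eichLin, map_smul, h1, h2, eichLin_smul_left, smul_smul]

/-- The swap `w` of the two isotropic lines is a product of Eichler transformations, hence in `K`,
and it inverts dilations. With `d` the dilation by `√a`, the square `d * d` is therefore a product
of `w` and a conjugate of `w⁻¹`. -/
theorem IsHyp.dilation_mem {e e' : Idx l → ℝ} (h : IsHyp e e') (hl : 1 < l)
    {K : Subgroup (SOId l)} [hn : K.Normal] (hK : ContainsContracted K) {a : ℝ} (ha : 0 < a)
    {g : SOId l} (hg : act (g : SO l) = dilLin e e' a) : g ∈ K := by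
  obtain ⟨b, hbe, hbe', hb⟩ := h.exists_orthogonal hl
  obtain ⟨g₁, g₂, h₁, h₂, hwe, hwe', -⟩ := h.exists_swap hbe hbe' hb
  set w := g₁ * g₂ * g₁ with hw
  have hwK : w ∈ K := by
    have m₁ := h.eichler_mem hbe hbe' hK h₁
    have m₂ := h.symm.eichler_mem (b := (2 / form b b) • b) (by simp [hbe']) (by simp [hbe]) hK h₂
    exact mul_mem (mul_mem m₁ m₂) m₁
  obtain ⟨d, hd⟩ := h.exists_dilation (Real.sqrt_pos.mpr ha)
  have hs0 : √a ≠ 0 := (Real.sqrt_pos.mpr ha).ne'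
  have hc : -(2 / form b b) ≠ 0 := neg_ne_zero.mpr (div_ne_zero two_ne_zero hb)
  have hdwd : d * w * d = w := SOId_ext fun x => by
    simp only [Subgroup.coe_mul, act_mul_apply]
    rw [hd, act_conj_dilLin, hwe, hwe', dilLin_smul _ _ _ hc,
      dilLin_swap e e', ← Module.End.mul_apply, ← h.dilLin_mul hs0 (inv_ne_zero hs0),
      mul_inv_cancel₀ hs0]
    simp [dilLin_apply]
  have hgd : g = d * d := SOId_ext fun x => by
    rw [hg, Subgroup.coe_mul, map_mul, hd, ← h.dilLin_mul hs0 hs0, Real.mul_self_sqrt ha.le]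
  have h6 : d * d = w * (d⁻¹ * w⁻¹ * d) := by
    calc d * d = (d * w * d) * d⁻¹ * w⁻¹ * d := by group
      _ = _ := by rw [hdwd]; group
  rw [hgd, h6]
  refine mul_mem hwK ?_
  simpa using hn.conj_mem w⁻¹ (inv_mem hwK) d⁻¹

theorem exists_orthogonal_opposite (hl : 1 < l) {u : Idx l → ℝ} (hu : form u u ≠ 0) :
    ∃ v, form u v = 0 ∧ form v v * form u u < 0 := by
  rcases lt_or_gt_of_ne hu with h | h
  · obtain ⟨v, hv0, hv⟩ := exists_ne_zero_form_eq_zero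
      (Fin.cons u fun j : Fin l => Pi.single (Sum.inr j) 1 : Fin (l + 1) → Idx l → ℝ) (by omega)
    have h1 : form v u = 0 := hv 0
    have h2 : ∀ j, v (Sum.inr j) = 0 := fun j => by
      simpa [form_single_inr] using hv j.succ
    refine ⟨v, by rw [form_comm, h1], mul_neg_of_pos_of_neg ?_ h⟩
    have h3 : form v v = ∑ i, v (Sum.inl i) ^ 2 := by simp [form_eq_sum, h2, sq]
    rw [h3]
    refine lt_of_le_of_ne (Finset.sum_nonneg fun _ _ => sq_nonneg _) fun h0 => hv0 ?_
    ext (i | j)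
    · simpa using (Finset.sum_eq_zero_iff_of_nonneg fun _ _ => sq_nonneg _).mp h0.symm i
        (Finset.mem_univ i)
    · exact h2 j
  · obtain ⟨v, hv0, hv⟩ := exists_ne_zero_form_eq_zero
      (Fin.cons u fun j : Fin 2 => Pi.single (Sum.inl j) 1 : Fin 3 → Idx l → ℝ) (by omega)
    have h1 : form v u = 0 := hv 0
    have h2 : ∀ j, v (Sum.inl j) = 0 := fun j => by
      simpa [form_single_inl] using hv j.succ
    refine ⟨v, by rw [form_comm, h1], mul_neg_of_neg_of_pos ?_ h⟩
    have h3 : form v v = -∑ i, v (Sum.inr i) ^ 2 := by simp [form_eq_sum, h2, sq]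
    rw [h3, neg_lt_zero]
    refine lt_of_le_of_ne (Finset.sum_nonneg fun _ _ => sq_nonneg _) fun h0 => hv0 ?_
    ext (i | j)
    · exact h2 i
    · simpa using (Finset.sum_eq_zero_iff_of_nonneg fun _ _ => sq_nonneg _).mp h0.symm j
        (Finset.mem_univ j)

theorem exists_hyperbolic_partner (hl : 1 < l) {u : Idx l → ℝ} (hu : form u u ≠ 0) :
    ∃ v, 0 < form u u * form v v ∧ form u u * form v v < form u v ^ 2 := by
  obtain ⟨v, huv, hv⟩ := exists_orthogonal_opposite hl hu
  have hv0 : form v v ≠ 0 := left_ne_zero_of_mul hv.ne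
  have hpos : 0 < -(form u u / (2 * form v v)) := by
    have : form u u / (2 * form v v) = form v v * form u u / (2 * form v v ^ 2) := by field_simp
    rw [this, neg_pos]
    exact div_neg_of_neg_of_pos hv (by positivity)
  -- This size of `r` makes the norm of `u + r v` half that of `u` while its pairing with `u` stays
  -- `(u, u)`; then `q · q/2 < q²`.
  set r := √(-(form u u / (2 * form v v)))
  have hr : r ^ 2 = -(form u u / (2 * form v v)) := Real.sq_sqrt hpos.le
  have h1 : form (u + r • v) (u + r • v) = form u u / 2 := by
    simp only [form_add_left, form_add_right, form_smul_left, form_smul_right, huv, form_comm v u]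
    rw [show form u u + r * 0 + r * (0 + r * form v v) = form u u + r ^ 2 * form v v by ring,
      hr]
    field_simp
    ring
  have h2 : form u (u + r • v) = form u u := by simp [huv]
  have h3 : 0 < form u u ^ 2 := by positivity
  refine ⟨u + r • v, ?_, ?_⟩ <;> rw [h1] <;> [skip; rw [h2]] <;> linarith

/-- Two vectors of nonzero norm are equivalent if the product of their reflections belongs
to `K`. -/
def ReflRel (K : Subgroup (SOId l)) (u v : Idx l → ℝ) : Prop :=
  ∃ k ∈ K, act (k : SO l) = reflLin u * reflLin v

theorem ReflRel.symm {K : Subgroup (SOId l)} {u v : Idx l → ℝ} (hu : form u u ≠ 0)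
    (hv : form v v ≠ 0) (h : ReflRel K u v) : ReflRel K v u := by
  obtain ⟨k, hk, hkuv⟩ := h
  refine ⟨k⁻¹, inv_mem hk, ?_⟩
  have h1 : act (k : SO l) * (reflLin v * reflLin u) = 1 := by
    rw [hkuv, mul_assoc, ← mul_assoc (reflLin v), reflLin_mul_self hv, one_mul,
      reflLin_mul_self hu]
  calc act ((k⁻¹ : SOId l) : SO l)
      = act ((k⁻¹ : SOId l) : SO l) * (act (k : SO l) * (reflLin v * reflLin u)) := by
        rw [h1, mul_one]
    _ = reflLin v * reflLin u := by
        rw [← mul_assoc, ← map_mul, ← Subgroup.coe_mul, inv_mul_cancel, Subgroup.coe_one, map_one,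
          one_mul]

theorem ReflRel.trans {K : Subgroup (SOId l)} {u v w : Idx l → ℝ} (hv : form v v ≠ 0)
    (h : ReflRel K u v) (h' : ReflRel K v w) : ReflRel K u w := by
  obtain ⟨k, hk, hkuv⟩ := h
  obtain ⟨k', hk', hkvw⟩ := h'
  refine ⟨k * k', mul_mem hk hk', ?_⟩
  rw [Subgroup.coe_mul, map_mul, hkuv, hkvw, mul_assoc, ← mul_assoc (reflLin v),
    reflLin_mul_self hv, one_mul]

theorem reflRel_of_hyperbolic (hl : 1 < l) {K : Subgroup (SOId l)} [hn : K.Normal]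
    (hK : ContainsContracted K) {u v : Idx l → ℝ} (hs : 0 < form u u * form v v)
    (hg : form u u * form v v < form u v ^ 2) : ReflRel K u v := by
  obtain ⟨e, e', a, h, ha, hr⟩ := exists_reflLin_mul_eq_dilLin hs hg
  obtain ⟨g, hg⟩ := h.exists_dilation ha
  exact ⟨g, h.dilation_mem hl hK ha hg, by rw [hg, hr]⟩

theorem continuous_form_left (v : Idx l → ℝ) : Continuous fun u : Idx l → ℝ => form u v := by
  simp only [form_eq_sum]; fun_prop

theorem continuous_form_self : Continuous fun u : Idx l → ℝ => form u u := by
  simp only [form_eq_sum]; fun_prop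

/-- A hyperbolic partner `w` of `u` is still a partner of every nearby `v`, so `u` and `v` are both
equivalent to `w`. -/
theorem eventually_reflRel (hl : 1 < l) {K : Subgroup (SOId l)} [hn : K.Normal]
    (hK : ContainsContracted K) {u : Idx l → ℝ} (hu : form u u ≠ 0) :
    ∀ᶠ v in 𝓝 u, ReflRel K u v := by
  obtain ⟨w, h1, h2⟩ := exists_hyperbolic_partner hl hu
  have hw : form w w ≠ 0 := right_ne_zero_of_mul h1.ne'
  have e1 : ∀ᶠ v in 𝓝 u, 0 < form v v * form w w :=
    (continuous_form_self.mul continuous_const).continuousAt.eventually_const_lt h1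
  have e2 : ∀ᶠ v in 𝓝 u, form v v * form w w < form v w ^ 2 :=
    (continuous_form_self.mul continuous_const).continuousAt.eventually_lt
      ((continuous_form_left w).pow 2).continuousAt h2
  filter_upwards [e1, e2] with v hv1 hv2
  exact (reflRel_of_hyperbolic hl hK h1 h2).trans hw
    ((reflRel_of_hyperbolic hl hK hv1 hv2).symm (left_ne_zero_of_mul hv1.ne') hw)

theorem reflRel_of_isPreconnected (hl : 1 < l) {K : Subgroup (SOId l)} [hn : K.Normal]
    (hK : ContainsContracted K) {s : Set (Idx l → ℝ)} (hs : IsPreconnected s)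
    (hs0 : ∀ u ∈ s, form u u ≠ 0) {u v : Idx l → ℝ} (hu : u ∈ s) (hv : v ∈ s) : ReflRel K u v :=
  hs.induction₂ (ReflRel K)
    (fun u hu => (eventually_reflRel hl hK (hs0 u hu)).filter_mono nhdsWithin_le_nhds)
    (fun _ y _ _ hy _ h h' => h.trans (hs0 y hy) h')
    (fun x y hx hy h => h.symm (hs0 x hx) (hs0 y hy)) hu hv

/-- The relation is locally constant on vectors of nonzero norm. Shrinking the negative coordinates
retracts the positive vectors onto a punctured plane, which is connected. -/
theorem reflRel_of_pos (hl : 1 < l) {K : Subgroup (SOId l)} [hn : K.Normal]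
    (hK : ContainsContracted K) {u v : Idx l → ℝ} (hu : 0 < form u u) (hv : 0 < form v v) :
    ReflRel K u v := by
  let L : (Fin 2 → ℝ) →ₗ[ℝ] (Idx l → ℝ) :=
    { toFun x := Sum.elim x 0
      map_add' x y := by ext (i | i) <;> simp
      map_smul' a x := by ext (i | i) <;> simp }
  have hL : ∀ x, form (L x) (L x) = ∑ i, x i ^ 2 := fun x => by simp [L, form_eq_sum, sq]
  have hL0 : ∀ x : Fin 2 → ℝ, x ≠ 0 → form (L x) (L x) ≠ 0 := fun x hx h0 => hx <| funext fun i => by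
    rw [hL] at h0
    simpa using (Finset.sum_eq_zero_iff_of_nonneg fun _ _ => sq_nonneg _).mp h0 i
        (Finset.mem_univ i)
  have hproj : ∀ u : Idx l → ℝ, 0 < form u u →
      (u ∘ Sum.inl ≠ 0) ∧ ReflRel K u (L (u ∘ Sum.inl)) := fun u hu => by
    have hu' : 0 < ∑ i, u (Sum.inl i) ^ 2 - ∑ j, u (Sum.inr j) ^ 2 := by
      simpa [form_eq_sum, sq] using hu
    have h2 : 0 ≤ ∑ j, u (Sum.inr j) ^ 2 := Finset.sum_nonneg fun _ _ => sq_nonneg _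
    refine ⟨fun h0 => ?_, ?_⟩
    · have h1 : ∀ i, u (Sum.inl i) = 0 := fun i => congrFun h0 i
      simp only [h1] at hu'
      norm_num at hu'
      linarith
    · refine reflRel_of_isPreconnected hl hK (convex_segment u (L (u ∘ Sum.inl))).isPreconnected
        ?_ (left_mem_segment _ _ _) (right_mem_segment _ _ _)
      rintro _ ⟨a, b, ha, hb, hab, rfl⟩
      have h3 : form (a • u + b • L (u ∘ Sum.inl)) (a • u + b • L (u ∘ Sum.inl))
          = ∑ i, u (Sum.inl i) ^ 2 - a ^ 2 * ∑ j, u (Sum.inr j) ^ 2 := by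
        rw [form_eq_sum, Finset.mul_sum]
        congr 1
        · refine Finset.sum_congr rfl fun i _ => ?_
          simp only [L, LinearMap.coe_mk, AddHom.coe_mk, Pi.add_apply, Pi.smul_apply, smul_eq_mul,
            Sum.elim_inl, Function.comp_apply, ← add_mul, hab]
          ring
        · refine Finset.sum_congr rfl fun i _ => ?_
          simp only [L, LinearMap.coe_mk, AddHom.coe_mk, Pi.add_apply, Pi.smul_apply, smul_eq_mul,
            Sum.elim_inr, Pi.zero_apply]
          ring
      have h4 : a ^ 2 ≤ 1 := pow_le_one₀ ha (by linarith)
      rw [h3]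
      have := mul_le_of_le_one_left h2 h4
      linarith
  have hc : IsPreconnected (L '' {0}ᶜ) :=
    (isConnected_compl_singleton_of_one_lt_rank (by simp) 0).isPreconnected.image _
      L.continuous_of_finiteDimensional.continuousOn
  obtain ⟨hu1, hu2⟩ := hproj u hu
  obtain ⟨hv1, hv2⟩ := hproj v hv
  have huv := reflRel_of_isPreconnected hl hK hc (by rintro _ ⟨x, hx, rfl⟩; exact hL0 x hx)
    ⟨_, hu1, rfl⟩ ⟨_, hv1, rfl⟩
  exact (hu2.trans (hL0 _ hu1) huv).trans (hL0 _ hv1) (hv2.symm hv.ne' (hL0 _ hv1))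

/-- Here the retraction goes to a punctured space of dimension `l`, which is connected since `l >
1`. -/
theorem reflRel_of_neg (hl : 1 < l) {K : Subgroup (SOId l)} [hn : K.Normal]
    (hK : ContainsContracted K) {u v : Idx l → ℝ} (hu : form u u < 0) (hv : form v v < 0) :
    ReflRel K u v := by
  let L : (Fin l → ℝ) →ₗ[ℝ] (Idx l → ℝ) :=
    { toFun x := Sum.elim 0 x
      map_add' x y := by ext (i | i) <;> simp
      map_smul' a x := by ext (i | i) <;> simp }
  have hL : ∀ x, form (L x) (L x) = -∑ i, x i ^ 2 := fun x => by simp [L, form_eq_sum, sq]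
  have hL0 : ∀ x : Fin l → ℝ, x ≠ 0 → form (L x) (L x) ≠ 0 := fun x hx h0 => hx <| funext fun i => by
    rw [hL, neg_eq_zero] at h0
    simpa using (Finset.sum_eq_zero_iff_of_nonneg fun _ _ => sq_nonneg _).mp h0 i
        (Finset.mem_univ i)
  have hproj : ∀ u : Idx l → ℝ, form u u < 0 →
      (u ∘ Sum.inr ≠ 0) ∧ ReflRel K u (L (u ∘ Sum.inr)) := fun u hu => by
    have hu' : ∑ i, u (Sum.inl i) ^ 2 - ∑ j, u (Sum.inr j) ^ 2 < 0 := by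
      simpa [form_eq_sum, sq] using hu
    have h2 : 0 ≤ ∑ j, u (Sum.inl j) ^ 2 := Finset.sum_nonneg fun _ _ => sq_nonneg _
    refine ⟨fun h0 => ?_, ?_⟩
    · have h1 : ∀ i, u (Sum.inr i) = 0 := fun i => congrFun h0 i
      rw [Finset.sum_eq_zero (f := fun j => u (Sum.inr j) ^ 2) (fun j _ => by simp [h1])] at hu'
      linarith
    · refine reflRel_of_isPreconnected hl hK (convex_segment u (L (u ∘ Sum.inr))).isPreconnected
        ?_ (left_mem_segment _ _ _) (right_mem_segment _ _ _)
      rintro _ ⟨a, b, ha, hb, hab, rfl⟩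
      have h3 : form (a • u + b • L (u ∘ Sum.inr)) (a • u + b • L (u ∘ Sum.inr))
          = a ^ 2 * ∑ i, u (Sum.inl i) ^ 2 - ∑ j, u (Sum.inr j) ^ 2 := by
        rw [form_eq_sum, Finset.mul_sum]
        congr 1
        · refine Finset.sum_congr rfl fun i _ => ?_
          simp only [L, LinearMap.coe_mk, AddHom.coe_mk, Pi.add_apply, Pi.smul_apply, smul_eq_mul,
            Sum.elim_inl, Pi.zero_apply]
          ring
        · refine Finset.sum_congr rfl fun i _ => ?_
          simp only [L, LinearMap.coe_mk, AddHom.coe_mk, Pi.add_apply, Pi.smul_apply, smul_eq_mul,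
            Sum.elim_inr, Function.comp_apply, ← add_mul, hab]
          ring
      have h4 : a ^ 2 ≤ 1 := pow_le_one₀ ha (by linarith)
      rw [h3]
      have := mul_le_of_le_one_left h2 h4
      linarith
  have hc : IsPreconnected (L '' {0}ᶜ) :=
    (isConnected_compl_singleton_of_one_lt_rank (by simpa using hl) 0).isPreconnected.image _
      L.continuous_of_finiteDimensional.continuousOn
  obtain ⟨hu1, hu2⟩ := hproj u hu
  obtain ⟨hv1, hv2⟩ := hproj v hv
  have huv := reflRel_of_isPreconnected hl hK hc (by rintro _ ⟨x, hx, rfl⟩; exact hL0 x hx)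
    ⟨_, hu1, rfl⟩ ⟨_, hv1, rfl⟩
  exact (hu2.trans (hL0 _ hu1) huv).trans (hL0 _ hv1) (hv2.symm hv.ne (hL0 _ hv1))

end Normal

-- Generation of the identity component, and the two cosets

section Generation

open Filter Topology

variable {l : ℕ}

theorem form_single_self_inl (i : Fin 2) :
    form (Pi.single (Sum.inl i) 1 : Idx l → ℝ) (Pi.single (Sum.inl i) 1) = 1 := by
  simp [form_single_inl]

theorem form_single_self_inr (i : Fin l) :
    form (Pi.single (Sum.inr i) 1 : Idx l → ℝ) (Pi.single (Sum.inr i) 1) = -1 := by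
  simp [form_single_inr]

theorem det_reflLin_single (i : Idx l) :
    LinearMap.det (reflLin (Pi.single i (1 : ℝ))) = -1 := by
  have h : reflLin (Pi.single i (1 : ℝ))
      = Matrix.toLin' (Matrix.diagonal (Function.update (fun _ => (1 : ℝ)) i (-1))) := by
    refine LinearMap.ext fun x => funext fun j => ?_
    have h2 : 2 / form (Pi.single i (1 : ℝ)) (Pi.single i 1) * form x (Pi.single i 1)
        = 2 * x i := by
      rcases i with i | i
      · simp [form_single_inl]
      · rw [form_single_self_inr, form_single_inr]; ring
    rw [reflLin_apply, h2, Matrix.toLin'_apply, Matrix.mulVec_diagonal]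
    by_cases hj : j = i
    · subst hj; simp; ring
    · simp [hj]
  rw [h, LinearMap.det_toLin', Matrix.det_diagonal, Finset.prod_update_of_mem (Finset.mem_univ i)]
  simp

/-- The determinant of the upper left block of size two. -/
def blockDet (T : Module.End ℝ (Idx l → ℝ)) : ℝ :=
  T (Pi.single (Sum.inl 0) 1) (Sum.inl 0) * T (Pi.single (Sum.inl 1) 1) (Sum.inl 1)
    - T (Pi.single (Sum.inl 0) 1) (Sum.inl 1) * T (Pi.single (Sum.inl 1) 1) (Sum.inl 0)

/-- A singular block would yield a nonzero vector of the positive coordinate plane whose image has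
no positive coordinates, while its norm is preserved. -/
theorem blockDet_ne_zero {T : Module.End ℝ (Idx l → ℝ)}
    (hT : ∀ x y, form (T x) (T y) = form x y) : blockDet T ≠ 0 := by
  intro h
  set u : Idx l → ℝ := Pi.single (Sum.inl 0) 1
  set v : Idx l → ℝ := Pi.single (Sum.inl 1) 1
  have huu : form u u = 1 := form_single_self_inl 0
  have hvv : form v v = 1 := form_single_self_inl 1
  have huv : form u v = 0 := by simp [u, v, form_single_inl]
  have key : ∀ a b : ℝ, a * T u (Sum.inl 0) + b * T v (Sum.inl 0) = 0 →
      a * T u (Sum.inl 1) + b * T v (Sum.inl 1) = 0 → a ^ 2 + b ^ 2 ≤ 0 := by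
    intro a b h0 h1
    have e1 : form (T (a • u + b • v)) (T (a • u + b • v)) = a ^ 2 + b ^ 2 := by
      rw [hT]
      simp only [form_add_left, form_add_right, form_smul_left, form_smul_right, huu, hvv, huv,
        form_comm v u]
      ring
    rw [← e1, form_eq_sum]
    have e2 : ∑ i : Fin 2, T (a • u + b • v) (Sum.inl i) * T (a • u + b • v) (Sum.inl i) = 0 := by
      simp [Fin.sum_univ_two, h0, h1]
    rw [e2, zero_sub, neg_nonpos]
    exact Finset.sum_nonneg fun _ _ => mul_self_nonneg _
  unfold blockDet at h
  have k1 := key (T v (Sum.inl 1)) (-T u (Sum.inl 1)) (by linarith) (by ring)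
  have k2 := key (T v (Sum.inl 0)) (-T u (Sum.inl 0)) (by ring) (by linarith)
  have z1 : T v (Sum.inl 1) = 0 := by nlinarith [sq_nonneg (T u (Sum.inl 1))]
  have z2 : T v (Sum.inl 0) = 0 := by nlinarith [sq_nonneg (T u (Sum.inl 0))]
  have k3 := key 0 1 (by simp [z2]) (by simp [z1])
  norm_num at k3

theorem blockDet_pos (g : SOId l) : 0 < blockDet (act (g : SO l)) := by
  have hc : Continuous fun g : SO l => blockDet (act g) := by
    have h (x : Idx l → ℝ) (i : Idx l) : Continuous fun g : SO l => act g x i :=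
      (continuous_apply i).comp (continuous_act x)
    exact ((h _ _).mul (h _ _)).sub ((h _ _).mul (h _ _))
  have hconn : IsPreconnected (SOId l : Set (SO l)) := isPreconnected_connectedComponent
  by_contra! hneg
  obtain ⟨k, -, hk⟩ := hconn.intermediate_value₂ g.2 (one_mem (SOId l)) hc.continuousOn
    continuousOn_const (hneg.trans le_rfl) (show (0 : ℝ) ≤ _ by simp [blockDet])
  exact blockDet_ne_zero (form_act k) hk

/-- Modulo `K` a reflection depends only on the sign of its vector. A product of reflections thus
reduces to an element of the four-group generated by one positive and one negative reflection, and
determinant one leaves only two of its elements. -/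
theorem mem_or_mem_mul (hl : 1 < l) {K : Subgroup (SOId l)} [hn : K.Normal]
    (hK : ContainsContracted K) (j : Fin l) (T : Module.End ℝ (Idx l → ℝ))
    (hT : ∀ x y, form (T x) (T y) = form x y) (hdet : LinearMap.det T = 1) :
    ∃ k ∈ K, T = act (k : SO l) ∨ T = act (k : SO l) *
      (reflLin (Pi.single (Sum.inl 0) 1) * reflLin (Pi.single (Sum.inr j) 1)) := by
  set p : Idx l → ℝ := Pi.single (Sum.inl 0) 1
  set q : Idx l → ℝ := Pi.single (Sum.inr j) 1
  have hp : form p p = 1 := form_single_self_inl 0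
  have hq : form q q = -1 := form_single_self_inr j
  have hp0 : form p p ≠ 0 := by rw [hp]; norm_num
  have hq0 : form q q ≠ 0 := by rw [hq]; norm_num
  have hqp : form q p = 0 := by simp [p, q, form_single_inl]
  set s := reflLin p
  set t := reflLin q
  have hss : s * s = 1 := reflLin_mul_self hp0
  have htt : t * t = 1 := reflLin_mul_self hq0
  have hst : s * t = t * s := by
    rw [mul_reflLin (form_reflLin hp0), reflLin_of_orthogonal hqp]
  have hs : ∀ x y, form (s x) (s y) = form x y := form_reflLin hp0
  have ht : ∀ x y, form (t x) (t y) = form x y := form_reflLin hq0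
  let W : Set (Module.End ℝ (Idx l → ℝ)) := {1, s, t, s * t}
  have hWiso : ∀ w ∈ W, ∀ x y, form (w x) (w y) = form x y := by
    rintro w (rfl | rfl | rfl | rfl) x y
    · rfl
    · exact hs x y
    · exact ht x y
    · rw [Module.End.mul_apply, Module.End.mul_apply, hs, ht]
  have hsW : ∀ w ∈ W, s * w ∈ W := by
    rintro w (rfl | rfl | rfl | rfl)
    · simp [W]
    · simp [W, hss]
    · simp [W]
    · rw [← mul_assoc, hss]; simp [W]
  have htW : ∀ w ∈ W, t * w ∈ W := by
    rintro w (rfl | rfl | rfl | rfl)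
    · simp [W]
    · rw [← hst]; simp [W]
    · simp [W, htt]
    · rw [hst, ← mul_assoc, htt]; simp [W]
  have hword : ∃ k ∈ K, ∃ w ∈ W, T = act (k : SO l) * w := by
    have hmem := mem_closure_reflLin T hT
    clear hT hdet
    induction hmem using Submonoid.closure_induction_right with
    | one => exact ⟨1, one_mem _, 1, by simp [W], by simp⟩
    | mul_right S hS y hy ih =>
      obtain ⟨k, hk, w, hw, rfl⟩ := ih
      obtain ⟨u, hu, rfl⟩ := hy
      have hwu : form (w u) (w u) ≠ 0 := by rwa [hWiso w hw]
      have h1 : act (k : SO l) * w * reflLin u = act (k : SO l) * (reflLin (w u) * w) := by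
        rw [mul_assoc, mul_reflLin (hWiso w hw)]
      rcases lt_or_gt_of_ne hwu with h | h
      · obtain ⟨k', hk', h2⟩ := reflRel_of_neg hl hK h (show form q q < 0 by rw [hq]; norm_num)
        refine ⟨k * k', mul_mem hk hk', t * w, htW w hw, ?_⟩
        rw [h1, Subgroup.coe_mul, map_mul, h2, mul_assoc, mul_assoc, ← mul_assoc (reflLin q), htt,
          one_mul]
      · obtain ⟨k', hk', h2⟩ := reflRel_of_pos hl hK h (show 0 < form p p by rw [hp]; norm_num)
        refine ⟨k * k', mul_mem hk hk', s * w, hsW w hw, ?_⟩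
        rw [h1, Subgroup.coe_mul, map_mul, h2, mul_assoc, mul_assoc, ← mul_assoc (reflLin p), hss,
          one_mul]
  obtain ⟨k, hk, w, hw, rfl⟩ := hword
  have hs1 : LinearMap.det s = -1 := det_reflLin_single _
  have ht1 : LinearMap.det t = -1 := det_reflLin_single _
  rw [map_mul, det_act, one_mul] at hdet
  rcases hw with rfl | rfl | rfl | rfl
  · exact ⟨k, hk, Or.inl (by simp)⟩
  · rw [hs1] at hdet; norm_num at hdet
  · rw [ht1] at hdet; norm_num at hdet
  · exact ⟨k, hk, Or.inr rfl⟩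

theorem blockDet_mul_reflLin (T : Module.End ℝ (Idx l → ℝ)) (j : Fin l) :
    blockDet (T * (reflLin (Pi.single (Sum.inl 0) 1) * reflLin (Pi.single (Sum.inr j) 1)))
      = -blockDet T := by
  have h1 : (reflLin (Pi.single (Sum.inl 0) 1) * reflLin (Pi.single (Sum.inr j) 1) :
      Module.End ℝ (Idx l → ℝ)) (Pi.single (Sum.inl 0) 1 : Idx l → ℝ) = -Pi.single (Sum.inl 0) 1 := by
    rw [Module.End.mul_apply, reflLin_of_orthogonal (u := Pi.single (Sum.inr j) 1)
      (by simp [form_single_inr]), reflLin_self (by simp [form_single_inl])]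
  have h2 : (reflLin (Pi.single (Sum.inl 0) 1) * reflLin (Pi.single (Sum.inr j) 1) :
      Module.End ℝ (Idx l → ℝ)) (Pi.single (Sum.inl 1) 1 : Idx l → ℝ) = Pi.single (Sum.inl 1) 1 := by
    rw [Module.End.mul_apply, reflLin_of_orthogonal (u := Pi.single (Sum.inr j) 1)
      (by simp [form_single_inr]), reflLin_of_orthogonal (by simp [form_single_inl])]
  unfold blockDet
  simp only [Module.End.mul_apply] at h1 h2 ⊢
  simp only [h1, h2, map_neg, Pi.neg_apply]
  ring

/-- A normal subgroup of `SO₀(2, l)`, `l > 1`, that contains all contracted elements is the whole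
group. -/
theorem eq_top_of_containsContracted (hl : 1 < l) {K : Subgroup (SOId l)} [hn : K.Normal]
    (hK : ContainsContracted K) : K = ⊤ := by
  rw [eq_top_iff]
  intro g _
  obtain ⟨k, hk, h | h⟩ := mem_or_mem_mul hl hK ⟨0, by omega⟩ (act (g : SO l)) (form_act _)
    (det_act _)
  · rwa [SOId_ext fun x => LinearMap.congr_fun h x]
  · have h1 := blockDet_pos g
    rw [h, blockDet_mul_reflLin] at h1
    have h2 := blockDet_pos k
    linarith

/-- `SO(2, l)` is the union of two cosets of its identity component. -/
theorem exists_SOId_mul (hl : 1 < l) (j : Fin l) (g : SO l) : ∃ k : SOId l,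
    g = k ∨ act g = act (k : SO l) *
      (reflLin (Pi.single (Sum.inl 0) 1) * reflLin (Pi.single (Sum.inr j) 1)) := by
  obtain ⟨k, -, h | h⟩ := mem_or_mem_mul hl (K := (⊤ : Subgroup (SOId l)))
    (fun _ _ _ => Subgroup.mem_top _) j (act g) (form_act _) (det_act _)
  · exact ⟨k, Or.inl (act_injective h)⟩
  · exact ⟨k, Or.inr h⟩

end Generation

-- Continuous one-parameter groups are exponentials

section OneParameter

open Filter Topology MeasureTheory

variable {𝔸 : Type*} [NormedRing 𝔸] [NormedAlgebra ℝ 𝔸] [CompleteSpace 𝔸]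

/-- A continuous one-parameter group in a Banach algebra is differentiable. -/
theorem differentiable_of_one_parameter {γ : ℝ → 𝔸} (hγ : Continuous γ) (h0 : γ 0 = 1)
    (hadd : ∀ s t, γ (s + t) = γ s * γ t) : Differentiable ℝ γ := by
  let Φ : ℝ → 𝔸 := fun t => ∫ s in (0 : ℝ)..t, γ s
  have hΦ : ∀ t, HasDerivAt Φ (γ t) t := fun t =>
    intervalIntegral.integral_hasDerivAt_right (hγ.intervalIntegrable _ _)
      hγ.aestronglyMeasurable.stronglyMeasurableAtFilter hγ.continuousAt
  have hslope : Tendsto (fun t : ℝ => t⁻¹ • Φ t) (𝓝[≠] 0) (𝓝 1) := by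
    have := (hΦ 0).tendsto_slope_zero
    simpa [Φ, h0] using this
  have hunit : ∀ᶠ t : ℝ in 𝓝[≠] 0, IsUnit (t⁻¹ • Φ t) :=
    hslope.eventually (Units.nhds 1)
  -- The mean of `γ` over a short interval is close to the identity, hence invertible. Dividing by
  -- it expresses `γ` through its own primitive, which is differentiable.
  obtain ⟨a, ha, ha0⟩ := (hunit.and self_mem_nhdsWithin).exists
  obtain ⟨u, hu⟩ : IsUnit (Φ a) := by
    have := (IsUnit.mk0 a ha0).map (algebraMap ℝ 𝔸) |>.mul ha
    rwa [← Algebra.smul_def, smul_smul, mul_inv_cancel₀ ha0, one_smul] at this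
  have key : ∀ t, γ t = (Φ (t + a) - Φ t) * ↑u⁻¹ := by
    intro t
    rw [Units.eq_mul_inv_iff_mul_eq, hu]
    have h1 : Φ (t + a) - Φ t = ∫ s in t..(t + a), γ s :=
      intervalIntegral.integral_interval_sub_left (hγ.intervalIntegrable _ _)
        (hγ.intervalIntegrable _ _)
    have h2 : ∫ s in (0 : ℝ)..a, γ (t + s) = ∫ s in t..(t + a), γ s := by
      rw [intervalIntegral.integral_comp_add_left γ t, add_zero]
    rw [h1, ← h2]
    simp_rw [hadd]
    exact ((ContinuousLinearMap.mul ℝ 𝔸 (γ t)).intervalIntegral_comp_comm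
      (hγ.intervalIntegrable _ _)).symm
  have hfun : γ = fun t => (Φ (t + a) - Φ t) * ↑u⁻¹ := funext key
  rw [hfun]
  intro t
  exact ((((hΦ (t + a)).comp_add_const t a).sub (hΦ t)).mul_const (↑u⁻¹ : 𝔸)).differentiableAt

/-- A continuous one-parameter group in a Banach algebra is an exponential. -/
theorem eq_exp_of_one_parameter {γ : ℝ → 𝔸} (hγ : Continuous γ) (h0 : γ 0 = 1)
    (hadd : ∀ s t, γ (s + t) = γ s * γ t) (t : ℝ) :
    γ t = NormedSpace.exp (t • deriv γ 0) := by
  have hd := differentiable_of_one_parameter hγ h0 hadd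
  set X := deriv γ 0
  have h1 : ∀ t, HasDerivAt γ (γ t * X) t := fun t => by
    have h2 : HasDerivAt (fun s => γ t * γ (s - t)) (γ t * X) t := by
      have h3 : HasDerivAt (fun s => γ (s - t)) X t := by
        have h4 : HasDerivAt γ X (t - t) := by rw [sub_self]; exact (hd 0).hasDerivAt
        exact h4.comp_sub_const t t
      exact h3.const_mul (γ t)
    refine h2.congr_of_eventuallyEq (Eventually.of_forall fun s => ?_)
    simp only [← hadd, add_sub_cancel]
  -- Uniqueness for the equation `γ' = γ X`: the quotient by the exponential is constant.
  have h2 : ∀ t, HasDerivAt (fun s : ℝ => γ s * NormedSpace.exp (s • -X)) 0 t := fun t => by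
    have h3 : HasDerivAt (fun s : ℝ => γ s * NormedSpace.exp (s • -X)) _ t :=
      (h1 t).mul (hasDerivAt_exp_smul_const (𝕂 := ℝ) (-X) t)
    have h4 : Commute (-X) (NormedSpace.exp (t • -X)) :=
      ((Commute.refl (-X)).smul_right t).exp_right
    refine h3.congr_deriv ?_
    rw [← h4.eq]
    noncomm_ring
  have h3 : γ t * NormedSpace.exp (t • -X) = 1 := by
    have := is_const_of_deriv_eq_zero (fun t => (h2 t).differentiableAt) (fun t => (h2 t).deriv) t 0
    simpa [h0] using this
  have h4 : NormedSpace.exp (t • -X) * NormedSpace.exp (t • X) = 1 := by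
    let : NormedAlgebra ℚ 𝔸 := NormedAlgebra.restrictScalars ℚ ℝ 𝔸
    rw [smul_neg, ← NormedSpace.exp_add_of_commute (Commute.neg_left (Commute.refl _)),
      neg_add_cancel, NormedSpace.exp_zero]
  calc γ t = γ t * (NormedSpace.exp (t • -X) * NormedSpace.exp (t • X)) := by rw [h4, mul_one]
    _ = _ := by rw [← mul_assoc, h3, one_mul]

end OneParameter

-- Contracted elements act trivially on definite spaces

section Contraction

open Filter Topology

variable {l n : ℕ}

theorem continuous_herm_self :
    Continuous fun v : Idx n → ℂ => (form (star v) v).re := by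
  simp only [form_eq_sum, Pi.star_apply]
  fun_prop

/-- Compactness of the unit sphere of `W` gives the constant; it makes the orbits of isometries in
`W` bounded. -/
theorem form_neg_bound {W : Submodule ℂ (Idx n → ℂ)}
    (hW : ∀ v ∈ W, v ≠ 0 → (form (star v) v).re < 0) :
    ∃ c > 0, ∀ v ∈ W, c * ‖v‖ ^ 2 ≤ -(form (star v) v).re := by
  have hcomp : IsCompact ((W : Set (Idx n → ℂ)) ∩ Metric.sphere 0 1) :=
    (isCompact_sphere 0 1).inter_left W.closed_of_finiteDimensional
  rcases ((W : Set (Idx n → ℂ)) ∩ Metric.sphere 0 1).eq_empty_or_nonempty with he | hne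
  · refine ⟨1, one_pos, fun v hv => ?_⟩
    by_cases hv0 : v = 0
    · simp [hv0]
    · exfalso
      have hn : ‖v‖ ≠ 0 := norm_ne_zero_iff.mpr hv0
      have : ((‖v‖ : ℂ)⁻¹ • v) ∈ (W : Set (Idx n → ℂ)) ∩ Metric.sphere 0 1 :=
        ⟨W.smul_mem _ hv, by simp [norm_smul, hn]⟩
      rw [he] at this
      exact this
  · obtain ⟨v₀, hv₀, hmin⟩ := hcomp.exists_isMinOn hne
      (f := fun v => -(form (star v) v).re) continuous_herm_self.neg.continuousOn
    have hv₀0 : v₀ ≠ 0 := by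
      rintro rfl
      simpa using hv₀.2
    refine ⟨-(form (star v₀) v₀).re, neg_pos.mpr (hW v₀ hv₀.1 hv₀0), fun v hv => ?_⟩
    by_cases hv0 : v = 0
    · simp [hv0]
    · have hn : ‖v‖ ≠ 0 := norm_ne_zero_iff.mpr hv0
      have hm : ((‖v‖ : ℂ)⁻¹ • v) ∈ (W : Set (Idx n → ℂ)) ∩ Metric.sphere 0 1 :=
        ⟨W.smul_mem _ hv, by simp [norm_smul, hn]⟩
      have h1 := hmin hm
      simp only [Set.mem_ofPred_eq] at h1
      have h2 : form (star ((‖v‖ : ℂ)⁻¹ • v)) ((‖v‖ : ℂ)⁻¹ • v)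
          = ((‖v‖⁻¹ ^ 2 : ℝ) : ℂ) * form (star v) v := by
        simp only [star_smul, form_smul_left, form_smul_right, Complex.star_def, map_inv₀,
          Complex.conj_ofReal]
        push_cast
        ring
      rw [h2, Complex.re_ofReal_mul] at h1
      calc -(form (star v₀) v₀).re * ‖v‖ ^ 2 ≤ -(‖v‖⁻¹ ^ 2 * (form (star v) v).re) * ‖v‖ ^ 2 := by
            gcongr
        _ = _ := by field_simp

/-- An element that is contracted to the identity acts trivially on every invariant negative
definite subspace. -/
theorem cact_eq_self_of_contracted {ρ : SOId l →* SO n} (hρ : Continuous ρ)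
    {W : Submodule ℂ (Idx n → ℂ)} (hW : ∀ v ∈ W, v ≠ 0 → (form (star v) v).re < 0)
    {g h : SOId l} (hgW : ∀ v ∈ W, cact (ρ g)⁻¹ v ∈ W) (hhW : ∀ v ∈ W, cact (ρ h) v ∈ W)
    (hlim : Tendsto (fun k : ℕ => (g ^ k)⁻¹ * h * g ^ k) atTop (𝓝 1)) :
    ∀ v ∈ W, cact (ρ h) v = v := by
  intro v hv
  obtain ⟨c, hc, hcW⟩ := form_neg_bound hW
  have hgk : ∀ k : ℕ, cact (ρ (g ^ k))⁻¹ v ∈ W := by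
    intro k
    induction k with
    | zero => simpa using hv
    | succ k ih =>
      have := hgW _ ih
      rw [← cact_mul_apply] at this
      convert this using 2
      rw [pow_succ, map_mul, mul_inv_rev]
  set d := cact (ρ h) v - v with hd
  have hdW : d ∈ W := W.sub_mem (hhW v hv) hv
  by_contra hne
  have hd0 : d ≠ 0 := sub_ne_zero.mpr hne
  have hneg := hW d hdW hd0
  have hbound : ∀ k : ℕ, ‖cact (ρ (g ^ k))⁻¹ v‖ ≤ √(-(form (star v) v).re / c) := by
    intro k
    have h1 := hcW _ (hgk k)
    rw [star_cact, form_cact] at h1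
    refine Real.le_sqrt_of_sq_le ?_
    rw [le_div_iff₀ hc]
    linarith
  have h1 : Tendsto (fun k : ℕ => cact (ρ ((g ^ k)⁻¹ * h * g ^ k)) - 1) atTop (𝓝 0) := by
    have := ((continuous_cact.comp hρ).tendsto 1).comp hlim
    have h2 := this.sub_const 1
    simpa using h2
  -- The vectors `g⁻ᵏ d` are the images of the bounded sequence `g⁻ᵏ v` under operators tending to
  -- zero. Their Hermitian norm is nevertheless that of `d`, so it vanishes, and definiteness gives
  -- `d = 0`.
  have h2 : Tendsto (fun k : ℕ => cact (ρ (g ^ k))⁻¹ d) atTop (𝓝 0) := by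
    have h3 : ∀ k : ℕ, cact (ρ (g ^ k))⁻¹ d
        = (cact (ρ ((g ^ k)⁻¹ * h * g ^ k)) - 1) (cact (ρ (g ^ k))⁻¹ v) := by
      intro k
      rw [hd, map_sub, sub_apply, ← cact_mul_apply, ← cact_mul_apply]
      simp [mul_assoc]
    rw [tendsto_zero_iff_norm_tendsto_zero]
    have h4 := h1.norm.mul_const (√(-(form (star v) v).re / c))
    rw [norm_zero, zero_mul] at h4
    refine squeeze_zero (fun _ => norm_nonneg _) (fun k => ?_) h4
    rw [h3]
    exact (ContinuousLinearMap.le_opNorm _ _).trans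
      (mul_le_mul_of_nonneg_left (hbound k) (norm_nonneg _))
  have h3 := (continuous_herm_self.tendsto 0).comp h2
  have h4 : ∀ k : ℕ, (form (star (cact (ρ (g ^ k))⁻¹ d)) (cact (ρ (g ^ k))⁻¹ d)).re
      = (form (star d) d).re := fun k => by rw [star_cact, form_cact]
  have h5 : Tendsto (fun _ : ℕ => (form (star d) d).re) atTop (𝓝 0) := by
    have h0 : (form (star (0 : Idx n → ℂ)) 0).re = 0 := by simp
    rw [h0] at h3
    exact h3.congr h4
  exact hneg.ne (tendsto_nhds_unique tendsto_const_nhds h5)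

/-- If `ρ g` and `ρ h` fix a point of the symmetric space and `h` is contracted to the identity
by `g`, then `ρ h` is trivial. -/
theorem eq_one_of_contracted {ρ : SOId l →* SO n} (hρ : Continuous ρ) {z : Idx n → ℂ}
    (hz : z ∈ cone n) {g h : SOId l} {a b : ℂ} (hg : cact (ρ g) z = a • z)
    (hh : cact (ρ h) z = b • z)
    (hlim : Tendsto (fun k : ℕ => (g ^ k)⁻¹ * h * g ^ k) atTop (𝓝 1)) : ρ h = 1 := by
  have hz0 := ne_zero_of_mem_cone hz
  have hzz : form z z = 0 := hz.1
  have hszs : form (star z) (star z) = 0 := by rw [form_star, hzz, star_zero]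
  have hpos : 0 < (form (star z) z).re := hz.2
  have hne : form (star z) z ≠ 0 := fun h => by simp [h] at hpos
  have ha : a ≠ 0 := by
    rintro rfl
    rw [zero_smul] at hg
    exact hz0 (by rw [← cact_inv_apply_self (ρ g) z, hg, map_zero])
  have hginv : cact (ρ g)⁻¹ z = a⁻¹ • z := by
    rw [eq_inv_smul_iff₀ ha, ← map_smul, ← hg, cact_inv_apply_self]
  have hgk : ∀ k : ℕ, cact (ρ (g ^ k)) z = a ^ k • z := by
    intro k
    induction k with
    | zero => simp
    | succ k ih => rw [pow_succ, map_mul, cact_mul_apply, hg, map_smul, ih, smul_smul, pow_succ']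
  -- All conjugates of `h` by powers of `g` act on `z` by the same scalar `b`, and they tend to the
  -- identity.
  have hb : b = 1 := by
    have h1 := (((continuous_cact.comp hρ).clm_apply (continuous_const (y := z))).tendsto 1).comp
      hlim
    have h2 : ∀ k : ℕ, cact (ρ ((g ^ k)⁻¹ * h * g ^ k)) z = b • z := fun k => by
      have h3 : cact (ρ (g ^ k))⁻¹ (a ^ k • z) = z := by rw [← hgk, cact_inv_apply_self]
      rw [map_mul ρ, map_mul ρ, map_inv ρ, cact_mul_apply, cact_mul_apply, hgk, map_smul, hh, smul_comm,
        map_smul, h3]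
    simp only [Function.comp_def, h2, map_one] at h1
    have h3 := tendsto_nhds_unique tendsto_const_nhds h1
    have h4 : (b - 1) • z = 0 := by
      rw [sub_smul, h3, one_smul]; simp
    exact sub_eq_zero.mp ((smul_eq_zero.mp h4).resolve_right hz0)
  subst hb
  rw [one_smul] at hh
  have hhs : cact (ρ h) (star z) = star z := by rw [← star_cact, hh]
  have hhinv : cact (ρ h)⁻¹ z = z := by
    conv_lhs => rw [← hh]
    rw [cact_inv_apply_self]
  -- Both `z` and its conjugate have positive norm, so they use up the positive part and their
  -- common complement is negative definite.
  let W : Submodule ℂ (Idx n → ℂ) :=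
    LinearMap.ker (formₗ (star z) : (Idx n → ℂ) →ₗ[ℂ] ℂ) ⊓ LinearMap.ker (formₗ z)
  have hWmem : ∀ v, v ∈ W ↔ form (star z) v = 0 ∧ form z v = 0 := fun v => by simp [W]
  have hWneg : ∀ v ∈ W, v ≠ 0 → (form (star v) v).re < 0 := fun v hv hv0 => by
    obtain ⟨h1, h2⟩ := (hWmem v).mp hv
    exact herm_neg_of_orthogonal (u := z) (v := star z) hszs hpos
      (by rw [star_star, form_comm]; exact hpos) h1 (by rwa [star_star]) hv0
  have hW := cact_eq_self_of_contracted hρ hWneg (g := g) (h := h) (fun v hv => by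
      obtain ⟨h1, h2⟩ := (hWmem v).mp hv
      rw [hWmem, form_comm _ (cact _ _), form_comm _ (cact _ _), form_cact_left, form_cact_left,
        inv_inv, ← star_cact, hg, star_smul, form_smul_right, form_smul_right, form_comm, h1,
        form_comm, h2, mul_zero, mul_zero]
      exact ⟨rfl, rfl⟩)
    (fun v hv => by
      obtain ⟨h1, h2⟩ := (hWmem v).mp hv
      rw [hWmem, form_comm _ (cact _ _), form_comm _ (cact _ _), form_cact_left, form_cact_left,
        ← star_cact, hhinv, form_comm, form_comm v]
      exact ⟨h1, h2⟩) hlim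
  have hall : ∀ v, cact (ρ h) v = v := fun v => by
    set c := form (star z) z with hc
    set w := v - (form (star z) v / c) • z - (form z v / c) • star z with hw
    have hwW : w ∈ W := by
      rw [hWmem, hw]
      simp only [form_sub_right, form_smul_right, hzz, hszs, form_comm z (star z), ← hc]
      constructor <;> field_simp <;> ring
    have hv : v = w + (form (star z) v / c) • z + (form z v / c) • star z := by
      rw [hw]; abel
    rw [hv]
    simp only [map_add, map_smul, hW w hwW, hh, hhs]
  refine SO_ext fun x => cvec_injective ?_
  rw [← cact_cvec, hall]
  simp

end Contraction

-- The tube domain and its translations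

/-- A hyperbolic pair together with a positive unit vector orthogonal to it. -/
structure Frame (l : ℕ) where
  e₀ : Idx l → ℝ
  e₁ : Idx l → ℝ
  p : Idx l → ℝ
  hyp : IsHyp e₀ e₁
  pp : form p p = 1
  pe₀ : form p e₀ = 0
  pe₁ : form p e₁ = 0

theorem exists_frame {l : ℕ} (hl : 1 < l) : Nonempty (Frame l) := by
  let a : Idx l → ℝ := Pi.single (Sum.inl 0) 1
  let b : Idx l → ℝ := Pi.single (Sum.inl 1) 1
  let c : Idx l → ℝ := Pi.single (Sum.inr ⟨0, by omega⟩) 1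
  have haa : form a a = 1 := form_single_self_inl 0
  have hbb : form b b = 1 := form_single_self_inl 1
  have hcc : form c c = -1 := form_single_self_inr _
  have hba : form b a = 0 := by simp [a, b, form_single_inl]
  have hca : form c a = 0 := by simp [a, c, form_single_inl]
  have hbc : form b c = 0 := by simp [b, c, form_single_inr]
  have hac : form a c = 0 := by simp [a, c, form_single_inr]
  exact ⟨⟨(2⁻¹ : ℝ) • (a + c), a - c, b, ⟨by simp [haa, hca, hcc, hac], by simp [haa, hca, hcc, hac],
    by simp [haa, hca, hcc, hac]; norm_num⟩, hbb, by simp [hba, hbc], by simp [hba, hbc]⟩⟩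

namespace Frame

variable {l : ℕ} (F : Frame l)

/-- The orthogonal projection to the complement of the hyperbolic plane, for real vectors. -/
def prR : (Idx l → ℝ) →ₗ[ℝ] (Idx l → ℝ) :=
  LinearMap.id - (formₗ.flip F.e₁).smulRight F.e₀ - (formₗ.flip F.e₀).smulRight F.e₁

theorem prR_apply (x : Idx l → ℝ) : F.prR x = x - form x F.e₁ • F.e₀ - form x F.e₀ • F.e₁ := by
  simp [prR]

/-- The orthogonal projection to the complement of the hyperbolic plane, for complex vectors. -/
def pr : (Idx l → ℂ) →ₗ[ℂ] (Idx l → ℂ) :=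
  LinearMap.id - (formₗ.flip (cvec F.e₁)).smulRight (cvec F.e₀)
    - (formₗ.flip (cvec F.e₀)).smulRight (cvec F.e₁)

theorem pr_apply (z : Idx l → ℂ) :
    F.pr z = z - form z (cvec F.e₁) • cvec F.e₀ - form z (cvec F.e₀) • cvec F.e₁ := by
  simp [pr]

@[simp] theorem pr_cvec (x : Idx l → ℝ) : F.pr (cvec x) = cvec (F.prR x) := by
  simp [pr_apply, prR_apply]

theorem star_pr (z : Idx l → ℂ) : star (F.pr z) = F.pr (star z) := by
  have h (x : Idx l → ℝ) : star (form z (cvec x)) = form (star z) (cvec x) := by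
    rw [← form_star, star_cvec]
  simp [pr_apply, h]

@[simp] theorem form_prR_e₀ (x : Idx l → ℝ) : form (F.prR x) F.e₀ = 0 := by
  simp [prR_apply, F.hyp.left, F.hyp.pair']

@[simp] theorem form_prR_e₁ (x : Idx l → ℝ) : form (F.prR x) F.e₁ = 0 := by
  simp [prR_apply, F.hyp.right, F.hyp.pair]

@[simp] theorem form_pr_e₀ (z : Idx l → ℂ) : form (F.pr z) (cvec F.e₀) = 0 := by
  simp [pr_apply, F.hyp.left, F.hyp.pair']

@[simp] theorem form_pr_e₁ (z : Idx l → ℂ) : form (F.pr z) (cvec F.e₁) = 0 := by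
  simp [pr_apply, F.hyp.right, F.hyp.pair]

theorem prR_of_orthogonal {x : Idx l → ℝ} (h₀ : form x F.e₀ = 0) (h₁ : form x F.e₁ = 0) :
    F.prR x = x := by
  simp [prR_apply, h₀, h₁]

theorem pr_of_orthogonal {x : Idx l → ℂ} (h₀ : form x (cvec F.e₀) = 0)
    (h₁ : form x (cvec F.e₁) = 0) : F.pr x = x := by
  simp [pr_apply, h₀, h₁]

@[simp] theorem prR_p : F.prR F.p = F.p := F.prR_of_orthogonal F.pe₀ F.pe₁

@[simp] theorem pr_pr (z : Idx l → ℂ) : F.pr (F.pr z) = F.pr z :=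
  F.pr_of_orthogonal (F.form_pr_e₀ z) (F.form_pr_e₁ z)

@[simp] theorem prR_prR (z : Idx l → ℝ) : F.prR (F.prR z) = F.prR z :=
  F.prR_of_orthogonal (F.form_prR_e₀ z) (F.form_prR_e₁ z)

theorem form_prR_p (x : Idx l → ℝ) : form (F.prR x) F.p = form x F.p := by
  simp [prR_apply, form_comm _ F.p, F.pe₀, F.pe₁]

/-- The parametrization of the quadric by the tube domain. -/
def tau (Z : Idx l → ℂ) : Idx l → ℂ :=
  cvec F.e₀ + F.pr Z - (form (F.pr Z) (F.pr Z) / 2) • cvec F.e₁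

/-- The tube domain, seen in the ambient space. -/
def tube : Set (Idx l → ℂ) :=
  {Z | 0 < form (F.prR (imv Z)) (F.prR (imv Z)) ∧ 0 < form (imv Z) F.p}

/-- This one identity gives isotropy on setting `Z' = Z`, and the Hermitian norm on setting `Z' =
star Z`. -/
theorem form_tau (Z Z' : Idx l → ℂ) :
    form (F.tau Z) (F.tau Z') = -form (F.pr (Z - Z')) (F.pr (Z - Z')) / 2 := by
  simp only [tau, form_add_left, form_sub_left, form_smul_left, form_add_right, form_sub_right,
    form_smul_right, form_cvec, form_pr_e₀, form_pr_e₁, form_comm (cvec F.e₀) (F.pr _),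
    form_comm (cvec F.e₁) (F.pr _), F.hyp.left, F.hyp.right, F.hyp.pair, F.hyp.pair', map_sub,
    form_comm (F.pr Z') (F.pr Z)]
  push_cast
  ring

theorem form_tau_self (Z : Idx l → ℂ) : form (F.tau Z) (F.tau Z) = 0 := by
  simp [form_tau]

@[simp] theorem form_tau_e₁ (Z : Idx l → ℂ) : form (F.tau Z) (cvec F.e₁) = 1 := by
  simp [tau, F.hyp.right, F.hyp.pair]

theorem star_tau (Z : Idx l → ℂ) : star (F.tau Z) = F.tau (star Z) := by
  rw [tau, tau, ← star_pr, form_star]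
  simp

theorem herm_tau (Z : Idx l → ℂ) : form (star (F.tau Z)) (F.tau Z)
    = 2 * (form (F.prR (imv Z)) (F.prR (imv Z)) : ℝ) := by
  rw [form_comm, star_tau, form_tau, sub_star_eq, map_smul, pr_cvec, form_smul_left,
    form_smul_right, form_cvec]
  linear_combination (-2 * ((form (F.prR (imv Z)) (F.prR (imv Z)) : ℝ) : ℂ)) * Complex.I_mul_I

theorem pr_tau (Z : Idx l → ℂ) : F.pr (F.tau Z) = F.pr Z := by
  have h₀ : F.prR F.e₀ = 0 := by simp [prR_apply, F.hyp.left, F.hyp.pair]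
  have h₁ : F.prR F.e₁ = 0 := by simp [prR_apply, F.hyp.right, F.hyp.pair']
  simp [tau, h₀, h₁]

theorem imv_pr (z : Idx l → ℂ) : imv (F.pr z) = F.prR (imv z) := by
  conv_lhs => rw [eq_rev_add_imv z, map_add, map_smul, pr_cvec, pr_cvec]
  ext i
  simp

theorem tau_mem_cone {Z : Idx l → ℂ} (hZ : Z ∈ F.tube) : F.tau Z ∈ cone l := by
  refine ⟨F.form_tau_self Z, ?_⟩
  rw [herm_tau]
  have := hZ.1
  norm_cast
  positivity

/-- A vector orthogonal to `z` and its conjugate is zero or negative, whereas `e₁` is nonzero and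
isotropic. -/
theorem form_e₁_ne_zero {z : Idx l → ℂ} (hz : z ∈ cone l) : form z (cvec F.e₁) ≠ 0 := by
  intro h
  have hpos : 0 < (form (star z) z).re := hz.2
  have hzz : form z z = 0 := hz.1
  have hszs : form (star z) (star z) = 0 := by rw [form_star, hzz, star_zero]
  have h1 : form (star z) (cvec F.e₁) = 0 := by
    rw [← star_cvec, form_star, h, star_zero]
  have := herm_neg_of_orthogonal (u := z) (v := star z) (w := cvec F.e₁) hszs hpos
    (by rw [star_star, form_comm]; exact hpos) h1 (by rwa [star_star])
    (by simpa using F.hyp.symm.left_ne_zero)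
  simp [F.hyp.right] at this

/-- After scaling the `e₀`-coordinate to one, the equation of the quadric determines the
`e₁`-coordinate. -/
theorem eq_smul_tau {z : Idx l → ℂ} (hz : z ∈ cone l) :
    z = form z (cvec F.e₁) • F.tau ((form z (cvec F.e₁))⁻¹ • z) := by
  have hc := F.form_e₁_ne_zero hz
  set c := form z (cvec F.e₁) with hcdef
  have hzz : form z z = 0 := hz.1
  have hq : form (F.pr z) (F.pr z) = -2 * c * form z (cvec F.e₀) := by
    simp only [pr_apply, form_sub_left, form_sub_right, form_smul_left, form_smul_right, hzz,
      form_cvec, F.hyp.left, F.hyp.right, F.hyp.pair, F.hyp.pair', form_comm (cvec _) z, ← hcdef]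
    push_cast
    ring
  rw [tau, map_smul, form_smul_left, form_smul_right, hq, smul_sub, smul_add, smul_smul c c⁻¹,
    mul_inv_cancel₀ hc, one_smul, smul_smul, pr_apply, ← hcdef]
  have : c * (c⁻¹ * (c⁻¹ * (-2 * c * form z (cvec F.e₀))) / 2) = -form z (cvec F.e₀) := by
    field_simp
  rw [this, neg_smul]
  abel

/-- The complement of the hyperbolic plane has a single positive direction, so its positive vectors
form two cones, which the sign of the pairing with `p` separates. -/
theorem form_p_ne_zero {y : Idx l → ℝ} (hy : 0 < form (F.prR y) (F.prR y)) : form y F.p ≠ 0 := by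
  intro h
  have h1 : form (F.prR y) F.p = 0 := by rw [form_prR_p, h]
  have := form_neg_of_orthogonal (e := F.e₁) (p := F.p) (x := F.prR y) F.hyp.right
    F.hyp.symm.left_ne_zero (by rw [F.pp]; norm_num) (by rw [form_comm, F.pe₁])
    (by rw [form_comm, form_prR_e₁]) (by rw [form_comm, h1]) (fun c hc => by
      rw [hc] at hy
      simp [F.hyp.right] at hy)
  linarith

theorem prR_im_smul_mem {z : Idx l → ℂ} (hz : z ∈ cone l) :
    0 < form (F.prR (imv ((form z (cvec F.e₁))⁻¹ • z)))
      (F.prR (imv ((form z (cvec F.e₁))⁻¹ • z))) := by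
  have hc := F.form_e₁_ne_zero hz
  have h1 : F.tau ((form z (cvec F.e₁))⁻¹ • z) ∈ cone l := by
    have := (smul_mem_cone_iff (Units.mk0 _ (inv_ne_zero hc)) z).mpr hz
    rw [Units.smul_mk0] at this
    have h2 := congrArg (fun x => (form z (cvec F.e₁))⁻¹ • x) (F.eq_smul_tau hz)
    simp only [smul_smul, inv_mul_cancel₀ hc, one_smul] at h2
    rwa [h2] at this
  have h2 := h1.2
  rw [herm_tau] at h2
  norm_cast at h2
  linarith

theorem continuous_imv : Continuous (imv (n := l)) := LinearMap.continuous_of_finiteDimensional _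

theorem continuous_prR : Continuous F.prR := LinearMap.continuous_of_finiteDimensional _

theorem isOpen_tube : IsOpen F.tube := by
  refine (isOpen_lt continuous_const ?_).and (isOpen_lt continuous_const ?_)
  · exact continuous_form_self.comp (F.continuous_prR.comp continuous_imv)
  · exact (continuous_form_left F.p).comp continuous_imv

theorem I_smul_p_mem {t : ℝ} (ht : 0 < t) : (t * Complex.I) • cvec F.p ∈ F.tube := by
  have h : imv ((t * Complex.I) • cvec F.p) = t • F.p := by ext i; simp
  have h2 : form (F.prR (t • F.p)) (F.prR (t • F.p)) = t ^ 2 := by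
    rw [map_smul, prR_p]
    simp [F.pp, sq]
  refine ⟨by rw [h, h2]; positivity, by rw [h]; simpa [F.pp] using ht⟩

/-- On a segment from `I p` to `Z` the cross term of the norm is a positive multiple of `(Im Z, p)`.
-/
theorem starConvex_tube : StarConvex ℝ (Complex.I • cvec F.p) F.tube := by
  intro Z hZ a b ha hb hab
  have h0 : imv (Complex.I • cvec F.p) = F.p := by ext i; simp
  obtain ⟨h1, h2⟩ := hZ
  have h3 : imv (a • Complex.I • cvec F.p + b • Z) = a • F.p + b • imv Z := by
    rw [map_add, imv.map_smul a, imv.map_smul b, h0]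
  have h4 : form (F.prR (a • F.p + b • imv Z)) (F.prR (a • F.p + b • imv Z))
      = a ^ 2 + 2 * (a * b) * form (imv Z) F.p
        + b ^ 2 * form (F.prR (imv Z)) (F.prR (imv Z)) := by
    simp only [map_add, map_smul, prR_p, form_add_left, form_add_right, form_smul_left,
      form_smul_right, F.pp, form_comm F.p (F.prR _), form_prR_p]
    ring
  refine ⟨?_, ?_⟩
  · rw [h3, h4]
    rcases eq_or_lt_of_le hb with rfl | hb'
    · obtain rfl : a = 1 := by linarith
      simp
    · positivity
  · rw [h3]
    simp only [form_add_left, form_smul_left, F.pp]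
    rcases eq_or_lt_of_le hb with rfl | hb'
    · obtain rfl : a = 1 := by linarith
      simp
    · positivity

theorem I_smul_p_mem' : Complex.I • cvec F.p ∈ F.tube := by
  simpa using F.I_smul_p_mem one_pos

theorem isPreconnected_tube : IsPreconnected F.tube :=
  (F.starConvex_tube.isPathConnected F.I_smul_p_mem').isConnected.isPreconnected

/-- The identity component preserves the tube domain. -/
theorem exists_cact_tau (g : SOId l) {Z : Idx l → ℂ} (hZ : Z ∈ F.tube) :
    ∃ Z' ∈ F.tube, ∃ c : ℂ, c ≠ 0 ∧ cact (g : SO l) (F.tau Z) = c • F.tau Z' := by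
  have hz : ∀ g : SO l, cact g (F.tau Z) ∈ cone l := fun g =>
    toComplex_smul_mem_cone g (F.tau_mem_cone hZ)
  let y : SO l → Idx l → ℝ := fun g =>
    imv ((form (cact g (F.tau Z)) (cvec F.e₁))⁻¹ • cact g (F.tau Z))
  have hy : ∀ g, 0 < form (F.prR (y g)) (F.prR (y g)) := fun g => F.prR_im_smul_mem (hz g)
  have hyc : Continuous fun g => form (y g) F.p := by
    refine (continuous_form_left F.p).comp (continuous_imv.comp ?_)
    have h1 : Continuous fun g : SO l => cact g (F.tau Z) :=
      continuous_cact.clm_apply continuous_const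
    have h2 : Continuous fun z : Idx l → ℂ => form z (cvec F.e₁) := by
      simp only [form_eq_sum]; fun_prop
    exact ((h2.comp h1).inv₀ fun g => F.form_e₁_ne_zero (hz g)).smul h1
  have hconn : IsPreconnected (SOId l : Set (SO l)) := isPreconnected_connectedComponent
  have hy1 : 0 < form (y 1) F.p := by
    have h1 : form (y 1) F.p = form (imv Z) F.p := by
      rw [← form_prR_p, ← F.form_prR_p (imv Z)]
      simp [y, ← imv_pr, pr_tau]
    rw [h1]
    exact hZ.2
  -- The pairing with `p` never vanishes along the group, so its sign is constant on the identity
  -- component.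
  have hpos : 0 < form (y g) F.p := by
    by_contra! hneg
    obtain ⟨k, -, hk⟩ := hconn.intermediate_value₂ g.2 (one_mem (SOId l)) hyc.continuousOn
      continuousOn_const hneg hy1.le
    exact F.form_p_ne_zero (hy k) hk
  exact ⟨_, ⟨hy g, hpos⟩, _, F.form_e₁_ne_zero (hz g), F.eq_smul_tau (hz g)⟩

theorem exists_trans (b : Idx l → ℝ) : ∃ g : SOId l, act (g : SO l) = eichLin F.e₁ (F.prR b) :=
  exists_eichler F.hyp.right (F.form_prR_e₁ b)

/-- The translation by `b` of the tube domain. -/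
def trans (b : Idx l → ℝ) : SOId l := (F.exists_trans b).choose

theorem act_trans (b : Idx l → ℝ) : act (F.trans b : SO l) = eichLin F.e₁ (F.prR b) :=
  (F.exists_trans b).choose_spec

theorem continuous_trans (b : Idx l → ℝ) : Continuous fun t : ℝ => F.trans (t • b) := by
  obtain ⟨γ, hγ, h⟩ := exists_eichler_family F.hyp.right (F.form_prR_e₁ b)
  convert hγ using 2 with t
  exact SOId_ext fun x => by rw [act_trans, h, map_smul]

theorem trans_add (b c : Idx l → ℝ) : F.trans (b + c) = F.trans b * F.trans c :=
  SOId_ext fun x => funext fun i => by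
    have hb : form F.e₁ (F.prR b) = 0 := by rw [form_comm, form_prR_e₁]
    simp only [Subgroup.coe_mul, act_mul_apply, act_trans, map_add, eichLin_apply, form_add_left,
      form_sub_left, form_add_right, form_smul_left, F.hyp.right, form_prR_e₁, hb,
      form_comm (F.prR c) (F.prR b), Pi.add_apply, Pi.sub_apply, Pi.smul_apply, smul_eq_mul]
    ring

@[simp] theorem trans_zero : F.trans 0 = 1 := SOId_ext fun x => by
  simp [act_trans, eichLin_apply]

theorem cact_trans_tau (b : Idx l → ℝ) (Z : Idx l → ℂ) :
    cact (F.trans b : SO l) (F.tau Z) = F.tau (Z + cvec b) := by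
  have h : ∀ z : Idx l → ℂ, cact (F.trans b : SO l) z
      = z + form z (cvec F.e₁) • cvec (F.prR b) - form z (cvec (F.prR b)) • cvec F.e₁
        - (form (F.prR b) (F.prR b) / 2 * form z (cvec F.e₁)) • cvec F.e₁ := by
    intro z
    let L : (Idx l → ℂ) →ₗ[ℂ] (Idx l → ℂ) :=
      LinearMap.id + (formₗ.flip (cvec F.e₁)).smulRight (cvec (F.prR b))
        - (formₗ.flip (cvec (F.prR b))).smulRight (cvec F.e₁)
        - ((form (F.prR b) (F.prR b) / 2 : ℂ)) • (formₗ.flip (cvec F.e₁)).smulRight (cvec F.e₁)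
    have hL : ∀ z, L z = z + form z (cvec F.e₁) • cvec (F.prR b)
        - form z (cvec (F.prR b)) • cvec F.e₁
        - (form (F.prR b) (F.prR b) / 2 * form z (cvec F.e₁)) • cvec F.e₁ := fun z => by
      simp [L, mul_smul]
    rw [← hL]
    refine linear_ext_real (f := (cact (F.trans b : SO l)).toLinearMap) (g := L) (fun x => ?_) z
    rw [hL]
    simp only [ContinuousLinearMap.coe_coe, cact_cvec, act_trans, eichLin_apply, map_sub, map_add,
      cvec_smul, form_cvec]
    push_cast
    rfl
  have h1 : form (F.tau Z) (cvec (F.prR b)) = form (F.pr Z) (cvec (F.prR b)) := by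
    simp [tau, form_comm _ (F.prR b)]
  rw [h, form_tau_e₁, h1]
  simp only [tau, map_add, pr_cvec, form_add_left, form_add_right, form_cvec,
    form_comm (cvec (F.prR b)) (F.pr Z)]
  ext i
  simp only [Pi.add_apply, Pi.sub_apply, Pi.smul_apply, smul_eq_mul]
  ring

theorem pr_cact {g : SOId l} {κ : ℝ} (hκ : κ ≠ 0) (h₀ : act (g : SO l) F.e₀ = κ • F.e₀)
    (h₁ : act (g : SO l) F.e₁ = κ⁻¹ • F.e₁)
    (Z : Idx l → ℂ) : F.pr (cact (g : SO l) Z) = cact (g : SO l) (F.pr Z) := by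
  have hc : (κ : ℂ) ≠ 0 := by exact_mod_cast hκ
  have e₀ : cact (g : SO l) (cvec F.e₀) = (κ : ℂ) • cvec F.e₀ := by simp [h₀]
  have e₁ : cact (g : SO l) (cvec F.e₁) = (κ : ℂ)⁻¹ • cvec F.e₁ := by
    rw [cact_cvec, h₁, cvec_smul, Complex.ofReal_inv]
  have e₀' : cact (g : SO l)⁻¹ (cvec F.e₀) = (κ : ℂ)⁻¹ • cvec F.e₀ := by
    rw [eq_inv_smul_iff₀ hc, ← map_smul, ← e₀, cact_inv_apply_self]
  have e₁' : cact (g : SO l)⁻¹ (cvec F.e₁) = (κ : ℂ) • cvec F.e₁ := by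
    rw [← inv_smul_eq_iff₀ hc, ← map_smul, ← e₁, cact_inv_apply_self]
  simp only [pr_apply, form_cact_left, map_sub, map_smul, e₀, e₁, e₀', e₁', form_smul_right,
    smul_smul]
  rw [mul_comm (κ : ℂ), mul_comm (κ : ℂ)⁻¹]

theorem cact_tau {g : SOId l} {κ : ℝ} (hκ : κ ≠ 0) (h₀ : act (g : SO l) F.e₀ = κ • F.e₀)
    (h₁ : act (g : SO l) F.e₁ = κ⁻¹ • F.e₁)
    (Z : Idx l → ℂ) : cact (g : SO l) (F.tau Z)
    = (κ : ℂ) • F.tau ((κ : ℂ)⁻¹ • cact (g : SO l) Z) := by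
  have hc : (κ : ℂ) ≠ 0 := by exact_mod_cast hκ
  have e₀ : cact (g : SO l) (cvec F.e₀) = (κ : ℂ) • cvec F.e₀ := by simp [h₀]
  have e₁ : cact (g : SO l) (cvec F.e₁) = (κ : ℂ)⁻¹ • cvec F.e₁ := by
    rw [cact_cvec, h₁, cvec_smul, Complex.ofReal_inv]
  simp only [tau, map_sub, map_add, map_smul, e₀, e₁, F.pr_cact hκ h₀ h₁, form_smul_left,
    form_smul_right, form_cact, smul_sub, smul_add, smul_smul]
  rw [mul_inv_cancel₀ hc, one_smul]
  congr 2
  field_simp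

/-- Elements preserving both isotropic lines normalize the translations; the scalar `κ⁻¹` comes from
their action on `e₁`. -/
theorem mul_trans {g : SOId l} {κ : ℝ} (hκ : κ ≠ 0) (h₀ : act (g : SO l) F.e₀ = κ • F.e₀)
    (h₁ : act (g : SO l) F.e₁ = κ⁻¹ • F.e₁)
    (b : Idx l → ℝ) :
    g * F.trans b = F.trans (κ⁻¹ • act (g : SO l) b) * g := by
  have hp : F.prR (act (g : SO l) b) = act (g : SO l) (F.prR b) := cvec_injective (by
    rw [← pr_cvec, ← cact_cvec, ← cact_cvec, F.pr_cact hκ h₀ h₁, pr_cvec])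
  refine SOId_ext fun x => ?_
  simp only [Subgroup.coe_mul, act_mul_apply, act_trans]
  rw [act_conj_eichLin, h₁, eichLin_smul_left, map_smul, hp]

end Frame

-- Exponentials of operators applied to vectors

section Exponential

open Filter Topology
open scoped Nat

variable {n : ℕ}

theorem hasSum_exp_apply (A : (Idx n → ℂ) →L[ℂ] (Idx n → ℂ)) (v : Idx n → ℂ) :
    HasSum (fun k : ℕ => ((k ! : ℂ)⁻¹) • (A ^ k) v) (NormedSpace.exp A v) := by
  have h := NormedSpace.exp_series_hasSum_exp' (𝕂 := ℂ) A
  exact h.mapL (ContinuousLinearMap.apply ℂ (Idx n → ℂ) v)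

theorem exp_apply_add {A B : (Idx n → ℂ) →L[ℂ] (Idx n → ℂ)} (h : Commute A B) (v : Idx n → ℂ) :
    NormedSpace.exp (A + B) v = NormedSpace.exp A (NormedSpace.exp B v) := by
  let : NormedAlgebra ℚ ((Idx n → ℂ) →L[ℂ] (Idx n → ℂ)) := NormedAlgebra.restrictScalars ℚ ℂ _
  rw [NormedSpace.exp_add_of_commute h]
  rfl

theorem exp_neg_apply_exp (A : (Idx n → ℂ) →L[ℂ] (Idx n → ℂ)) (v : Idx n → ℂ) :
    NormedSpace.exp (-A) (NormedSpace.exp A v) = v := by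
  rw [← exp_apply_add (Commute.neg_left (Commute.refl A)), neg_add_cancel, NormedSpace.exp_zero]
  rfl

theorem exp_apply_exp_neg (A : (Idx n → ℂ) →L[ℂ] (Idx n → ℂ)) (v : Idx n → ℂ) :
    NormedSpace.exp A (NormedSpace.exp (-A) v) = v := by
  rw [← exp_apply_add (Commute.neg_right (Commute.refl A)), add_neg_cancel, NormedSpace.exp_zero]
  rfl

/-- The form with one vector fixed, as a continuous linear functional. -/
def formCL (u : Idx n → ℂ) : (Idx n → ℂ) →L[ℂ] ℂ := LinearMap.toContinuousLinearMap (formₗ u)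

@[simp] theorem formCL_apply (u v : Idx n → ℂ) : formCL u v = form u v := rfl

theorem form_pow_left {A : (Idx n → ℂ) →L[ℂ] (Idx n → ℂ)}
    (hA : ∀ u v, form (A u) v = -form u (A v)) (k : ℕ) (u v : Idx n → ℂ) :
    form ((A ^ k) u) v = (-1) ^ k * form u ((A ^ k) v) := by
  induction k generalizing u v with
  | zero => simp
  | succ k ih =>
    rw [pow_succ' A, mul_apply_eq_comp, hA, ih, ← mul_apply_eq_comp,
      ← pow_succ, ← pow_succ', pow_succ (-1 : ℂ)]
    ring

theorem form_exp_left {A : (Idx n → ℂ) →L[ℂ] (Idx n → ℂ)}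
    (hA : ∀ u v, form (A u) v = -form u (A v)) (u v : Idx n → ℂ) :
    form (NormedSpace.exp A u) v = form u (NormedSpace.exp (-A) v) := by
  have h1 := (hasSum_exp_apply A u).mapL (formCL v)
  have h2 := (hasSum_exp_apply (-A) v).mapL (formCL u)
  have h3 : ∀ k : ℕ, formCL u (((k ! : ℂ)⁻¹) • ((-A) ^ k) v)
      = formCL v (((k ! : ℂ)⁻¹) • (A ^ k) u) := fun k => by
    have h4 : ((-A) ^ k) v = ((-1 : ℂ) ^ k) • (A ^ k) v := by
      induction k with
      | zero => simp
      | succ k ih => simp only [pow_succ', mul_apply_eq_comp, ih, neg_apply, map_smul, neg_smul,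
          one_smul, mul_smul, smul_neg]
    rw [map_smul, map_smul, formCL_apply, formCL_apply, form_comm v, form_pow_left hA, h4,
      form_smul_right]
  simp only [h3] at h2
  rw [form_comm]
  exact h1.unique h2

theorem intertwine_exp {m : ℕ} {A : (Idx n → ℂ) →L[ℂ] (Idx n → ℂ)}
    {B : (Idx m → ℂ) →L[ℂ] (Idx m → ℂ)} (T : (Idx n → ℂ) →L[ℂ] (Idx m → ℂ))
    (h : ∀ v, T (A v) = B (T v)) (v : Idx n → ℂ) :
    T (NormedSpace.exp A v) = NormedSpace.exp B (T v) := by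
  have hk : ∀ (k : ℕ) v, T ((A ^ k) v) = (B ^ k) (T v) := fun k => by
    induction k with
    | zero => intro v; simp
    | succ k ih =>
      intro v
      rw [pow_succ, pow_succ, mul_apply_eq_comp, mul_apply_eq_comp, ih, h]
  have h1 := (hasSum_exp_apply A v).mapL T
  simp only [map_smul, hk] at h1
  exact h1.unique (hasSum_exp_apply B (T v))

theorem star_exp_apply {A B : (Idx n → ℂ) →L[ℂ] (Idx n → ℂ)}
    (h : ∀ v, star (A v) = B (star v)) (v : Idx n → ℂ) :
    star (NormedSpace.exp A v) = NormedSpace.exp B (star v) := by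
  have hk : ∀ (k : ℕ) v, star ((A ^ k) v) = (B ^ k) (star v) := fun k => by
    induction k with
    | zero => intro v; simp
    | succ k ih =>
      intro v
      rw [pow_succ, pow_succ, mul_apply_eq_comp, mul_apply_eq_comp, ih, h]
  have h1 := (hasSum_exp_apply A v).star
  have h2 : ∀ k : ℕ, star (((k ! : ℂ)⁻¹) • (A ^ k) v) = ((k ! : ℂ)⁻¹) • (B ^ k) (star v) :=
    fun k => by rw [star_smul, hk]; simp
  simp only [h2] at h1
  exact h1.unique (hasSum_exp_apply B (star v))

end Exponential

-- Infinitesimal generators of the translations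

section Generators

open Filter Topology

variable {l n : ℕ} {ρ : SOId l →* SO n} (hρ : Continuous ρ) (F : Frame l)

/-- The infinitesimal generator of the one-parameter group of translations in the direction `b`. -/
def genR (ρ : SOId l →* SO n) (F : Frame l) (b : Idx l → ℝ) : (Idx n → ℂ) →L[ℂ] (Idx n → ℂ) :=
  deriv (fun t : ℝ => cact (ρ (F.trans (t • b)))) 0

/-- The complex linear extension of `genR`. -/
def gen (ρ : SOId l →* SO n) (F : Frame l) :
    (Idx l → ℂ) →ₗ[ℂ] ((Idx n → ℂ) →L[ℂ] (Idx n → ℂ)) :=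
  ∑ i, (LinearMap.proj i).smulRight (genR ρ F (Pi.single i 1))

theorem gen_apply (Z : Idx l → ℂ) : gen ρ F Z = ∑ i, Z i • genR ρ F (Pi.single i 1) := by
  simp [gen]

include hρ in
theorem continuous_cact_trans (b : Idx l → ℝ) :
    Continuous fun t : ℝ => cact (ρ (F.trans (t • b))) :=
  continuous_cact.comp (hρ.comp (F.continuous_trans b))

include hρ in
theorem hasDerivAt_cact_trans (b : Idx l → ℝ) :
    HasDerivAt (fun t : ℝ => cact (ρ (F.trans (t • b)))) (genR ρ F b) 0 :=
  (differentiable_of_one_parameter (continuous_cact_trans hρ F b) (by simp)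
    (fun s t => by rw [add_smul, F.trans_add, map_mul, map_mul]) 0).hasDerivAt

include hρ in
theorem hasDerivAt_cact_trans_apply (b : Idx l → ℝ) (v : Idx n → ℂ) :
    HasDerivAt (fun t : ℝ => cact (ρ (F.trans (t • b))) v) (genR ρ F b v) 0 := by
  have := ((ContinuousLinearMap.apply ℂ (Idx n → ℂ) v).restrictScalars ℝ).hasFDerivAt.comp_hasDerivAt
    (0 : ℝ) (hasDerivAt_cact_trans hρ F b)
  exact this

include hρ in
theorem genR_add (b c : Idx l → ℝ) : genR ρ F (b + c) = genR ρ F b + genR ρ F c := by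
  have h1 := hasDerivAt_cact_trans hρ F (b + c)
  have h2 := (hasDerivAt_cact_trans hρ F b).mul (hasDerivAt_cact_trans hρ F c)
  have h3 : (fun t : ℝ => cact (ρ (F.trans (t • (b + c)))))
      = (fun t : ℝ => cact (ρ (F.trans (t • b)))) * fun t : ℝ => cact (ρ (F.trans (t • c))) := by
    funext t
    rw [smul_add, F.trans_add, map_mul, map_mul]
    rfl
  rw [h3] at h1
  simpa using h1.unique h2

include hρ in
theorem genR_smul (a : ℝ) (b : Idx l → ℝ) : genR ρ F (a • b) = a • genR ρ F b := by
  have h1 := hasDerivAt_cact_trans hρ F (a • b)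
  have h2 : HasDerivAt (fun t : ℝ => cact (ρ (F.trans (t • b)))) (genR ρ F b) (a * 0) := by
    rw [mul_zero]; exact hasDerivAt_cact_trans hρ F b
  have h4 : HasDerivAt (fun t : ℝ => a * t) a 0 := by simpa using (hasDerivAt_id (0 : ℝ)).const_mul a
  have h3 := h2.scomp (0 : ℝ) h4
  refine h1.unique (h3.congr_of_eventuallyEq (Eventually.of_forall fun t => ?_))
  simp [smul_smul, mul_comm]

include hρ in
theorem gen_cvec (b : Idx l → ℝ) : gen ρ F (cvec b) = genR ρ F b := by
  let L : (Idx l → ℝ) →ₗ[ℝ] ((Idx n → ℂ) →L[ℂ] (Idx n → ℂ)) :=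
    { toFun := genR ρ F, map_add' := genR_add hρ F, map_smul' := genR_smul hρ F }
  have h : L b = ∑ i, b i • L (Pi.single i 1) := by
    conv_lhs => rw [pi_eq_sum_univ' b]
    simp only [map_sum, map_smul]
  rw [gen_apply]
  refine Eq.trans ?_ h.symm
  refine Finset.sum_congr rfl fun i _ => ?_
  ext v
  simp [L]

include hρ in
theorem cact_trans (b : Idx l → ℝ) :
    cact (ρ (F.trans b)) = NormedSpace.exp (gen ρ F (cvec b)) := by
  have h := eq_exp_of_one_parameter (continuous_cact_trans hρ F b) (by simp)
    (fun s t => by rw [add_smul, F.trans_add, map_mul, map_mul]) 1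
  rw [one_smul, one_smul] at h
  rw [h, gen_cvec hρ]
  rfl

include hρ in
theorem genR_intertwine {g : SOId l} {b c : Idx l → ℝ}
    (h : ∀ t : ℝ, g * F.trans (t • b) = F.trans (t • c) * g) :
    cact (ρ g) * genR ρ F b = genR ρ F c * cact (ρ g) := by
  have h1 := (hasDerivAt_cact_trans hρ F b).const_mul (cact (ρ g))
  have h2 := (hasDerivAt_cact_trans hρ F c).mul_const (cact (ρ g))
  refine h1.unique (h2.congr_of_eventuallyEq (Eventually.of_forall fun t => ?_))
  simp only [← map_mul, h]

include hρ in
-- Translations commute; differentiating first in one parameter and then in the other passes this on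
-- to the generators.
theorem genR_commute (b c : Idx l → ℝ) : Commute (genR ρ F b) (genR ρ F c) := by
  have h : ∀ s : ℝ, cact (ρ (F.trans (s • c))) * genR ρ F b
      = genR ρ F b * cact (ρ (F.trans (s • c))) := fun s =>
    genR_intertwine hρ F fun t => by rw [← F.trans_add, add_comm, F.trans_add]
  have h1 := (hasDerivAt_cact_trans hρ F c).const_mul (genR ρ F b)
  have h2 := (hasDerivAt_cact_trans hρ F c).mul_const (genR ρ F b)
  exact h1.unique (h2.congr_of_eventuallyEq (Eventually.of_forall fun t => (h t).symm))

include hρ in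
theorem gen_commute (Z Z' : Idx l → ℂ) : Commute (gen ρ F Z) (gen ρ F Z') := by
  refine ContinuousLinearMap.ext fun v => ?_
  simp only [mul_apply_eq_comp, gen_apply, sum_apply, smul_apply, map_sum, map_smul,
    Finset.smul_sum]
  rw [Finset.sum_comm]
  refine Finset.sum_congr rfl fun i _ => Finset.sum_congr rfl fun j _ => ?_
  rw [smul_comm, ← mul_apply_eq_comp, ← mul_apply_eq_comp, (genR_commute hρ F _ _).eq]

include hρ in
theorem genR_skew (b : Idx l → ℝ) (u v : Idx n → ℂ) :
    form (genR ρ F b u) v = -form u (genR ρ F b v) := by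
  let B : (Idx n → ℂ) →L[ℝ] (Idx n → ℂ) →L[ℝ] ℂ :=
    LinearMap.toContinuousBilinearMap (LinearMap.mk₂ ℝ form form_add_left
      (fun c x y => by
        change form ((c : ℂ) • x) y = _
        rw [form_smul_left, Complex.real_smul])
      (fun x y z => form_add_right y z x) (fun c x y => by
        change form x ((c : ℂ) • y) = _
        rw [form_smul_right, Complex.real_smul]))
  have hB : ∀ x y, B x y = form x y := fun x y => rfl
  have h1 := B.hasFDerivAt_of_bilinear (hasDerivAt_cact_trans_apply hρ F b u).hasFDerivAt
    (hasDerivAt_cact_trans_apply hρ F b v).hasFDerivAt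
  have h2 := h1.hasDerivAt
  have h3 : HasDerivAt (fun t : ℝ => B (cact (ρ (F.trans (t • b))) u)
      (cact (ρ (F.trans (t • b))) v)) 0 0 := by
    simp only [hB, form_cact]
    exact hasDerivAt_const _ _
  have h4 := h3.unique h2
  simp [hB] at h4
  linear_combination -h4

include hρ in
theorem gen_skew (Z : Idx l → ℂ) (u v : Idx n → ℂ) :
    form (gen ρ F Z u) v = -form u (gen ρ F Z v) := by
  simp only [gen_apply, sum_apply, smul_apply, form_sum_left, form_sum_right,
    form_smul_left, form_smul_right, genR_skew hρ F, ← Finset.sum_neg_distrib, mul_neg]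

include hρ in
theorem star_genR (b : Idx l → ℝ) (v : Idx n → ℂ) :
    star (genR ρ F b v) = genR ρ F b (star v) := by
  have h1 := (hasDerivAt_cact_trans_apply hρ F b v).star
  have h2 := hasDerivAt_cact_trans_apply hρ F b (star v)
  refine h1.unique (h2.congr_of_eventuallyEq (Eventually.of_forall fun t => ?_))
  exact star_cact _ _

include hρ in
theorem star_gen (Z : Idx l → ℂ) (v : Idx n → ℂ) :
    star (gen ρ F Z v) = gen ρ F (star Z) (star v) := by
  simp only [gen_apply, sum_apply, smul_apply, star_sum, star_smul,
    star_genR hρ F, Pi.star_apply]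

include hρ in
-- A translation depends on its direction only through the projection, so the generators do not see
-- the components along `e₀` and `e₁`.
theorem gen_pr (Z : Idx l → ℂ) : gen ρ F (F.pr Z) = gen ρ F Z := by
  refine linear_ext_real (f := gen ρ F ∘ₗ F.pr) (g := gen ρ F) (fun x => ?_) Z
  simp only [LinearMap.comp_apply, Frame.pr_cvec, gen_cvec hρ, genR]
  congr 1
  funext t
  congr 2
  exact SOId_ext fun x => by rw [Frame.act_trans, Frame.act_trans, map_smul, map_smul, F.prR_prR]

include hρ in
theorem cact_mul_gen {g : SOId l} {κ : ℝ} (hκ : κ ≠ 0) (h₀ : act (g : SO l) F.e₀ = κ • F.e₀)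
    (h₁ : act (g : SO l) F.e₁ = κ⁻¹ • F.e₁) (Z : Idx l → ℂ) (v : Idx n → ℂ) :
    cact (ρ g) (gen ρ F Z v) = gen ρ F ((κ : ℂ)⁻¹ • cact (g : SO l) Z) (cact (ρ g) v) := by
  have key : ∀ b : Idx l → ℝ, cact (ρ g) * genR ρ F b
      = genR ρ F (κ⁻¹ • act (g : SO l) b) * cact (ρ g) := fun b =>
    genR_intertwine hρ F fun t => by
      rw [F.mul_trans hκ h₀ h₁, map_smul, smul_comm]
  let L : (Idx l → ℂ) →ₗ[ℂ] (Idx n → ℂ) :=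
    (cact (ρ g)).toLinearMap ∘ₗ (ContinuousLinearMap.apply ℂ (Idx n → ℂ) v).toLinearMap ∘ₗ gen ρ F
  let L' : (Idx l → ℂ) →ₗ[ℂ] (Idx n → ℂ) :=
    (ContinuousLinearMap.apply ℂ (Idx n → ℂ) (cact (ρ g) v)).toLinearMap ∘ₗ gen ρ F ∘ₗ
      ((κ : ℂ)⁻¹ • (cact (g : SO l)).toLinearMap)
  refine linear_ext_real (f := L) (g := L') (fun b => ?_) Z
  change cact (ρ g) (gen ρ F (cvec b) v)
    = gen ρ F ((κ : ℂ)⁻¹ • cact (g : SO l) (cvec b)) (cact (ρ g) v)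
  rw [cact_cvec, ← Complex.ofReal_inv, ← cvec_smul, gen_cvec hρ, gen_cvec hρ,
    ← mul_apply_eq_comp, ← mul_apply_eq_comp, key]

end Generators

-- Lifting the map of domains to vectors

section Related

variable {l n : ℕ}

theorem pt_eq_pt_iff {z z' : Idx n → ℂ} (hz : z ∈ cone n) (hz' : z' ∈ cone n) :
    pt hz = pt hz' ↔ ∃ a : ℂ, a ≠ 0 ∧ z' = a • z := by
  rw [pt, pt, Subtype.mk_eq_mk, eq_comm, Projectivization.mk_eq_mk_iff']
  constructor
  · rintro ⟨a, ha⟩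
    exact ⟨a, by rintro rfl; exact ne_zero_of_mem_cone hz' (by rw [← ha, zero_smul]), ha.symm⟩
  · rintro ⟨a, -, ha⟩
    exact ⟨a, ha.symm⟩

theorem smul_mem_cone {a : ℂ} (ha : a ≠ 0) {z : Idx n → ℂ} (hz : z ∈ cone n) : a • z ∈ cone n := by
  have := (smul_mem_cone_iff (Units.mk0 a ha) z).mpr hz
  rwa [Units.smul_mk0] at this

/-- The map `f` sends the point `[z]` to the point `[w]`. -/
def Related (f : Dom l → Dom n) (z : Idx l → ℂ) (w : Idx n → ℂ) : Prop :=
  ∃ (hz : z ∈ cone l) (hw : w ∈ cone n), f (pt hz) = pt hw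

variable {f : Dom l → Dom n} {z : Idx l → ℂ} {w w' : Idx n → ℂ}

theorem Related.mem (h : Related f z w) : w ∈ cone n := h.2.1

theorem Related.unique (h : Related f z w) (h' : Related f z w') : ∃ a : ℂ, a ≠ 0 ∧ w' = a • w := by
  obtain ⟨hz, hw, h1⟩ := h
  obtain ⟨_, hw', h2⟩ := h'
  exact (pt_eq_pt_iff hw hw').mp (h1.symm.trans h2)

theorem Related.smul_right (h : Related f z w) {a : ℂ} (ha : a ≠ 0) : Related f z (a • w) := by
  obtain ⟨hz, hw, h1⟩ := h
  exact ⟨hz, smul_mem_cone ha hw, h1.trans ((pt_eq_pt_iff _ _).mpr ⟨a, ha, rfl⟩)⟩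

theorem Related.smul_left (h : Related f z w) {a : ℂ} (ha : a ≠ 0) : Related f (a • z) w := by
  obtain ⟨hz, hw, h1⟩ := h
  refine ⟨smul_mem_cone ha hz, hw, ?_⟩
  rw [← h1]
  congr 1
  exact ((pt_eq_pt_iff _ _).mpr ⟨a, ha, rfl⟩).symm

theorem Related.of_smul_left {a : ℂ} (ha : a ≠ 0) (h : Related f (a • z) w) : Related f z w := by
  have := h.smul_left (inv_ne_zero ha)
  rwa [smul_smul, inv_mul_cancel₀ ha, one_smul] at this

theorem exists_related (hz : z ∈ cone l) : ∃ w, Related f z w := by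
  generalize hp : f (pt hz) = p
  obtain ⟨p, hp'⟩ := p
  induction p using Projectivization.ind with
  | h w hw =>
    have hwc := (mk_mem_Dom_iff w hw).mp hp'
    exact ⟨w, hz, hwc, hp⟩

theorem Related.act {ρ : SOId l →* SO n}
    (hf : ∀ (g : SOId l) (x : Dom l), f ((g : SO l) • x) = ρ g • f x) (h : Related f z w)
    (g : SOId l) : Related f (cact (g : SO l) z) (cact (ρ g) w) := by
  obtain ⟨hz, hw, h1⟩ := h
  refine ⟨toComplex_smul_mem_cone _ hz, toComplex_smul_mem_cone _ hw, ?_⟩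
  have := hf g (pt hz)
  rw [h1, smul_pt, smul_pt] at this
  exact this

end Related

-- The equivariant map as an exponential

section FlatSection

open Filter Topology

variable {l n : ℕ} {ρ : SOId l →* SO n} (hρ : Continuous ρ) (F : Frame l) {f : Dom l → Dom n}

theorem differentiable_gen : Differentiable ℂ fun Z => gen ρ F Z :=
  (LinearMap.toContinuousLinearMap (gen ρ F)).differentiable

theorem Frame.differentiable_tau : Differentiable ℂ F.tau := by
  have h : Differentiable ℂ F.pr := (LinearMap.toContinuousLinearMap F.pr).differentiable
  unfold Frame.tau
  simp only [form_eq_sum]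
  fun_prop

theorem differentiable_exp_apply :
    Differentiable ℂ (NormedSpace.exp : ((Idx n → ℂ) →L[ℂ] (Idx n → ℂ)) → _) := fun A =>
  (NormedSpace.exp_analytic (𝕂 := ℂ) A).differentiableAt

include hρ in
/-- Near every point of the tube domain the equivariant map is given by the exponential of the
generators applied to a constant vector. -/
theorem eventually_related_iff (hf : IsHolomorphic f)
    (hfρ : ∀ (g : SOId l) (x : Dom l), f ((g : SO l) • x) = ρ g • f x) {Z₀ : Idx l → ℂ}
    (hZ₀ : Z₀ ∈ F.tube) : ∀ᶠ Z in 𝓝 Z₀, ∀ w,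
      Related f (F.tau Z₀) (NormedSpace.exp (gen ρ F Z₀) w) ↔
      Related f (F.tau Z) (NormedSpace.exp (gen ρ F Z) w) := by
  obtain ⟨U, hU, hzU, φ, hφ, hφf⟩ := hf (F.tau Z₀) (F.tau_mem_cone hZ₀)
  let V : Set (Idx l → ℂ) := F.tube ∩ F.tau ⁻¹' U
  have hV : IsOpen V := F.isOpen_tube.inter (hU.preimage F.differentiable_tau.continuous)
  -- Undoing the exponential straightens the local lift `φ`: the aim is that the line spanned by `G
  -- Z` does not depend on `Z`.
  let G : (Idx l → ℂ) → (Idx n → ℂ) := fun Z => NormedSpace.exp (-gen ρ F Z) (φ (F.tau Z))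
  have hG : DifferentiableOn ℂ G V := by
    refine DifferentiableOn.clm_apply ?_ ?_
    · exact (differentiable_exp_apply.comp (differentiable_gen F).neg).differentiableOn
    · exact hφ.comp F.differentiable_tau.differentiableOn fun Z hZ => hZ.2
  have hGrel : ∀ Z ∈ V, Related f (F.tau Z) (φ (F.tau Z)) := fun Z hZ => by
    obtain ⟨h, h'⟩ := hφf _ hZ.2 (F.tau_mem_cone hZ.1)
    exact ⟨_, h, h'⟩
  have hG0 : ∀ Z ∈ V, G Z ≠ 0 := fun Z hZ h0 => by
    have h1 := exp_apply_exp_neg (gen ρ F Z) (φ (F.tau Z))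
    change NormedSpace.exp (gen ρ F Z) (G Z) = _ at h1
    rw [h0, map_zero] at h1
    exact ne_zero_of_mem_cone (hGrel Z hZ).mem h1.symm
  have hGiff : ∀ Z ∈ V, ∀ w, Related f (F.tau Z) (NormedSpace.exp (gen ρ F Z) w) ↔
      ∃ a : ℂ, a ≠ 0 ∧ w = a • G Z := fun Z hZ w => by
    constructor
    · intro h
      obtain ⟨a, ha, h1⟩ := (hGrel Z hZ).unique h
      refine ⟨a, ha, ?_⟩
      rw [← exp_neg_apply_exp (gen ρ F Z) w, h1, map_smul]
    · rintro ⟨a, ha, rfl⟩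
      rw [map_smul, exp_apply_exp_neg]
      exact (hGrel Z hZ).smul_right ha
  have htrans : ∀ Z ∈ V, ∀ b : Idx l → ℝ, Z + cvec b ∈ V →
      ∃ s : ℂ, s ≠ 0 ∧ G (Z + cvec b) = s • G Z := by
    intro Z hZ b hb
    have h1 := (hGrel Z hZ).act hfρ (F.trans b)
    rw [F.cact_trans_tau, cact_trans hρ] at h1
    obtain ⟨s, hs, h2⟩ := h1.unique (hGrel _ hb)
    refine ⟨s, hs, ?_⟩
    simp only [G]
    rw [h2, map_smul, map_add, neg_add, exp_apply_add, exp_neg_apply_exp]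
    exact ((gen_commute hρ F _ _).neg_left).neg_right
  have hZ₀V : Z₀ ∈ V := ⟨hZ₀, hzU⟩
  obtain ⟨i, hi⟩ := Function.ne_iff.mp (hG0 Z₀ hZ₀V)
  replace hi : G Z₀ i ≠ 0 := hi
  have hV' : IsOpen (V ∩ (fun Z => G Z i) ⁻¹' {0}ᶜ) :=
    ((continuous_apply i).comp_continuousOn hG.continuousOn).isOpen_inter_preimage hV
      isOpen_compl_singleton
  obtain ⟨r, hr, hball⟩ := Metric.isOpen_iff.mp hV' Z₀ ⟨hZ₀V, hi⟩
  -- Quotients by a nonvanishing coordinate are affine coordinates of the line spanned by `G Z`, and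
  -- they are holomorphic.
  have hconst : ∀ Z ∈ Metric.ball Z₀ r, ∀ j, G Z j / G Z i = G Z₀ j / G Z₀ i := by
    intro Z hZ j
    have hd : DifferentiableOn ℂ (fun Z => G Z j / G Z i) (Metric.ball Z₀ r) := by
      intro Y hY
      have h1 := ((hG Y (hball hY).1).differentiableAt (hV.mem_nhds (hball hY).1))
      have hj : DifferentiableAt ℂ (fun Z => G Z j) Y := differentiableAt_pi.mp h1 j
      have hi' : DifferentiableAt ℂ (fun Z => G Z i) Y := differentiableAt_pi.mp h1 i
      have hd : DifferentiableAt ℂ (fun Z => G Z j / G Z i) Y := by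
        simp only [div_eq_mul_inv]
        exact hj.mul (hi'.inv (hball hY).2)
      exact hd.differentiableWithinAt
    refine Metric.isOpen_ball.is_const_of_fderiv_eq_zero (𝕜 := ℂ)
      (convex_ball Z₀ r).isPreconnected hd (fun Y hY => ?_) hZ (Metric.mem_ball_self hr)
    have hY' := (hd Y hY).differentiableAt (Metric.isOpen_ball.mem_nhds hY)
    refine ContinuousLinearMap.ext fun v => ?_
    -- The derivative is complex linear, so it is enough that it vanishes in real directions, where
    -- `htrans` applies.
    refine linear_ext_real (f := fderiv ℂ (fun Z => G Z j / G Z i) Y)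
      (g := (0 : (Idx l → ℂ) →L[ℂ] ℂ)) (fun b => ?_) v
    have hc : HasDerivAt (fun t : ℝ => Y + t • cvec b) (cvec b) 0 := by
      have := ((hasDerivAt_id (0 : ℝ)).smul_const (cvec b)).const_add Y
      simpa using this
    have hY0 : Y + (0 : ℝ) • cvec b = Y := by simp
    have h1 : HasDerivAt (fun t : ℝ => G (Y + t • cvec b) j / G (Y + t • cvec b) i)
        (fderiv ℂ (fun Z => G Z j / G Z i) Y (cvec b)) 0 := by
      have h2 : HasFDerivAt (fun Z => G Z j / G Z i)
          ((fderiv ℂ (fun Z => G Z j / G Z i) Y).restrictScalars ℝ) (Y + (0 : ℝ) • cvec b) := by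
        rw [hY0]
        exact hY'.hasFDerivAt.restrictScalars ℝ
      exact h2.comp_hasDerivAt (0 : ℝ) hc
    have h3 : ∀ᶠ t : ℝ in 𝓝 0, Y + t • cvec b ∈ Metric.ball Z₀ r := by
      refine hc.continuousAt.eventually_mem ?_
      rw [hY0]
      exact Metric.isOpen_ball.mem_nhds hY
    have h4 : HasDerivAt (fun t : ℝ => G (Y + t • cvec b) j / G (Y + t • cvec b) i) 0 0 := by
      refine (hasDerivAt_const (0 : ℝ) (G Y j / G Y i)).congr_of_eventuallyEq ?_
      filter_upwards [h3] with t ht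
      have h5 : (t : ℝ) • cvec b = cvec (t • b) := (map_smul cvec t b).symm
      obtain ⟨s, hs, h6⟩ := htrans Y (hball hY).1 (t • b) (by rw [← h5]; exact (hball ht).1)
      rw [h5, h6]
      simp [mul_div_mul_left _ _ hs]
    exact h1.unique h4
  filter_upwards [Metric.ball_mem_nhds Z₀ hr] with Z hZ w
  have hZV := (hball hZ).1
  have hZi : G Z i ≠ 0 := (hball hZ).2
  have hprop : G Z = (G Z i / G Z₀ i) • G Z₀ := by
    funext j
    have := hconst Z hZ j
    rw [div_eq_div_iff hZi hi] at this
    rw [Pi.smul_apply, smul_eq_mul]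
    field_simp
    linear_combination this
  have hs : G Z i / G Z₀ i ≠ 0 := div_ne_zero hZi hi
  rw [hGiff Z₀ hZ₀V, hGiff Z hZV]
  constructor
  · rintro ⟨a, ha, rfl⟩
    refine ⟨a / (G Z i / G Z₀ i), div_ne_zero ha hs, ?_⟩
    rw [hprop, smul_smul, hprop]
    congr 1
    simp only [Pi.smul_apply, smul_eq_mul]
    field_simp
  · rintro ⟨a, ha, rfl⟩
    exact ⟨a * (G Z i / G Z₀ i), mul_ne_zero ha hs, by rw [mul_smul, ← hprop]⟩

include hρ in
-- Locally the set of admissible vectors does not change, and the tube is connected, so a vector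
-- that works at `I p` works everywhere.
theorem exists_flat_vector (hf : IsHolomorphic f)
    (hfρ : ∀ (g : SOId l) (x : Dom l), f ((g : SO l) • x) = ρ g • f x) :
    ∃ w : Idx n → ℂ, ∀ Z ∈ F.tube, Related f (F.tau Z) (NormedSpace.exp (gen ρ F Z) w) := by
  obtain ⟨v, hv⟩ := exists_related (f := f) (F.tau_mem_cone F.I_smul_p_mem')
  refine ⟨NormedSpace.exp (-gen ρ F (Complex.I • cvec F.p)) v, fun Z hZ => ?_⟩
  have h := F.isPreconnected_tube.induction₂
    (fun Z Z' => ∀ w, Related f (F.tau Z) (NormedSpace.exp (gen ρ F Z) w) ↔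
      Related f (F.tau Z') (NormedSpace.exp (gen ρ F Z') w))
    (fun Z hZ => (eventually_related_iff hρ F hf hfρ hZ).filter_mono nhdsWithin_le_nhds)
    (fun _ _ _ _ _ _ h h' w => (h w).trans (h' w)) (fun _ _ _ _ h w => (h w).symm)
    F.I_smul_p_mem' hZ
  rw [← h, exp_apply_exp_neg]
  exact hv

end FlatSection

-- Eigenvalues and degrees for the dilation of the tube

section Flat

open scoped Nat

variable {l n : ℕ} {ρ : SOId l →* SO n} {F : Frame l} {f : Dom l → Dom n} {w : Idx n → ℂ}

/-- In the coordinates of the tube domain the map `f` is given by the exponential of the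
generators applied to `w`. -/
def IsFlat (ρ : SOId l →* SO n) (F : Frame l) (f : Dom l → Dom n) (w : Idx n → ℂ) : Prop :=
  ∀ Z ∈ F.tube, Related f (F.tau Z) (NormedSpace.exp (gen ρ F Z) w)

theorem IsFlat.smul (hw : IsFlat ρ F f w) {a : ℂ} (ha : a ≠ 0) : IsFlat ρ F f (a • w) :=
  fun Z hZ => by
    rw [map_smul]
    exact (hw Z hZ).smul_right ha

/-- The image of a flat vector under an element of the Levi subgroup is a multiple of it. -/
theorem IsFlat.exists_eigenvalue (hρ : Continuous ρ) (hw : IsFlat ρ F f w)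
    (hfρ : ∀ (g : SOId l) (x : Dom l), f ((g : SO l) • x) = ρ g • f x)
    {g : SOId l} {κ : ℝ} (hκ : κ ≠ 0)
    (h₀ : act (g : SO l) F.e₀ = κ • F.e₀) (h₁ : act (g : SO l) F.e₁ = κ⁻¹ • F.e₁) :
    ∃ χ : ℂ, χ ≠ 0 ∧ cact (ρ g) w = χ • w := by
  have hc : (κ : ℂ) ≠ 0 := by exact_mod_cast hκ
  let Z : Idx l → ℂ := Complex.I • cvec F.p
  have hZ : Z ∈ F.tube := F.I_smul_p_mem'
  let Y : Idx l → ℂ := (κ : ℂ)⁻¹ • cact (g : SO l) Z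
  obtain ⟨Z', hZ', c, hc0, h1⟩ := F.exists_cact_tau g hZ
  rw [F.cact_tau hκ h₀ h₁] at h1
  have h2 : (κ : ℂ) = c := by
    have := congrArg (fun z => form z (cvec F.e₁)) h1
    simpa only [form_smul_left, Frame.form_tau_e₁, mul_one] using this
  have h3 : F.tau Y = F.tau Z' := by
    rw [← h2] at h1
    exact smul_right_injective _ hc h1
  -- The points `Y` and `Z'` may differ along the hyperbolic plane, which the generators ignore.
  have h4 : gen ρ F Y = gen ρ F Z' := by
    rw [← gen_pr hρ, ← gen_pr hρ F Z', ← F.pr_tau, h3, F.pr_tau]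
  have h5 := (hw Z hZ).act hfρ g
  rw [F.cact_tau hκ h₀ h₁,
    intertwine_exp (B := gen ρ F Y) (cact (ρ g)) (fun v => cact_mul_gen hρ F hκ h₀ h₁ Z v)] at h5
  have h6 := hw Z' hZ'
  rw [← h3, ← h4] at h6
  obtain ⟨χ, hχ, h7⟩ := h6.unique (h5.of_smul_left hc)
  refine ⟨χ, hχ, ?_⟩
  rw [← exp_neg_apply_exp (gen ρ F Y) (cact (ρ g) w), h7, map_smul, exp_neg_apply_exp]

/-- The vector `v` is an eigenvector of `g` for an eigenvalue of absolute value `2 ^ k * r`. -/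
def HasDegree (g : SO n) (r : ℝ) (k : ℕ) (v : Idx n → ℂ) : Prop :=
  ∃ α : ℂ, cact g v = α • v ∧ ‖α‖ = 2 ^ k * r

theorem HasDegree.star {g : SO n} {r : ℝ} {k : ℕ} {v : Idx n → ℂ} (h : HasDegree g r k v) :
    HasDegree g r k (star v) := by
  obtain ⟨α, h1, h2⟩ := h
  exact ⟨Star.star α, by rw [← star_cact, h1, star_smul], by rw [norm_star, h2]⟩

/-- If the pairing is nonzero, invariance makes the product of the eigenvalues equal to one;
comparing absolute values gives `2 ^ (k + m) = 2 ^ j`. -/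
theorem HasDegree.form_eq_zero {g : SO n} {r : ℝ} {j k m : ℕ} {u v : Idx n → ℂ}
    (hu : HasDegree g r k u) (hv : HasDegree g r m v) (hr : 2 ^ j * r ^ 2 = 1) (h : k + m ≠ j) :
    form u v = 0 := by
  obtain ⟨α, h1, h2⟩ := hu
  obtain ⟨β, h3, h4⟩ := hv
  by_contra h0
  have h5 := form_cact g u v
  rw [h1, h3, form_smul_left, form_smul_right, ← mul_assoc] at h5
  have h6 : α * β = 1 := by
    have : (α * β - 1) * form u v = 0 := by rw [sub_mul, h5]; ring
    rcases mul_eq_zero.mp this with h | h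
    · exact sub_eq_zero.mp h
    · exact absurd h h0
  have h7 : (2 : ℝ) ^ (k + m) * r ^ 2 = 1 := by
    have := congrArg norm h6
    rw [norm_mul, h2, h4, norm_one] at this
    rw [← this]; ring
  have hr0 : r ^ 2 ≠ 0 := by rintro h; simp [h] at hr
  exact h (pow_right_injective₀ (two_pos : (0 : ℝ) < 2) (by norm_num)
    (mul_right_cancel₀ hr0 (h7.trans hr.symm)))

theorem Frame.act_dil_e₀ {a : SOId l} (ha : act (a : SO l) = dilLin F.e₁ F.e₀ 2) :
    act (a : SO l) F.e₀ = (2⁻¹ : ℝ) • F.e₀ := by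
  rw [ha, F.hyp.symm.dilLin_right]

theorem Frame.act_dil_e₁ {a : SOId l} (ha : act (a : SO l) = dilLin F.e₁ F.e₀ 2) :
    act (a : SO l) F.e₁ = (2⁻¹ : ℝ)⁻¹ • F.e₁ := by
  rw [ha, F.hyp.symm.dilLin_left, inv_inv]

theorem cact_dil_gen (hρ : Continuous ρ) {a : SOId l}
    (ha : act (a : SO l) = dilLin F.e₁ F.e₀ 2) (Z : Idx l → ℂ) (v : Idx n → ℂ) :
    cact (ρ a) (gen ρ F Z v) = (2 : ℂ) • gen ρ F Z (cact (ρ a) v) := by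
  have hp : cact (a : SO l) (F.pr Z) = F.pr Z := by
    refine linear_ext_real (f := (cact (a : SO l)).toLinearMap ∘ₗ F.pr) (g := F.pr) (fun x => ?_) Z
    change cact (a : SO l) (F.pr (cvec x)) = F.pr (cvec x)
    rw [F.pr_cvec, cact_cvec, ha, dilLin_of_orthogonal _ (F.form_prR_e₁ x) (F.form_prR_e₀ x)]
  rw [← gen_pr hρ, cact_mul_gen hρ F (by norm_num) (Frame.act_dil_e₀ ha) (Frame.act_dil_e₁ ha), hp]
  simp

theorem HasDegree.gen (hρ : Continuous ρ) {a : SOId l}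
    (ha : act (a : SO l) = dilLin F.e₁ F.e₀ 2) {r : ℝ} {k : ℕ} {v : Idx n → ℂ}
    (h : HasDegree (ρ a) r k v) (Z : Idx l → ℂ) : HasDegree (ρ a) r (k + 1) (gen ρ F Z v) := by
  obtain ⟨α, h1, h2⟩ := h
  refine ⟨2 * α, ?_, ?_⟩
  · rw [cact_dil_gen hρ ha, h1, map_smul, smul_smul]
  · rw [norm_mul, h2]
    simp only [Complex.norm_ofNat]
    ring

theorem gen_smul_pow (c : ℂ) (Z : Idx l → ℂ) (k : ℕ) (v : Idx n → ℂ) :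
    (gen ρ F (c • Z) ^ k) v = c ^ k • (gen ρ F Z ^ k) v := by
  induction k generalizing v with
  | zero => simp
  | succ k ih =>
    rw [pow_succ, pow_succ (gen ρ F Z), mul_apply_eq_comp, mul_apply_eq_comp, ih, map_smul,
      smul_apply, map_smul, smul_smul, pow_succ]

theorem star_gen_pow (hρ : Continuous ρ) (b : Idx l → ℝ) (k : ℕ) (v : Idx n → ℂ) :
    star ((gen ρ F (cvec b) ^ k) v) = (gen ρ F (cvec b) ^ k) (star v) := by
  induction k generalizing v with
  | zero => simp
  | succ k ih =>
    rw [pow_succ, mul_apply_eq_comp, mul_apply_eq_comp, ih, star_gen hρ, star_cvec]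

/-- The data attached to a flat vector `w`: an element `a` that dilates the tube domain, the
absolute value `r` of the eigenvalue of `a` on `w`, and the only degree `j` in which `w` pairs
with its images under the generator of the direction `p`. -/
structure Grading (ρ : SOId l →* SO n) (F : Frame l) (w : Idx n → ℂ) (j : ℕ) where
  a : SOId l
  r : ℝ
  act_a : act (a : SO l) = dilLin F.e₁ F.e₀ 2
  norm : 2 ^ j * r ^ 2 = 1
  deg : HasDegree (ρ a) r 0 w
  pos : 0 < ((2 * Complex.I) ^ j * form (star w) ((gen ρ F (cvec F.p) ^ j) w)).re

theorem HasDegree.gen_pow (hρ : Continuous ρ) {a : SOId l}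
    (ha : act (a : SO l) = dilLin F.e₁ F.e₀ 2) {r : ℝ} {v : Idx n → ℂ}
    (h : HasDegree (ρ a) r 0 v) (Z : Idx l → ℂ) (k : ℕ) :
    HasDegree (ρ a) r k ((SOTwo.gen ρ F Z ^ k) v) := by
  induction k with
  | zero => simpa using h
  | succ k ih =>
    rw [pow_succ', mul_apply_eq_comp]
    exact ih.gen hρ ha Z

/-- The norm at the point `I p` expands as `∑ (2 I) ^ k / k! (w̄, Nᵏ w)`, with `N` the generator in
direction `p`. By degrees at most one term survives, and positivity of the sum forces it to exist
and to be positive. -/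
theorem IsFlat.exists_grading (hρ : Continuous ρ) (hw : IsFlat ρ F f w)
    (hfρ : ∀ (g : SOId l) (x : Dom l), f ((g : SO l) • x) = ρ g • f x) :
    ∃ j, Nonempty (Grading ρ F w j) := by
  obtain ⟨a, ha⟩ := F.hyp.symm.exists_dilation (a := 2) two_pos
  obtain ⟨μ, hμ0, hμ⟩ := hw.exists_eigenvalue hρ hfρ (by norm_num) (Frame.act_dil_e₀ ha)
    (Frame.act_dil_e₁ ha)
  have hdeg : HasDegree (ρ a) ‖μ‖ 0 w := ⟨μ, hμ, by simp⟩
  let Z : Idx l → ℂ := Complex.I • cvec F.p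
  have h1 := (hw Z F.I_smul_p_mem').mem.2
  have hneg : star Z = -Z := by simp [Z]
  have h2 : form (star (NormedSpace.exp (gen ρ F Z) w)) (NormedSpace.exp (gen ρ F Z) w)
      = form (star w) (NormedSpace.exp (gen ρ F ((2 * Complex.I) • cvec F.p)) w) := by
    rw [star_exp_apply (B := gen ρ F (star Z)) (fun v => star_gen hρ F Z v),
      form_exp_left (fun u v => gen_skew hρ F (star Z) u v), hneg, map_neg, neg_neg,
      ← exp_apply_add (Commute.refl _), ← map_add, mul_smul, two_smul]
  rw [h2] at h1
  have h3 := (hasSum_exp_apply (gen ρ F ((2 * Complex.I) • cvec F.p)) w).mapL (formCL (star w))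
  simp only [formCL_apply, form_smul_right, gen_smul_pow] at h3
  have hzero : ∀ j k : ℕ, 2 ^ j * ‖μ‖ ^ 2 = 1 → k ≠ j →
      form (star w) ((gen ρ F (cvec F.p) ^ k) w) = 0 := fun j k hj hk =>
    hdeg.star.form_eq_zero (hdeg.gen_pow hρ ha _ k) hj (by simpa using hk)
  by_cases hj : ∃ j : ℕ, 2 ^ j * ‖μ‖ ^ 2 = 1
  · obtain ⟨j, hj⟩ := hj
    refine ⟨j, ⟨⟨a, ‖μ‖, ha, hj, hdeg, ?_⟩⟩⟩
    have h4 := h3.unique (hasSum_single j fun k hk => by rw [hzero j k hj hk]; simp)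
    have hfac : (0 : ℝ) < (j ! : ℝ)⁻¹ := by positivity
    rw [h4, ← Complex.ofReal_natCast, ← Complex.ofReal_inv, Complex.re_ofReal_mul] at h1
    exact (mul_pos_iff_of_pos_left hfac).mp h1
  · exfalso
    have h5 : ∀ k : ℕ, form (star w) ((gen ρ F (cvec F.p) ^ k) w) = 0 := fun k => by
      by_contra h0
      obtain ⟨α, h6, h7⟩ := hdeg.gen_pow hρ ha (cvec F.p) k
      obtain ⟨β, h8, h9⟩ := hdeg.star
      have h10 := form_cact (ρ a) (star w) ((gen ρ F (cvec F.p) ^ k) w)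
      rw [h6, h8, form_smul_left, form_smul_right, ← mul_assoc] at h10
      have h11 := congrArg norm (mul_eq_right₀ h0 |>.mp h10)
      rw [norm_mul, h7, h9, norm_one] at h11
      exact hj ⟨k, by rw [← h11]; ring⟩
    simp only [h5, mul_zero] at h3
    rw [h3.unique hasSum_zero] at h1
    simp at h1

namespace Grading

variable {j : ℕ} (G : Grading ρ F w j)

include G

theorem ne_zero : w ≠ 0 := by
  rintro rfl
  have := G.pos
  simp at this

theorem pair_ne_zero : form (star w) ((gen ρ F (cvec F.p) ^ j) w) ≠ 0 := fun h => by
  have := G.pos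
  rw [h, mul_zero] at this
  exact lt_irrefl _ this

theorem form_eq_zero {k m : ℕ} {u v : Idx n → ℂ} (hu : HasDegree (ρ G.a) G.r k u)
    (hv : HasDegree (ρ G.a) G.r m v) (h : k + m ≠ j) : form u v = 0 :=
  hu.form_eq_zero hv G.norm h

theorem herm_eq_zero {k m : ℕ} {u v : Idx n → ℂ} (hu : HasDegree (ρ G.a) G.r k u)
    (hv : HasDegree (ρ G.a) G.r m v) (h : k + m ≠ j) : form (star u) v = 0 :=
  hu.star.form_eq_zero hv G.norm h

theorem deg_gen (hρ : Continuous ρ) (Z : Idx l → ℂ) :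
    HasDegree (ρ G.a) G.r 1 (gen ρ F Z w) := by
  simpa using G.deg.gen hρ G.act_a Z

theorem deg_pow (hρ : Continuous ρ) (Z : Idx l → ℂ) (k : ℕ) :
    HasDegree (ρ G.a) G.r k ((gen ρ F Z ^ k) w) := G.deg.gen_pow hρ G.act_a Z k

end Grading

theorem herm_gen_pow (hρ : Continuous ρ) (b : Idx l → ℝ) (k m : ℕ) (u v : Idx n → ℂ) :
    form (star ((gen ρ F (cvec b) ^ k) u)) ((gen ρ F (cvec b) ^ m) v)
      = (-1) ^ k * form (star u) ((gen ρ F (cvec b) ^ (k + m)) v) := by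
  rw [star_gen_pow hρ, form_pow_left (fun u v => gen_skew hρ F _ u v), pow_add, mul_apply_eq_comp]

theorem form_gen_self (hρ : Continuous ρ) (Z : Idx l → ℂ) (v : Idx n → ℂ) :
    form v (gen ρ F Z v) = 0 := by
  have h := gen_skew hρ F Z v v
  rw [form_comm] at h
  linear_combination h / 2

theorem IsFlat.form_self (hρ : Continuous ρ) (hw : IsFlat ρ F f w) : form w w = 0 := by
  have h := (hw _ F.I_smul_p_mem').mem.1
  rwa [form_exp_left (fun u v => gen_skew hρ F _ u v), exp_neg_apply_exp] at h

theorem IsFlat.form_star_self (hρ : Continuous ρ) (hw : IsFlat ρ F f w) :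
    form (star w) (star w) = 0 := by
  rw [form_star, hw.form_self hρ, star_zero]

end Flat

-- Negative vectors orthogonal to a frame, boosts and swaps

section Transverse

variable {l : ℕ} (F : Frame l)

/-- A unit negative vector orthogonal to a frame. -/
structure Frame.IsTransverse (u : Idx l → ℝ) : Prop where
  e₀ : form u F.e₀ = 0
  e₁ : form u F.e₁ = 0
  p : form u F.p = 0
  norm : form u u = -1

variable {F}

theorem Frame.IsTransverse.neg {u : Idx l → ℝ} (hu : F.IsTransverse u) : F.IsTransverse (-u) :=
  ⟨by simp [hu.e₀], by simp [hu.e₁], by simp [hu.p], by simp [hu.norm]⟩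

theorem Frame.form_neg {x : Idx l → ℝ} (h₀ : form x F.e₀ = 0) (h₁ : form x F.e₁ = 0)
    (hp : form x F.p = 0) (hx : x ≠ 0) : form x x < 0 := by
  refine form_neg_of_orthogonal (e := F.e₁) (p := F.p) F.hyp.right F.hyp.symm.left_ne_zero
    (by rw [F.pp]; exact one_pos) (by rw [form_comm, F.pe₁]) (by rw [form_comm, h₁])
    (by rw [form_comm, hp]) fun c hc => hx ?_
  have : c = 0 := by
    rw [hc] at h₀
    simpa [F.hyp.pair'] using h₀
  rw [hc, this, zero_smul]

theorem Frame.isTransverse_smul {x : Idx l → ℝ} (h₀ : form x F.e₀ = 0) (h₁ : form x F.e₁ = 0)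
    (hp : form x F.p = 0) (hx : x ≠ 0) : F.IsTransverse ((√(-form x x))⁻¹ • x) := by
  refine ⟨by simp [h₀], by simp [h₁], by simp [hp], ?_⟩
  have h := Frame.form_neg h₀ h₁ hp hx
  have h1 : √(-form x x) ^ 2 = -form x x := Real.sq_sqrt (by linarith)
  have h2 : √(-form x x) ≠ 0 := (Real.sqrt_pos.mpr (by linarith)).ne'
  rw [form_smul_left, form_smul_right]
  field_simp
  linarith

theorem Frame.exists_isTransverse (hl : 1 < l) : ∃ u, F.IsTransverse u := by
  obtain ⟨x, hx0, hx⟩ := exists_ne_zero_form_eq_zero ![F.e₀, F.e₁, F.p]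
    (show 3 < 2 + l by omega)
  exact ⟨_, Frame.isTransverse_smul (hx 0) (hx 1) (hx 2) hx0⟩

theorem Frame.exists_isTransverse_orthogonal (hl : 2 < l) (u : Idx l → ℝ) :
    ∃ v, F.IsTransverse v ∧ form v u = 0 := by
  obtain ⟨x, hx0, hx⟩ := exists_ne_zero_form_eq_zero ![F.e₀, F.e₁, F.p, u]
    (show 4 < 2 + l by omega)
  have hxu : form x u = 0 := hx 3
  exact ⟨_, Frame.isTransverse_smul (hx 0) (hx 1) (hx 2) hx0, by simp [hxu]⟩

namespace Frame.IsTransverse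

variable {u : Idx l → ℝ} (hu : F.IsTransverse u)

include hu

theorem isHyp : IsHyp (F.p + u) ((2⁻¹ : ℝ) • (F.p - u)) := by
  constructor <;> simp [F.pp, hu.p, hu.norm, form_comm F.p u]
  norm_num

/-- Since `p` and `u` have opposite norms, `p + u` and `p - u` span the isotropic lines of their
plane, and a dilation of that plane scales them inversely. -/
theorem exists_boost : ∃ m : SOId l, act (m : SO l) F.e₀ = F.e₀ ∧ act (m : SO l) F.e₁ = F.e₁ ∧
    act (m : SO l) (F.p + u) = (2 : ℝ) • (F.p + u) ∧
    act (m : SO l) (F.p - u) = (2⁻¹ : ℝ) • (F.p - u) := by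
  obtain ⟨m, hm⟩ := hu.isHyp.exists_dilation (a := 2) two_pos
  refine ⟨m, ?_, ?_, by rw [hm, hu.isHyp.dilLin_left], ?_⟩
  · rw [hm]
    exact dilLin_of_orthogonal _ (by simp [form_comm F.e₀, F.pe₀, hu.e₀])
      (by simp [form_comm F.e₀, F.pe₀, hu.e₀])
  · rw [hm]
    exact dilLin_of_orthogonal _ (by simp [form_comm F.e₁, F.pe₁, hu.e₁])
      (by simp [form_comm F.e₁, F.pe₁, hu.e₁])
  · have h := hu.isHyp.dilLin_right 2
    rw [← hm, map_smul, smul_comm] at h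
    exact smul_right_injective _ (by norm_num : (2⁻¹ : ℝ) ≠ 0) h

/-- The auxiliary negative vector `v` supplies the third direction that the swap of `p + u` and `p -
u` needs. Such a vector exists only for `l > 2`. -/
theorem exists_swap {v : Idx l → ℝ} (hv : F.IsTransverse v) (hvu : form v u = 0) :
    ∃ m : SOId l, act (m : SO l) F.e₀ = F.e₀ ∧ act (m : SO l) F.e₁ = F.e₁ ∧
      act (m : SO l) (F.p + u) = F.p - u := by
  obtain ⟨g₁, g₂, -, -, h1, -, h2⟩ := hu.isHyp.exists_swap (b := v) (by simp [hv.p, hvu])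
    (by simp [hv.p, hvu]) (by rw [hv.norm]; norm_num)
  refine ⟨g₁ * g₂ * g₁, h2 _ ?_ ?_ ?_, h2 _ ?_ ?_ ?_, ?_⟩
  · simp [form_comm F.e₀, F.pe₀, hu.e₀]
  · simp [form_comm F.e₀, F.pe₀, hu.e₀]
  · rw [form_comm, hv.e₀]
  · simp [form_comm F.e₁, F.pe₁, hu.e₁]
  · simp [form_comm F.e₁, F.pe₁, hu.e₁]
  · rw [form_comm, hv.e₁]
  · rw [h1, hv.norm, smul_smul]
    norm_num

end Frame.IsTransverse

end Transverse

-- Degree zero, and generators that kill the flat vector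

section Levi

variable {l n : ℕ} {ρ : SOId l →* SO n} {F : Frame l} {f : Dom l → Dom n} {w : Idx n → ℂ}

theorem cact_gen_of_fixed (hρ : Continuous ρ) {g : SOId l} (h₀ : act (g : SO l) F.e₀ = F.e₀)
    (h₁ : act (g : SO l) F.e₁ = F.e₁) (b : Idx l → ℝ) (v : Idx n → ℂ) :
    cact (ρ g) (gen ρ F (cvec b) v) = gen ρ F (cvec (act (g : SO l) b)) (cact (ρ g) v) := by
  rw [cact_mul_gen hρ F one_ne_zero (by rw [h₀, one_smul]) (by rw [h₁, inv_one, one_smul])]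
  simp

theorem IsFlat.exists_eigenvalue_of_fixed (hρ : Continuous ρ) (hw : IsFlat ρ F f w)
    (hfρ : ∀ (g : SOId l) (x : Dom l), f ((g : SO l) • x) = ρ g • f x)
    {g : SOId l} (h₀ : act (g : SO l) F.e₀ = F.e₀) (h₁ : act (g : SO l) F.e₁ = F.e₁) :
    ∃ χ : ℂ, χ ≠ 0 ∧ cact (ρ g) w = χ • w :=
  hw.exists_eigenvalue hρ hfρ one_ne_zero (by rw [h₀, one_smul]) (by rw [h₁, inv_one, one_smul])

theorem exp_apply_eq_self {A : (Idx n → ℂ) →L[ℂ] (Idx n → ℂ)} {v : Idx n → ℂ} (h : A v = 0) :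
    NormedSpace.exp A v = v := by
  have h1 := (hasSum_exp_apply A v).unique (hasSum_single 0 fun k hk => by
    obtain ⟨m, rfl⟩ := Nat.exists_eq_succ_of_ne_zero hk
    rw [pow_succ, mul_apply_eq_comp, h, map_zero, smul_zero])
  simpa using h1

/-- In degree zero the map is constant, so that the homomorphism is trivial. -/
theorem Grading.eq_one (G : Grading ρ F w 0) (hl : 1 < l) (hρ : Continuous ρ)
    (hw : IsFlat ρ F f w)
    (hfρ : ∀ (g : SOId l) (x : Dom l), f ((g : SO l) • x) = ρ g • f x) : ρ = 1 := by
  have hpos : 0 < (form (star w) w).re := by simpa using G.pos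
  -- The vector `gen Z w` is orthogonal to `w` and to its conjugate, hence negative unless zero, but
  -- its degree makes it isotropic.
  have hgen : ∀ Z, gen ρ F Z w = 0 := fun Z => by
    by_contra h0
    have h1 := herm_neg_of_orthogonal (u := w) (v := star w) (w := gen ρ F Z w)
      (hw.form_star_self hρ) hpos (by rwa [star_star, form_comm])
      (G.herm_eq_zero G.deg (G.deg_gen hρ Z) (by simp))
      (by rw [star_star]; exact form_gen_self hρ Z w) h0
    rw [G.herm_eq_zero (G.deg_gen hρ Z) (G.deg_gen hρ Z) (by simp)] at h1
    simp at h1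
  have hrel : ∀ Z ∈ F.tube, Related f (F.tau Z) w := fun Z hZ => by
    have := hw Z hZ
    rwa [exp_apply_eq_self (hgen Z)] at this
  have hw' : w ∈ cone n := (hrel _ F.I_smul_p_mem').mem
  -- The map is constant with value `[w]` on the tube, which the identity component preserves, so
  -- `ρ` fixes `[w]`.
  have hfix : ∀ g : SOId l, ∃ χ : ℂ, cact (ρ g) w = χ • w := fun g => by
    obtain ⟨Z, hZ, c, hc, h1⟩ := F.exists_cact_tau g F.I_smul_p_mem'
    have h2 := (hrel _ F.I_smul_p_mem').act hfρ g
    rw [h1] at h2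
    obtain ⟨χ, -, h3⟩ := (hrel Z hZ).unique (h2.of_smul_left hc)
    exact ⟨χ, h3⟩
  have hker : ρ.ker = ⊤ := eq_top_of_containsContracted hl fun g h hlim => by
    obtain ⟨α, hα⟩ := hfix g
    obtain ⟨β, hβ⟩ := hfix h
    exact MonoidHom.mem_ker.mpr (eq_one_of_contracted hρ hw' hα hβ hlim)
  exact MonoidHom.ext fun g => MonoidHom.mem_ker.mp (hker ▸ Subgroup.mem_top g)

/-- If the generator in an isotropic direction of the tube domain kills the flat vector, then the
kernel of the homomorphism contains the translations in this direction. -/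
theorem IsFlat.map_trans_eq_one (hρ : Continuous ρ) (hw : IsFlat ρ F f w)
    (hfρ : ∀ (g : SOId l) (x : Dom l), f ((g : SO l) • x) = ρ g • f x) {u : Idx l → ℝ}
    (hu : F.IsTransverse u) (h : gen ρ F (cvec (F.p + u)) w = 0) (t : ℝ) :
    ρ (F.trans (t • (F.p + u))) = 1 := by
  obtain ⟨m, hm₀, hm₁, hmp, hmn⟩ := hu.exists_boost
  obtain ⟨a, ha⟩ := F.hyp.symm.exists_dilation (a := 2) two_pos
  have hfix : ∀ c : ℝ, act (a : SO l) (c • (F.p + u)) = c • (F.p + u) ∧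
      act (a : SO l) (c • (F.p - u)) = c • (F.p - u) := fun c => by
    rw [ha]
    constructor <;> refine dilLin_of_orthogonal _ ?_ ?_ <;> simp [F.pe₀, F.pe₁, hu.e₀, hu.e₁]
  -- Combining dilation and boost expands the translations along `p + u` by four and commutes with
  -- those along `p - u`.
  let g : SOId l := a * m
  have hact : ∀ x, act (g : SO l) x = act (a : SO l) (act (m : SO l) x) := fun x =>
    act_mul_apply _ _ _
  have h₀ : act (g : SO l) F.e₀ = (2⁻¹ : ℝ) • F.e₀ := by
    rw [hact, hm₀, Frame.act_dil_e₀ ha]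
  have h₁ : act (g : SO l) F.e₁ = (2⁻¹ : ℝ)⁻¹ • F.e₁ := by
    rw [hact, hm₁, Frame.act_dil_e₁ ha]
  have hgp : act (g : SO l) (F.p + u) = (2 : ℝ) • (F.p + u) := by rw [hact, hmp, (hfix _).1]
  have hgn : act (g : SO l) (F.p - u) = (2⁻¹ : ℝ) • (F.p - u) := by rw [hact, hmn, (hfix _).2]
  have hc : (2⁻¹ : ℝ) ≠ 0 := by norm_num
  obtain ⟨χ, -, hχ⟩ := hw.exists_eigenvalue hρ hfρ hc h₀ h₁
  -- Half of the generator at `I p` acts trivially on `w`. What remains commutes with `ρ g`, so `exp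
  -- B w` spans a line fixed by `ρ g` and by the translations along `p + u`, which is the setting of
  -- the contraction lemma.
  let B := gen ρ F ((Complex.I / 2) • cvec (F.p - u))
  have hz : NormedSpace.exp B w ∈ cone n := by
    have h1 := (hw _ F.I_smul_p_mem').mem
    have h2 : Complex.I • cvec F.p
        = (Complex.I / 2) • cvec (F.p - u) + (Complex.I / 2) • cvec (F.p + u) := by
      rw [map_sub, map_add]
      module
    rwa [h2, map_add, exp_apply_add (gen_commute hρ F _ _), map_smul (gen ρ F) _ (cvec (F.p + u)),
      exp_apply_eq_self (A := (Complex.I / 2) • gen ρ F (cvec (F.p + u)))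
        (by rw [smul_apply, h, smul_zero])] at h1
  have hgB : ∀ v, cact (ρ g) (B v) = B (cact (ρ g) v) := fun v => by
    simp only [B]
    rw [cact_mul_gen hρ F hc h₀ h₁, map_smul (cact (g : SO l)), cact_cvec, hgn, cvec_smul, smul_smul, smul_smul]
    congr 3
    push_cast
    ring
  refine eq_one_of_contracted hρ hz (g := g) (a := χ) (b := 1) ?_ ?_
    (tendsto_conj_pow (γ := fun t : ℝ => F.trans (t • (F.p + u))) (F.continuous_trans _) (by simp)
      (c := 4) (by norm_num) (fun t => ?_) t)
  · rw [intertwine_exp _ hgB, hχ, map_smul]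
  · have h3 : gen ρ F (cvec (t • (F.p + u))) w = 0 := by
      rw [cvec_smul, map_smul, smul_apply, h, smul_zero]
    rw [cact_trans hρ, ← exp_apply_add (gen_commute hρ F _ _), add_comm,
      exp_apply_add (gen_commute hρ F _ _), exp_apply_eq_self h3, one_smul]
  · rw [F.mul_trans hc h₀ h₁, map_smul, hgp, smul_smul, smul_smul]
    congr 3
    ring

/-- For `l > 2` a swap carries `p + u` to `p - u`, and both generators kill `w`. For `l = 2` no such
swap is available; instead a whole line of translations would lie in the kernel of `ρ`. -/
theorem IsFlat.gen_p_eq_zero (hl : 1 < l) (hfin : l = 2 → Finite ρ.ker) (hρ : Continuous ρ)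
    (hw : IsFlat ρ F f w)
    (hfρ : ∀ (g : SOId l) (x : Dom l), f ((g : SO l) • x) = ρ g • f x) {u : Idx l → ℝ}
    (hu : F.IsTransverse u) (h : gen ρ F (cvec (F.p + u)) w = 0) : gen ρ F (cvec F.p) w = 0 := by
  rcases Nat.lt_or_ge 2 l with hl | hl'
  · obtain ⟨v, hv, hvu⟩ := Frame.exists_isTransverse_orthogonal (F := F) hl u
    obtain ⟨m, hm₀, hm₁, hm⟩ := hu.exists_swap hv hvu
    obtain ⟨χ, hχ0, hχ⟩ := hw.exists_eigenvalue_of_fixed hρ hfρ hm₀ hm₁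
    have h1 := cact_gen_of_fixed hρ hm₀ hm₁ (F.p + u) w
    rw [h, map_zero, hm, hχ, map_smul] at h1
    have h2 := (smul_eq_zero.mp h1.symm).resolve_left hχ0
    have h3 : cvec F.p = (2⁻¹ : ℂ) • (cvec (F.p + u) + cvec (F.p - u)) := by
      rw [map_sub, map_add]
      module
    rw [h3, map_smul, map_add, smul_apply, add_apply, h, h2, add_zero, smul_zero]
  · have := hfin (by omega)
    exfalso
    have hinj : Function.Injective fun t : ℝ =>
        (⟨F.trans (t • (F.p + u)), hw.map_trans_eq_one hρ hfρ hu h t⟩ : ρ.ker) := fun s t hst => by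
      have h1 : F.trans (s • (F.p + u)) = F.trans (t • (F.p + u)) := congrArg Subtype.val hst
      have h2 : ∀ t : ℝ, form (act (F.trans (t • (F.p + u)) : SO l) F.e₀) F.p = t := fun t => by
        have h3 : F.prR (F.p + u) = F.p + u := F.prR_of_orthogonal (by simp [F.pe₀, hu.e₀])
          (by simp [F.pe₁, hu.e₁])
        rw [F.act_trans, map_smul, h3, eichLin_apply]
        simp [F.hyp.pair, F.pp, hu.p, form_comm F.e₀ F.p, form_comm F.e₁ F.p, F.pe₀, F.pe₁]
      rw [← h2 s, h1, h2]
    have := Finite.of_injective _ hinj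
    exact not_finite ℝ

end Levi

-- The degree is two

section Degree

variable {l n : ℕ} {ρ : SOId l →* SO n} {F : Frame l} {f : Dom l → Dom n} {w : Idx n → ℂ} {j : ℕ}

/-- The Hermitian pairing of the iterated images of a graded vector. -/
theorem Grading.herm_pow_ne_zero (G : Grading ρ F w j) (hρ : Continuous ρ) {k m : ℕ}
    (h : k + m = j) :
    form (star ((gen ρ F (cvec F.p) ^ k) w)) ((gen ρ F (cvec F.p) ^ m) w) ≠ 0 := by
  rw [herm_gen_pow hρ, h]
  exact mul_ne_zero (pow_ne_zero _ (by norm_num)) G.pair_ne_zero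

theorem Grading.herm_pow_eq_zero (G : Grading ρ F w j) (hρ : Continuous ρ) {k m : ℕ}
    (h : k + m ≠ j) :
    form (star ((gen ρ F (cvec F.p) ^ k) w)) ((gen ρ F (cvec F.p) ^ m) w) = 0 :=
  G.herm_eq_zero (G.deg_pow hρ _ k) (G.deg_pow hρ _ m) h

/-- Write `N` for the generator in direction `p`. From degree four on, `w`, `N w` and `N² w` are
mutually orthogonal of nonnegative norm, the last one because `I ^ 4 = 1` when `j = 4`. Pairing with
`Nʲ w`, `Nʲ⁻¹ w` and `Nʲ⁻² w` shows that they are independent. -/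
theorem Grading.lt_four (G : Grading ρ F w j) (hρ : Continuous ρ) : j < 4 := by
  by_contra! hj
  have hdiag : 0 ≤ (form (star ((gen ρ F (cvec F.p) ^ 2) w)) ((gen ρ F (cvec F.p) ^ 2) w)).re := by
    rcases hj.eq_or_lt with rfl | hj
    · have h := G.pos
      rw [herm_gen_pow hρ]
      rw [mul_pow, Complex.I_pow_four] at h
      norm_num at h ⊢
      exact h.le
    · rw [G.herm_pow_eq_zero hρ (by omega), Complex.zero_re]
  obtain ⟨α, β, γ, hne, h⟩ := exists_relation_of_orthogonal
    (G.herm_pow_eq_zero hρ (k := 0) (m := 1) (by omega))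
    (G.herm_pow_eq_zero hρ (k := 0) (m := 2) (by omega))
    (G.herm_pow_eq_zero hρ (k := 1) (m := 2) (by omega))
    (by rw [G.herm_pow_eq_zero hρ (by omega), Complex.zero_re])
    (by rw [G.herm_pow_eq_zero hρ (by omega), Complex.zero_re]) hdiag
  have key : ∀ k, α * form (star ((gen ρ F (cvec F.p) ^ k) w)) ((gen ρ F (cvec F.p) ^ 0) w)
      + β * form (star ((gen ρ F (cvec F.p) ^ k) w)) ((gen ρ F (cvec F.p) ^ 1) w)
      + γ * form (star ((gen ρ F (cvec F.p) ^ k) w)) ((gen ρ F (cvec F.p) ^ 2) w) = 0 := fun k => by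
    rw [← form_smul_right, ← form_smul_right, ← form_smul_right, ← form_add_right,
      ← form_add_right, h, form_zero_right]
  have hα : α = 0 := by
    have := key j
    rw [G.herm_pow_eq_zero hρ (m := 1) (by omega), G.herm_pow_eq_zero hρ (m := 2) (by omega)] at this
    simp only [mul_zero, add_zero, mul_eq_zero] at this
    exact this.resolve_right (G.herm_pow_ne_zero hρ (k := j) (m := 0) rfl)
  have hβ : β = 0 := by
    have := key (j - 1)
    rw [G.herm_pow_eq_zero hρ (m := 0) (by omega), G.herm_pow_eq_zero hρ (m := 2) (by omega)] at this
    simp only [mul_zero, add_zero, zero_add, mul_eq_zero] at this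
    exact this.resolve_right (G.herm_pow_ne_zero hρ (k := j - 1) (m := 1) (by omega))
  have hγ : γ = 0 := by
    have := key (j - 2)
    rw [G.herm_pow_eq_zero hρ (m := 0) (by omega), G.herm_pow_eq_zero hρ (m := 1) (by omega)] at this
    simp only [mul_zero, add_zero, zero_add, mul_eq_zero] at this
    exact this.resolve_right (G.herm_pow_ne_zero hρ (k := j - 2) (m := 2) (by omega))
  simp [hα, hβ, hγ] at hne

/-- With `N` as above, `w`, `N w` and the conjugate of `w` span an isotropic space. The third power
of a skew operator is skew, so `(w, N³ w) = 0`, and pairing a relation with `N³ w` and `N² w` leaves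
only a multiple of the conjugate of `w`. -/
theorem Grading.ne_three (G : Grading ρ F w j) (hρ : Continuous ρ) (hw : IsFlat ρ F f w) :
    j ≠ 3 := by
  rintro rfl
  have hdeg' := G.deg.star
  have h1 := G.deg_gen hρ (cvec F.p)
  obtain ⟨α, β, γ, hne, h⟩ := exists_relation_of_orthogonal (u := w)
    (v := gen ρ F (cvec F.p) w) (w := star w)
    (G.herm_eq_zero G.deg h1 (by norm_num)) (hw.form_star_self hρ)
    (G.herm_eq_zero h1 hdeg' (by norm_num))
    (by rw [G.herm_eq_zero G.deg G.deg (by norm_num), Complex.zero_re])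
    (by rw [G.herm_eq_zero h1 h1 (by norm_num), Complex.zero_re])
    (by rw [G.herm_eq_zero hdeg' hdeg' (by norm_num), Complex.zero_re])
  have key : ∀ k, α * form (star ((gen ρ F (cvec F.p) ^ k) w)) w
      + β * form (star ((gen ρ F (cvec F.p) ^ k) w)) (gen ρ F (cvec F.p) w)
      + γ * form (star ((gen ρ F (cvec F.p) ^ k) w)) (star w) = 0 := fun k => by
    rw [← form_smul_right, ← form_smul_right, ← form_smul_right, ← form_add_right,
      ← form_add_right, h, form_zero_right]
  have h3 : form (star ((gen ρ F (cvec F.p) ^ 3) w)) (star w) = 0 := by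
    have h4 := form_pow_left (fun u v => gen_skew hρ F (cvec F.p) u v) 3 w w
    rw [form_comm _ w] at h4
    rw [form_star, form_comm, show form w ((gen ρ F (cvec F.p) ^ 3) w) = 0 by
      linear_combination h4 / 2, star_zero]
  have hα : α = 0 := by
    have := key 3
    rw [h3, G.herm_eq_zero (G.deg_pow hρ _ 3) h1 (by norm_num)] at this
    simp only [mul_zero, add_zero, mul_eq_zero] at this
    exact this.resolve_right (G.herm_pow_ne_zero hρ (k := 3) (m := 0) rfl)
  have hβ : β = 0 := by
    have := key 2
    rw [G.herm_eq_zero (G.deg_pow hρ _ 2) G.deg (by norm_num),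
      G.herm_eq_zero (G.deg_pow hρ _ 2) hdeg' (by norm_num)] at this
    have hne := G.herm_pow_ne_zero hρ (k := 2) (m := 1) rfl
    rw [pow_one] at hne
    simp only [mul_zero, add_zero, zero_add, mul_eq_zero] at this
    exact this.resolve_right hne
  have hγ : γ ≠ 0 := by simpa [hα, hβ] using hne
  rw [hα, hβ, zero_smul, zero_smul, zero_add, zero_add, smul_eq_zero, star_eq_zero] at h
  exact h.elim hγ G.ne_zero

theorem Grading.gen_p_ne_zero (G : Grading ρ F w j) (hj : j ≠ 0) : gen ρ F (cvec F.p) w ≠ 0 := by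
  intro h
  obtain ⟨k, rfl⟩ := Nat.exists_eq_succ_of_ne_zero hj
  refine G.pair_ne_zero ?_
  rw [pow_succ, mul_apply_eq_comp, h, map_zero, form_zero_right]

theorem Grading.ne_one (G : Grading ρ F w j) (hl : 1 < l) (hfin : l = 2 → Finite ρ.ker)
    (hρ : Continuous ρ) (hw : IsFlat ρ F f w)
    (hfρ : ∀ (g : SOId l) (x : Dom l), f ((g : SO l) • x) = ρ g • f x) : j ≠ 1 := by
  rintro rfl
  let v := gen ρ F (cvec F.p) w
  have hv : HasDegree (ρ G.a) G.r 1 v := G.deg_gen hρ _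
  have hv0 : v ≠ 0 := G.gen_p_ne_zero one_ne_zero
  have hpair : form w (star v) ≠ 0 := by
    have h1 := G.pair_ne_zero
    rw [pow_one] at h1
    rw [← star_star w, form_star, ne_eq, star_eq_zero]
    exact h1
  -- The three vectors have degree one, so they are isotropic and mutually orthogonal. Pairing their
  -- relation with `w` removes the conjugate of `v`, the only one of the three not orthogonal to
  -- `w`.
  have hline : ∀ b : Idx l → ℝ, ∃ c : ℂ, gen ρ F (cvec b) w = c • v := fun b => by
    have hb := G.deg_gen hρ (cvec b)
    obtain ⟨α, β, γ, hne, h⟩ := exists_relation_of_orthogonal (u := v) (v := star v)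
      (w := gen ρ F (cvec b) w) (G.herm_eq_zero hv hv.star (by norm_num))
      (G.herm_eq_zero hv hb (by norm_num)) (G.herm_eq_zero hv.star hb (by norm_num))
      (by rw [G.herm_eq_zero hv hv (by norm_num), Complex.zero_re])
      (by rw [G.herm_eq_zero hv.star hv.star (by norm_num), Complex.zero_re])
      (by rw [G.herm_eq_zero hb hb (by norm_num), Complex.zero_re])
    have hβ : β = 0 := by
      have := congrArg (form w) h
      rw [form_add_right, form_add_right, form_smul_right, form_smul_right, form_smul_right,
        form_gen_self hρ, form_gen_self hρ, form_zero_right] at this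
      simpa [hpair] using this
    rw [hβ, zero_smul, add_zero] at h
    have hγ : γ ≠ 0 := by
      rintro rfl
      rw [zero_smul, add_zero, smul_eq_zero] at h
      have hα := h.resolve_right hv0
      simp [hα, hβ] at hne
    refine ⟨-(γ⁻¹ * α), ?_⟩
    have h2 : γ • gen ρ F (cvec b) w = -(α • v) := by rw [← add_eq_zero_iff_neg_eq.mp h]
    rw [← inv_smul_smul₀ hγ (gen ρ F (cvec b) w), h2, smul_neg, smul_smul, neg_smul]
  obtain ⟨u, hu⟩ := Frame.exists_isTransverse (F := F) hl
  have hp : gen ρ F (cvec (F.p + u)) w ≠ 0 := fun h =>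
    hv0 (hw.gen_p_eq_zero hl hfin hρ hfρ hu h)
  have hn : gen ρ F (cvec (F.p - u)) w ≠ 0 := fun h =>
    hv0 (hw.gen_p_eq_zero hl hfin hρ hfρ hu.neg (by rwa [← sub_eq_add_neg]))
  obtain ⟨m, hm₀, hm₁, hmp, hmn⟩ := hu.exists_boost
  obtain ⟨χ, hχ0, hχ⟩ := hw.exists_eigenvalue_of_fixed hρ hfρ hm₀ hm₁
  have key : ∀ (b : Idx l → ℝ) (a : ℝ), act (m : SO l) b = a • b → gen ρ F (cvec b) w ≠ 0 →
      cact (ρ m) v = (a * χ) • v := fun b a hb hb0 => by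
    obtain ⟨c, hc⟩ := hline b
    have hc0 : c ≠ 0 := by
      rintro rfl
      exact hb0 (by rw [hc, zero_smul])
    have h1 := cact_gen_of_fixed hρ hm₀ hm₁ b w
    rw [hb, hχ, map_smul, cvec_smul, map_smul, smul_apply, hc, map_smul, smul_smul, smul_smul] at h1
    refine smul_right_injective _ hc0 ?_
    simp only
    rw [h1, smul_smul]
    congr 1
    ring
  -- The boost would scale the same vector `v` by `2 χ` and by `χ / 2`.
  have h1 := (key _ _ hmp hp).symm.trans (key _ _ hmn hn)
  have h2 := smul_left_injective ℂ hv0 h1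
  have h3 := mul_right_cancel₀ hχ0 h2
  norm_num at h3

theorem Grading.eq_two (G : Grading ρ F w j) (hl : 1 < l) (hfin : l = 2 → Finite ρ.ker)
    (hρ : Continuous ρ) (hne : ρ ≠ 1) (hw : IsFlat ρ F f w)
    (hfρ : ∀ (g : SOId l) (x : Dom l), f ((g : SO l) • x) = ρ g • f x) : j = 2 := by
  have h0 : j ≠ 0 := by
    rintro rfl
    exact hne (G.eq_one hl hρ hw hfρ)
  have h1 := G.ne_one hl hfin hρ hw hfρ
  have h3 := G.ne_three hρ hw
  have h4 := G.lt_four hρ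
  omega

/-- In degree two the flat vector can be chosen to be real. -/
theorem Grading.exists_real (G : Grading ρ F w 2) (hρ : Continuous ρ) (hw : IsFlat ρ F f w) :
    ∃ x : Idx n → ℝ, IsFlat ρ F f (cvec x) := by
  let v := gen ρ F (cvec F.p) w
  have hv : HasDegree (ρ G.a) G.r 1 v := G.deg_gen hρ _
  have hvv : 0 < (form (star v) v).re := by
    have h := G.pos
    have h1 := herm_gen_pow hρ (F := F) F.p 1 1 w w
    rw [pow_one] at h1
    rw [h1]
    rw [mul_pow, Complex.I_sq] at h
    norm_num at h ⊢
    linarith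
  -- In degree two `v` has positive norm, which leaves room for one isotropic line only, so `w` and
  -- its conjugate are proportional.
  obtain ⟨α, β, γ, hne, h⟩ := exists_relation_of_orthogonal (u := w) (v := star w)
    (w := v) (hw.form_star_self hρ) (G.herm_eq_zero G.deg hv (by norm_num))
    (by rw [star_star]; exact form_gen_self hρ _ _)
    (by rw [G.herm_eq_zero G.deg G.deg (by norm_num), Complex.zero_re])
    (by rw [G.herm_eq_zero G.deg.star G.deg.star (by norm_num), Complex.zero_re]) hvv.le
  have hγ : γ = 0 := by
    have := congrArg (form (star v)) h
    rw [form_add_right, form_add_right, form_smul_right, form_smul_right, form_smul_right,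
      G.herm_eq_zero hv G.deg (by norm_num), G.herm_eq_zero hv G.deg.star (by norm_num),
      form_zero_right] at this
    have h2 : form (star v) v ≠ 0 := fun h0 => by simp [h0] at hvv
    simpa [h2] using this
  rw [hγ, zero_smul, add_zero] at h
  have hβ : β ≠ 0 := by
    rintro rfl
    rw [zero_smul, add_zero, smul_eq_zero] at h
    have hα := h.resolve_right G.ne_zero
    simp [hα, hγ] at hne
  obtain ⟨s, hs⟩ : ∃ s : ℂ, star w = s • w := by
    refine ⟨-(β⁻¹ * α), ?_⟩
    have h2 : β • star w = -(α • w) := by rw [← add_eq_zero_iff_neg_eq.mp h]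
    rw [← inv_smul_smul₀ hβ (star w), h2, smul_neg, smul_smul, neg_smul]
  -- The sum of `w` and its conjugate is real; if it vanishes, `w` is purely imaginary and `I w` is
  -- real.
  by_cases hs1 : 1 + s = 0
  · have h1 : star (Complex.I • w) = Complex.I • w := by
      rw [star_smul, hs, smul_smul, show s = -1 by linear_combination hs1]
      simp
    exact ⟨_, eq_cvec_of_star_eq h1 ▸ hw.smul Complex.I_ne_zero⟩
  · have h1 : star ((1 + s) • w) = (1 + s) • w := by
      rw [add_smul, one_smul, ← hs, star_add, star_star, add_comm]
    exact ⟨_, eq_cvec_of_star_eq h1 ▸ hw.smul hs1⟩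

end Degree

-- Degree two: the generators give a similitude

section RealVector

variable {l n : ℕ} {ρ : SOId l →* SO n} {F : Frame l} {f : Dom l → Dom n} {x : Idx n → ℝ}

/-- The real vector obtained by applying the generator of the direction `b` to `x`. -/
def realGen (ρ : SOId l →* SO n) (F : Frame l) (x : Idx n → ℝ) :
    (Idx l → ℝ) →ₗ[ℝ] (Idx n → ℝ) :=
  rev ∘ₗ ((ContinuousLinearMap.apply ℂ (Idx n → ℂ) (cvec x)).toLinearMap ∘ₗ
    gen ρ F).restrictScalars ℝ ∘ₗ cvec

theorem cvec_realGen (hρ : Continuous ρ) (b : Idx l → ℝ) :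
    cvec (realGen ρ F x b) = gen ρ F (cvec b) (cvec x) :=
  (eq_cvec_of_star_eq (by
    change star (gen ρ F (cvec b) (cvec x)) = gen ρ F (cvec b) (cvec x)
    rw [star_gen hρ, star_cvec, star_cvec])).symm

theorem realGen_prR (hρ : Continuous ρ) (b : Idx l → ℝ) :
    realGen ρ F x (F.prR b) = realGen ρ F x b :=
  cvec_injective (by rw [cvec_realGen hρ, cvec_realGen hρ, ← F.pr_cvec, gen_pr hρ])

theorem realGen_skew (hρ : Continuous ρ) (y z : Idx n → ℝ) (b : Idx l → ℝ) :
    form (realGen ρ F y b) z = -form y (realGen ρ F z b) := by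
  have h := gen_skew hρ F (cvec b) (cvec y) (cvec z)
  rw [← cvec_realGen hρ, ← cvec_realGen hρ, form_cvec, form_cvec] at h
  exact_mod_cast h

theorem form_realGen_self (hρ : Continuous ρ) (b : Idx l → ℝ) : form x (realGen ρ F x b) = 0 := by
  have h := realGen_skew hρ (F := F) x x b
  rw [form_comm] at h
  linarith

theorem HasDegree.realGen (hρ : Continuous ρ) {a : SOId l}
    (ha : act (a : SO l) = dilLin F.e₁ F.e₀ 2) {r : ℝ} {k : ℕ}
    (h : HasDegree (ρ a) r k (cvec x)) (b : Idx l → ℝ) :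
    HasDegree (ρ a) r (k + 1) (cvec (SOTwo.realGen ρ F x b)) := by
  rw [cvec_realGen hρ]
  exact h.gen hρ ha _

theorem Grading.form_real_eq_zero {w : Idx n → ℂ} {j : ℕ} (G : Grading ρ F w j) {k m : ℕ}
    {y z : Idx n → ℝ}
    (hy : HasDegree (ρ G.a) G.r k (cvec y)) (hz : HasDegree (ρ G.a) G.r m (cvec z))
    (h : k + m ≠ j) : form y z = 0 := by
  have := G.form_eq_zero hy hz h
  rw [form_cvec] at this
  exact_mod_cast this

theorem exists_relation_of_orthogonal_real {u v w : Idx n → ℝ} (huv : form u v = 0)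
    (huw : form u w = 0) (hvw : form v w = 0) (hu : 0 ≤ form u u) (hv : 0 ≤ form v v)
    (hw : 0 ≤ form w w) :
    ∃ a b c : ℝ, (a ≠ 0 ∨ b ≠ 0 ∨ c ≠ 0) ∧ a • u + b • v + c • w = 0 := by
  obtain ⟨a, b, c, hne, h⟩ := exists_relation_of_orthogonal (u := cvec u) (v := cvec v)
    (w := cvec w) (by simp [huv]) (by simp [huw]) (by simp [hvw]) (by simpa using hu)
    (by simpa using hv) (by simpa using hw)
  have hre : a.re • u + b.re • v + c.re • w = 0 := funext fun i => by
    simpa using congrArg Complex.re (congrFun h i)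
  have him : a.im • u + b.im • v + c.im • w = 0 := funext fun i => by
    simpa using congrArg Complex.im (congrFun h i)
  by_cases h0 : a.re ≠ 0 ∨ b.re ≠ 0 ∨ c.re ≠ 0
  · exact ⟨_, _, _, h0, hre⟩
  · refine ⟨_, _, _, ?_, him⟩
    by_contra! h1
    push Not at h0
    rcases hne with h | h | h <;> refine h (Complex.ext ?_ ?_) <;> simp [h0, h1]

theorem IsFlat.form_real_self (hρ : Continuous ρ) (hw : IsFlat ρ F f (cvec x)) : form x x = 0 := by
  have := hw.form_self hρ
  rw [form_cvec] at this
  exact_mod_cast this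

section DegreeTwo

variable (G : Grading ρ F (cvec x) 2) (hρ : Continuous ρ) (hw : IsFlat ρ F f (cvec x))

include G hρ

theorem Grading.form_realGen_p_pos :
    0 < form (realGen ρ F x F.p) (realGen ρ F x F.p) := by
  have h := G.pos
  have h1 := herm_gen_pow hρ (F := F) F.p 1 1 (cvec x) (cvec x)
  rw [pow_one, ← cvec_realGen hρ, star_cvec, form_cvec] at h1
  rw [mul_pow, Complex.I_sq] at h
  have h2 := congrArg Complex.re h1
  norm_num at h h2 ⊢
  linarith

theorem Grading.realGen_p_ne_zero : realGen ρ F x F.p ≠ 0 := fun h => by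
  have := G.form_realGen_p_pos hρ
  simp [h] at this

include hw

/-- Isotropic directions are sent to isotropic vectors. -/
theorem Grading.form_realGen_isotropic (hl : 1 < l) (hfin : l = 2 → Finite ρ.ker)
    (hfρ : ∀ (g : SOId l) (x : Dom l), f ((g : SO l) • x) = ρ g • f x) {u : Idx l → ℝ}
    (hu : F.IsTransverse u) :
    form (realGen ρ F x (F.p + u)) (realGen ρ F x (F.p + u)) = 0 := by
  by_contra h0
  obtain ⟨m, hm₀, hm₁, hmp, hmn⟩ := hu.exists_boost
  obtain ⟨χ, hχ0, hχ⟩ := hw.exists_eigenvalue_of_fixed hρ hfρ hm₀ hm₁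
  have hinv : ∀ (b c : Idx l → ℝ) (s t : ℝ), act (m : SO l) b = s • b → act (m : SO l) c = t • c →
      ((form (realGen ρ F x b) (realGen ρ F x c) : ℝ) : ℂ)
        = (s * t * χ ^ 2) * (form (realGen ρ F x b) (realGen ρ F x c) : ℝ) := by
    intro b c s t hb hc
    rw [← form_cvec]
    conv_lhs => rw [← form_cact (ρ m)]
    simp only [cvec_realGen hρ, cact_gen_of_fixed hρ hm₀ hm₁, hb, hc, hχ, cvec_smul,
      map_smul (gen ρ F (_ : Idx l → ℂ)), form_smul_left, form_smul_right]
    simp only [map_smul (gen ρ F), smul_apply, form_smul_left, form_smul_right, ← cvec_realGen hρ,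
      form_cvec]
    ring
  have hpp := hinv _ _ _ _ hmp hmp
  -- The boost multiplies the pairings of the images of `p + u` and `p - u` by `4 χ²`, `χ²` and `χ²
  -- / 4`. If the first pairing is nonzero, its factor is one and the two others must vanish.
  have hχ2 : χ ^ 2 = 1 / 4 := by
    have h1 : ((form (realGen ρ F x (F.p + u)) (realGen ρ F x (F.p + u)) : ℝ) : ℂ) ≠ 0 := by
      exact_mod_cast h0
    push_cast at hpp
    have h2 := mul_right_cancel₀ h1 ((one_mul _).trans hpp)
    linear_combination -h2 / 4
  have hnn : form (realGen ρ F x (F.p - u)) (realGen ρ F x (F.p - u)) = 0 := by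
    have h1 := hinv _ _ _ _ hmn hmn
    rw [hχ2] at h1
    push_cast at h1
    have h2 : ((form (realGen ρ F x (F.p - u)) (realGen ρ F x (F.p - u)) : ℝ) : ℂ) = 0 := by
      linear_combination (16 / 15 : ℂ) * h1
    exact_mod_cast h2
  have hpn : form (realGen ρ F x (F.p + u)) (realGen ρ F x (F.p - u)) = 0 := by
    have h1 := hinv _ _ _ _ hmp hmn
    rw [hχ2] at h1
    push_cast at h1
    have h2 : ((form (realGen ρ F x (F.p + u)) (realGen ρ F x (F.p - u)) : ℝ) : ℂ) = 0 := by
      linear_combination (4 / 3 : ℂ) * h1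
    exact_mod_cast h2
  have hsum : 4 * form (realGen ρ F x F.p) (realGen ρ F x F.p)
      = form (realGen ρ F x (F.p + u)) (realGen ρ F x (F.p + u)) := by
    have h1 : (2 : ℝ) • realGen ρ F x F.p
        = realGen ρ F x (F.p + u) + realGen ρ F x (F.p - u) := by
      rw [map_add, map_sub]; module
    have h2 := congrArg (fun y => form y y) h1
    simp only [form_smul_left, form_smul_right, form_add_left, form_add_right, hnn, hpn,
      form_comm (realGen ρ F x (F.p - u))] at h2
    linarith
  have hpos := G.form_realGen_p_pos hρ
  -- The flat vector and the images of `p ± u` are mutually orthogonal, with the image of `p + u`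
  -- positive. Pairing with that image and with `y` reduces the relation to the vanishing of the
  -- image of `p - u`.
  obtain ⟨α, β, γ, hne, h⟩ := exists_relation_of_orthogonal_real
    (form_realGen_self (x := x) hρ (F.p + u)) (form_realGen_self hρ (F.p - u)) hpn
    (hw.form_real_self hρ).ge (by linarith) hnn.ge
  have hβ : β = 0 := by
    have := congrArg (form (realGen ρ F x (F.p + u))) h
    rw [form_add_right, form_add_right, form_smul_right, form_smul_right, form_smul_right, hpn,
      form_comm, form_realGen_self hρ, form_zero_right] at this
    simp only [mul_zero, add_zero, zero_add, mul_eq_zero] at this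
    exact this.resolve_right h0
  let y := realGen ρ F (realGen ρ F x F.p) F.p
  have hyx : form y x ≠ 0 := by
    rw [realGen_skew hρ]
    linarith
  have hdeg1 : ∀ b, HasDegree (ρ G.a) G.r 1 (cvec (realGen ρ F x b)) := fun b => by
    simpa using G.deg.realGen hρ G.act_a b
  have hα : α = 0 := by
    have := congrArg (form y) h
    rw [form_add_right, form_add_right, form_smul_right, form_smul_right, form_smul_right, hβ,
      G.form_real_eq_zero ((hdeg1 F.p).realGen hρ G.act_a F.p) (hdeg1 (F.p - u))
        (by norm_num), form_zero_right] at this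
    simp only [mul_zero, zero_mul, add_zero, mul_eq_zero] at this
    exact this.resolve_right hyx
  have hγ : γ ≠ 0 := by simpa [hα, hβ] using hne
  rw [hα, hβ, zero_smul, zero_smul, zero_add, zero_add, smul_eq_zero] at h
  have h1 := h.resolve_left hγ
  refine G.realGen_p_ne_zero hρ (cvec_injective ?_)
  rw [cvec_realGen hρ, map_zero]
  refine hw.gen_p_eq_zero hl hfin hρ hfρ hu.neg ?_
  rw [← sub_eq_add_neg, ← cvec_realGen hρ, h1, map_zero]

/-- The generators induce a multiple of the form. -/
theorem Grading.form_realGen (hl : 1 < l) (hfin : l = 2 → Finite ρ.ker)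
    (hfρ : ∀ (g : SOId l) (x : Dom l), f ((g : SO l) • x) = ρ g • f x) (b c : Idx l → ℝ) :
    form (realGen ρ F x b) (realGen ρ F x c)
      = form (realGen ρ F x F.p) (realGen ρ F x F.p) * form (F.prR b) (F.prR c) := by
  set L := realGen ρ F x with hL
  -- Adding and subtracting the isotropy relations for `p + u` and `p - u` separates the cross term
  -- from the norms.
  have htrans : ∀ u, F.IsTransverse u →
      form (L F.p) (L u) = 0 ∧ form (L u) (L u) = -form (L F.p) (L F.p) := fun u hu => by
    have h1 := G.form_realGen_isotropic hρ hw hl hfin hfρ hu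
    have h2 := G.form_realGen_isotropic hρ hw hl hfin hfρ hu.neg
    rw [← hL] at h1 h2
    simp only [map_add, map_neg, form_add_left, form_add_right, form_neg_left, form_neg_right,
      form_comm (L u) (L F.p)] at h1 h2
    constructor <;> linarith
  have horth : ∀ y, form y F.e₀ = 0 → form y F.e₁ = 0 → form y F.p = 0 →
      form (L F.p) (L y) = 0 ∧ form (L y) (L y) = form (L F.p) (L F.p) * form y y := by
    intro y h₀ h₁ hp
    by_cases hy : y = 0
    · simp [hy]
    obtain ⟨h1, h2⟩ := htrans _ (Frame.isTransverse_smul h₀ h₁ hp hy)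
    have hneg := Frame.form_neg h₀ h₁ hp hy
    have hs : √(-form y y) ^ 2 = -form y y := Real.sq_sqrt (by linarith)
    have hs0 : √(-form y y) ≠ 0 := (Real.sqrt_pos.mpr (by linarith)).ne'
    simp only [map_smul, form_smul_left, form_smul_right] at h1 h2
    refine ⟨by simpa [hs0] using h1, ?_⟩
    field_simp at h2
    rw [h2, hs]
    ring
  have hquad : ∀ b, form (L b) (L b)
      = form (L F.p) (L F.p) * form (F.prR b) (F.prR b) := fun b => by
    obtain ⟨y, hy⟩ : ∃ y, F.prR b = form b F.p • F.p + y := ⟨_, (add_sub_cancel _ _).symm⟩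
    have hy' : y = F.prR b - form b F.p • F.p := by rw [hy, add_sub_cancel_left]
    have hyp : form y F.p = 0 := by simp [hy', F.form_prR_p, F.pp]
    obtain ⟨h1, h2⟩ := horth y (by simp [hy', F.pe₀]) (by simp [hy', F.pe₁]) hyp
    have h3 : L b = form b F.p • L F.p + L y := by
      rw [hL, ← realGen_prR hρ, hy, map_add, map_smul]
    rw [h3, hy]
    simp only [form_add_left, form_add_right, form_smul_left, form_smul_right, h1, h2,
      form_comm (L y) (L F.p), hyp, form_comm F.p y, F.pp]
    ring
  have h1 := hquad (b + c)
  simp only [map_add, form_add_left, form_add_right, hquad b, hquad c, form_comm (L c) (L b),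
    form_comm (F.prR c) (F.prR b)] at h1
  linarith

end DegreeTwo

theorem realGen_smul (hρ : Continuous ρ) (t : ℝ) (b : Idx l → ℝ) :
    realGen ρ F (t • x) b = t • realGen ρ F x b :=
  cvec_injective (by rw [cvec_smul, cvec_realGen hρ, cvec_realGen hρ, cvec_smul, map_smul])

/-- The flat vector can be chosen to be real, of degree two, and such that the generators are
isometric. -/
theorem exists_normalized (hl : 1 < l) (hfin : l = 2 → Finite ρ.ker) (hρ : Continuous ρ)
    (hne : ρ ≠ 1) (hf : IsHolomorphic f)
    (hfρ : ∀ (g : SOId l) (x : Dom l), f ((g : SO l) • x) = ρ g • f x) (F : Frame l) :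
    ∃ x : Idx n → ℝ, IsFlat ρ F f (cvec x) ∧ Nonempty (Grading ρ F (cvec x) 2) ∧
      ∀ b c, form (realGen ρ F x b) (realGen ρ F x c) = form (F.prR b) (F.prR c) := by
  have hgrad : ∀ w, IsFlat ρ F f w → Nonempty (Grading ρ F w 2) := fun w hw => by
    obtain ⟨j, ⟨G⟩⟩ := hw.exists_grading hρ hfρ
    obtain rfl := G.eq_two hl hfin hρ hne hw hfρ
    exact ⟨G⟩
  obtain ⟨w, hw⟩ := exists_flat_vector hρ F hf hfρ
  obtain ⟨G⟩ := hgrad w hw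
  obtain ⟨x, hx⟩ := G.exists_real hρ hw
  obtain ⟨G'⟩ := hgrad _ hx
  have hpos := G'.form_realGen_p_pos hρ
  set c := form (realGen ρ F x F.p) (realGen ρ F x F.p) with hc
  have hs : √c ^ 2 = c := Real.sq_sqrt hpos.le
  have hs0 : √c ≠ 0 := (Real.sqrt_pos.mpr hpos).ne'
  have hflat : IsFlat ρ F f (cvec ((√c)⁻¹ • x)) := by
    rw [cvec_smul]
    exact hx.smul (by exact_mod_cast inv_ne_zero hs0)
  refine ⟨(√c)⁻¹ • x, hflat, hgrad _ hflat, fun b b' => ?_⟩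
  rw [realGen_smul hρ, realGen_smul hρ, form_smul_left, form_smul_right,
    G'.form_realGen hρ hx hl hfin hfρ, ← hc]
  field_simp
  rw [hs]

end RealVector

-- The linear isometric embedding

section Model

variable {l n : ℕ} {ρ : SOId l →* SO n} {F : Frame l} {f : Dom l → Dom n} {x : Idx n → ℝ}

/-- The vector that completes the image of a frame. -/
def dualVec (ρ : SOId l →* SO n) (F : Frame l) (x : Idx n → ℝ) : Idx n → ℝ :=
  -realGen ρ F (realGen ρ F x F.p) F.p

theorem form_dualVec (hρ : Continuous ρ)
    (hB : ∀ b c, form (realGen ρ F x b) (realGen ρ F x c) = form (F.prR b) (F.prR c)) :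
    form x (dualVec ρ F x) = 1 := by
  have h := realGen_skew hρ (F := F) x (realGen ρ F x F.p) F.p
  rw [hB, F.prR_p, F.pp] at h
  rw [dualVec, form_neg_right, ← h]

section Relations

variable (G : Grading ρ F (cvec x) 2) (hρ : Continuous ρ)
  (hB : ∀ b c, form (realGen ρ F x b) (realGen ρ F x c) = form (F.prR b) (F.prR c))

include G hρ

theorem Grading.deg_realGen (b : Idx l → ℝ) : HasDegree (ρ G.a) G.r 1 (cvec (realGen ρ F x b)) := by
  simpa using G.deg.realGen hρ G.act_a b

theorem Grading.deg_dualVec : HasDegree (ρ G.a) G.r 2 (cvec (dualVec ρ F x)) := by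
  obtain ⟨α, h1, h2⟩ := (G.deg_realGen hρ F.p).realGen hρ G.act_a F.p
  exact ⟨α, by rw [dualVec, map_neg, map_neg, h1, smul_neg], h2⟩

theorem Grading.form_dualVec_self : form (dualVec ρ F x) (dualVec ρ F x) = 0 :=
  G.form_real_eq_zero (G.deg_dualVec hρ) (G.deg_dualVec hρ) (by norm_num)

theorem Grading.form_dualVec_realGen (b : Idx l → ℝ) :
    form (dualVec ρ F x) (realGen ρ F x b) = 0 :=
  G.form_real_eq_zero (G.deg_dualVec hρ) (G.deg_realGen hρ b) (by norm_num)

include hB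

/-- The image of `p` has norm one, so the isotropic vectors of degree two, being orthogonal to it,
span at most a line, which contains `dualVec`. Pairing with `x` finds the coefficient. -/
theorem Grading.realGen_realGen (b c : Idx l → ℝ) :
    realGen ρ F (realGen ρ F x b) c = -(form (F.prR b) (F.prR c)) • dualVec ρ F x := by
  set y := realGen ρ F (realGen ρ F x b) c + form (F.prR b) (F.prR c) • dualVec ρ F x with hy
  have hdeg : HasDegree (ρ G.a) G.r 2 (cvec y) := by
    obtain ⟨α, h1, h2⟩ := G.deg
    have h3 : ∀ b c, cact (ρ G.a) (cvec (realGen ρ F (realGen ρ F x b) c))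
        = (2 * (2 * α)) • cvec (realGen ρ F (realGen ρ F x b) c) := fun b c => by
      simp only [cvec_realGen hρ, cact_dil_gen hρ G.act_a, h1, map_smul, smul_smul]
    refine ⟨2 * (2 * α), ?_, ?_⟩
    · rw [hy, dualVec, map_add, cvec_smul, map_neg, map_add, map_smul (cact (ρ G.a)), map_neg, h3,
        h3]
      module
    · rw [norm_mul, norm_mul, h2]
      simp only [Complex.norm_ofNat]
      ring
  have hp : form (realGen ρ F x F.p) (realGen ρ F x F.p) = 1 := by rw [hB, F.prR_p, F.pp]
  obtain ⟨α, β, γ, hne, h⟩ := exists_relation_of_orthogonal_real (u := y)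
    (v := dualVec ρ F x) (w := realGen ρ F x F.p)
    (G.form_real_eq_zero hdeg (G.deg_dualVec hρ) (by norm_num))
    (G.form_real_eq_zero hdeg (G.deg_realGen hρ _) (by norm_num))
    (G.form_dualVec_realGen hρ _)
    (G.form_real_eq_zero hdeg hdeg (by norm_num)).ge (G.form_dualVec_self hρ).ge
    (by rw [hp]; exact zero_le_one)
  have hγ : γ = 0 := by
    have := congrArg (fun z => form z (realGen ρ F x F.p)) h
    simpa only [form_add_left, form_smul_left, form_zero_left, hp, G.form_dualVec_realGen hρ,
      G.form_real_eq_zero hdeg (G.deg_realGen hρ F.p) (by norm_num), mul_zero, zero_add,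
      mul_one] using this
  have hxy : form x y = 0 := by
    have h1 := realGen_skew hρ (F := F) x (realGen ρ F x b) c
    rw [hB, form_comm] at h1
    rw [hy, form_add_right, form_smul_right, form_dualVec hρ hB]
    linarith
  have hβ : β = 0 := by
    have := congrArg (form x) h
    simpa only [form_add_right, form_smul_right, form_zero_right, hxy, form_dualVec hρ hB,
      form_realGen_self hρ, mul_zero, zero_add, add_zero, mul_one] using this
  have hα : α ≠ 0 := by simpa [hβ, hγ] using hne
  rw [hβ, hγ, zero_smul, zero_smul, add_zero, add_zero, smul_eq_zero] at h
  rw [neg_smul, ← add_eq_zero_iff_eq_neg]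
  exact h.resolve_left hα

/-- A vector of degree three is isotropic and orthogonal to `dualVec` and to the image of `p`, hence
a multiple of `dualVec`. It is also orthogonal to `x`, which `dualVec` is not. -/
theorem Grading.realGen_dualVec (b : Idx l → ℝ) : realGen ρ F (dualVec ρ F x) b = 0 := by
  have hdeg := (G.deg_dualVec hρ).realGen hρ G.act_a b
  have hp : form (realGen ρ F x F.p) (realGen ρ F x F.p) = 1 := by rw [hB, F.prR_p, F.pp]
  obtain ⟨α, β, γ, hne, h⟩ := exists_relation_of_orthogonal_real
    (u := realGen ρ F (dualVec ρ F x) b)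
    (v := dualVec ρ F x) (w := realGen ρ F x F.p)
    (G.form_real_eq_zero hdeg (G.deg_dualVec hρ) (by norm_num))
    (G.form_real_eq_zero hdeg (G.deg_realGen hρ _) (by norm_num))
    (G.form_dualVec_realGen hρ _)
    (G.form_real_eq_zero hdeg hdeg (by norm_num)).ge (G.form_dualVec_self hρ).ge
    (by rw [hp]; exact zero_le_one)
  have hγ : γ = 0 := by
    have := congrArg (fun z => form z (realGen ρ F x F.p)) h
    simpa only [form_add_left, form_smul_left, form_zero_left, hp, G.form_dualVec_realGen hρ,
      G.form_real_eq_zero hdeg (G.deg_realGen hρ F.p) (by norm_num), mul_zero, zero_add,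
      mul_one] using this
  have hβ : β = 0 := by
    have := congrArg (form x) h
    simpa only [form_add_right, form_smul_right, form_zero_right, form_dualVec hρ hB,
      G.form_real_eq_zero G.deg hdeg (by norm_num),
      form_realGen_self hρ, mul_zero, zero_add, add_zero, mul_one] using this
  have hα : α ≠ 0 := by simpa [hβ, hγ] using hne
  rw [hβ, hγ, zero_smul, zero_smul, add_zero, add_zero, smul_eq_zero] at h
  exact h.resolve_left hα

end Relations

/-- The complex linear map underlying the map of symmetric spaces. -/
def model (ρ : SOId l →* SO n) (F : Frame l) (x : Idx n → ℝ) : (Idx l → ℂ) →ₗ[ℂ] (Idx n → ℂ) :=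
  (formₗ.flip (cvec F.e₁)).smulRight (cvec x)
    + (ContinuousLinearMap.apply ℂ (Idx n → ℂ) (cvec x)).toLinearMap ∘ₗ gen ρ F
    + (formₗ.flip (cvec F.e₀)).smulRight (cvec (dualVec ρ F x))

theorem model_apply (z : Idx l → ℂ) : model ρ F x z = form z (cvec F.e₁) • cvec x
    + gen ρ F z (cvec x) + form z (cvec F.e₀) • cvec (dualVec ρ F x) := rfl

/-- The real linear map underlying the map of symmetric spaces. -/
def modelR (ρ : SOId l →* SO n) (F : Frame l) (x : Idx n → ℝ) : (Idx l → ℝ) →ₗ[ℝ] (Idx n → ℝ) :=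
  (formₗ.flip F.e₁).smulRight x + realGen ρ F x + (formₗ.flip F.e₀).smulRight (dualVec ρ F x)

theorem modelR_apply (b : Idx l → ℝ) : modelR ρ F x b = form b F.e₁ • x
    + realGen ρ F x b + form b F.e₀ • dualVec ρ F x := rfl

theorem model_cvec (hρ : Continuous ρ) (b : Idx l → ℝ) :
    model ρ F x (cvec b) = cvec (modelR ρ F x b) := by
  rw [model_apply, modelR_apply, map_add, map_add, cvec_smul, cvec_smul, cvec_realGen hρ,
    form_cvec, form_cvec]

theorem Grading.form_modelR (G : Grading ρ F (cvec x) 2) (hρ : Continuous ρ)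
    (hB : ∀ b c, form (realGen ρ F x b) (realGen ρ F x c) = form (F.prR b) (F.prR c))
    (hw : IsFlat ρ F f (cvec x)) (b c : Idx l → ℝ) :
    form (modelR ρ F x b) (modelR ρ F x c) = form b c := by
  simp only [modelR_apply, form_add_left, form_add_right, form_smul_left, form_smul_right,
    hw.form_real_self hρ, form_realGen_self hρ, form_dualVec hρ hB, hB,
    form_comm (realGen ρ F x _) x, form_comm (dualVec ρ F x) x, G.form_dualVec_self hρ,
    G.form_dualVec_realGen hρ, form_comm (realGen ρ F x _) (dualVec ρ F x)]
  simp only [F.prR_apply, form_sub_left, form_sub_right, form_smul_left, form_smul_right,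
    F.hyp.left, F.hyp.right, F.hyp.pair, F.hyp.pair', form_comm F.e₀ c, form_comm F.e₁ c]
  ring

/-- The generators are nilpotent of order three on `x`. The constant, linear and quadratic terms of
the exponential are the `e₀`, transverse and `e₁` parts of `tau Z`. -/
theorem Grading.exp_gen_apply (G : Grading ρ F (cvec x) 2) (hρ : Continuous ρ)
    (hB : ∀ b c, form (realGen ρ F x b) (realGen ρ F x c) = form (F.prR b) (F.prR c))
    (Z : Idx l → ℂ) : NormedSpace.exp (gen ρ F Z) (cvec x) = model ρ F x (F.tau Z) := by
  have hdual : gen ρ F Z (cvec (dualVec ρ F x)) = 0 := by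
    refine linear_ext_real
      (f := (ContinuousLinearMap.apply ℂ (Idx n → ℂ) (cvec (dualVec ρ F x))).toLinearMap ∘ₗ gen ρ F)
      (g := (0 : (Idx l → ℂ) →ₗ[ℂ] (Idx n → ℂ))) (fun b => ?_) Z
    change gen ρ F (cvec b) (cvec (dualVec ρ F x)) = 0
    rw [← cvec_realGen hρ, G.realGen_dualVec hρ hB, map_zero]
  have hsq : ∀ Z Z' : Idx l → ℂ, gen ρ F Z (gen ρ F Z' (cvec x))
      = -(form (F.pr Z') (F.pr Z)) • cvec (dualVec ρ F x) := by
    intro Z Z'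
    refine linear_ext_real
      (f := (gen ρ F Z).toLinearMap ∘ₗ
        (ContinuousLinearMap.apply ℂ (Idx n → ℂ) (cvec x)).toLinearMap ∘ₗ gen ρ F)
      (g := -((formₗ.flip (F.pr Z)) ∘ₗ F.pr).smulRight (cvec (dualVec ρ F x))) (fun b => ?_) Z'
      |>.trans (neg_smul _ _).symm
    change gen ρ F Z (gen ρ F (cvec b) (cvec x))
      = -((form (F.pr (cvec b)) (F.pr Z)) • cvec (dualVec ρ F x))
    refine linear_ext_real
      (f := (ContinuousLinearMap.apply ℂ (Idx n → ℂ) (gen ρ F (cvec b) (cvec x))).toLinearMap ∘ₗ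
        gen ρ F)
      (g := -((formₗ (F.pr (cvec b))) ∘ₗ F.pr).smulRight (cvec (dualVec ρ F x))) (fun c => ?_) Z
    change gen ρ F (cvec c) (gen ρ F (cvec b) (cvec x))
      = -((form (F.pr (cvec b)) (F.pr (cvec c))) • cvec (dualVec ρ F x))
    rw [← cvec_realGen hρ, ← cvec_realGen hρ, G.realGen_realGen hρ hB, neg_smul, map_neg,
      cvec_smul, F.pr_cvec, F.pr_cvec, form_cvec]
  have h1 := (hasSum_exp_apply (gen ρ F Z) (cvec x)).unique
    (hasSum_sum_of_ne_finset_zero (s := Finset.range 3) fun k hk => by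
      obtain ⟨m, rfl⟩ : ∃ m, k = m + 3 :=
        ⟨k - 3, by have := Finset.mem_range.not.mp hk; omega⟩
      rw [pow_add, pow_succ', pow_two, mul_apply_eq_comp, mul_apply_eq_comp, mul_apply_eq_comp,
        hsq, map_smul, hdual, smul_zero, map_zero, smul_zero])
  rw [h1, model_apply, F.form_tau_e₁, ← gen_pr hρ F (F.tau Z), F.pr_tau, gen_pr hρ]
  have h2 : form (F.tau Z) (cvec F.e₀) = -(form (F.pr Z) (F.pr Z)) / 2 := by
    simp only [Frame.tau, form_add_left, form_sub_left, form_smul_left, form_cvec, F.form_pr_e₀,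
      F.hyp.left, F.hyp.pair']
    push_cast
    ring
  rw [h2, Finset.sum_range_succ, Finset.sum_range_succ, Finset.sum_range_one, pow_zero, pow_one,
    pow_two, mul_apply_eq_comp, hsq, smul_smul]
  simp only [Nat.factorial, one_apply_eq_self]
  congr 2
  · simp
  · simp
  · push_cast
    ring

/-- The map of symmetric spaces is induced by a linear isometric embedding. -/
theorem exists_model (hl : 1 < l) (hfin : l = 2 → Finite ρ.ker) (hρ : Continuous ρ)
    (hne : ρ ≠ 1) (hf : IsHolomorphic f)
    (hfρ : ∀ (g : SOId l) (x : Dom l), f ((g : SO l) • x) = ρ g • f x) (F : Frame l) :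
    ∃ (φ : (Idx l → ℝ) →ₗ[ℝ] (Idx n → ℝ)) (Φ : (Idx l → ℂ) →ₗ[ℂ] (Idx n → ℂ)),
      (∀ b c, form (φ b) (φ c) = form b c) ∧ (∀ b, Φ (cvec b) = cvec (φ b)) ∧
      ∀ Z ∈ F.tube, Related f (F.tau Z) (Φ (F.tau Z)) := by
  obtain ⟨x, hx, ⟨G⟩, hB⟩ := exists_normalized hl hfin hρ hne hf hfρ F
  refine ⟨modelR ρ F x, model ρ F x, G.form_modelR hρ hB hx, model_cvec hρ, fun Z hZ => ?_⟩
  rw [← G.exp_gen_apply hρ hB]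
  exact hx Z hZ

end Model

-- Equivariance of the embedding, and triviality on the complement

section Equivariance

variable {l n : ℕ} {ρ : SOId l →* SO n} {F : Frame l} {f : Dom l → Dom n}
  {φ : (Idx l → ℝ) →ₗ[ℝ] (Idx n → ℝ)} {Φ : (Idx l → ℂ) →ₗ[ℂ] (Idx n → ℂ)}

theorem star_complexification (hΦ : ∀ b, Φ (cvec b) = cvec (φ b)) (z : Idx l → ℂ) :
    star (Φ z) = Φ (star z) := by
  rw [eq_rev_add_imv z]
  simp [hΦ]

theorem form_complexification (hφ : ∀ b c, form (φ b) (φ c) = form b c)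
    (hΦ : ∀ b, Φ (cvec b) = cvec (φ b)) (z z' : Idx l → ℂ) :
    form (Φ z) (Φ z') = form z z' := by
  rw [eq_rev_add_imv z, eq_rev_add_imv z']
  simp only [map_add, map_smul, hΦ, form_add_left, form_add_right, form_smul_left, form_smul_right,
    form_cvec, hφ]

theorem exists_multiplier (hfρ : ∀ (g : SOId l) (x : Dom l), f ((g : SO l) • x) = ρ g • f x)
    (hrel : ∀ Z ∈ F.tube, Related f (F.tau Z) (Φ (F.tau Z))) (g : SOId l) {Z : Idx l → ℂ}
    (hZ : Z ∈ F.tube) :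
    ∃ κ : ℂ, cact (ρ g) (Φ (F.tau Z)) = κ • Φ (cact (g : SO l) (F.tau Z)) := by
  obtain ⟨Z', hZ', c, hc, h⟩ := F.exists_cact_tau g hZ
  have h1 := (hrel Z hZ).act hfρ g
  rw [h] at h1
  obtain ⟨a, -, h2⟩ := (hrel Z' hZ').unique (h1.of_smul_left hc)
  exact ⟨a / c, by rw [h2, h, map_smul, smul_smul, div_mul_cancel₀ _ hc]⟩

/-- The points of the tube domain that are used below span the whole space. -/
theorem Frame.linearMap_eq_zero {M : Type*} [AddCommGroup M] [Module ℂ M]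
    (D : (Idx l → ℂ) →ₗ[ℂ] M)
    (h1 : ∀ s : ℝ, 0 < s → D (F.tau ((s * Complex.I) • cvec F.p)) = 0)
    (h2 : ∀ y, form y F.e₀ = 0 → form y F.e₁ = 0 → form y F.p = 0 →
      D (F.tau (Complex.I • cvec F.p + cvec y)) = 0) (z : Idx l → ℂ) : D z = 0 := by
  have hs : ∀ s : ℝ, 0 < s →
      D (cvec F.e₀) + (s * Complex.I) • D (cvec F.p) + ((s : ℂ) ^ 2 / 2) • D (cvec F.e₁) = 0 := by
    intro s hs
    rw [← h1 s hs]
    have h3 : F.pr ((s * Complex.I) • cvec F.p) = (s * Complex.I) • cvec F.p := by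
      rw [map_smul, F.pr_cvec, F.prR_p]
    rw [Frame.tau, h3, form_smul_left, form_smul_right, form_cvec, F.pp, map_sub, map_add, map_smul,
      map_smul, sub_eq_add_neg, ← neg_smul]
    congr 2
    push_cast
    linear_combination ((s : ℂ) ^ 2 / 2) * Complex.I_sq
  have hs1 := hs 1 one_pos
  have hs2 := hs 2 two_pos
  have hs3 := hs 3 three_pos
  push_cast at hs1 hs2 hs3
  -- The left side of `hs` is quadratic in `s`, so its second difference at 1, 2, 3 isolates the
  -- leading coefficient.
  have hE₁ : D (cvec F.e₁) = 0 := by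
    have h3 := congrArg₂ (fun a b => a - (2 : ℂ) • b) (congrArg₂ (· + ·) hs3 hs1) hs2
    simp only [add_zero, smul_zero, sub_zero] at h3
    rw [← h3]
    module
  rw [hE₁, smul_zero, add_zero] at hs1 hs2
  have hP' : Complex.I • D (cvec F.p) = 0 := by
    have h3 := congrArg₂ (· - ·) hs2 hs1
    simp only [sub_zero] at h3
    rw [← h3]
    module
  have hP := (smul_eq_zero.mp hP').resolve_left Complex.I_ne_zero
  rw [hP, smul_zero, add_zero] at hs1
  have hy : ∀ y, form y F.e₀ = 0 → form y F.e₁ = 0 → form y F.p = 0 → D (cvec y) = 0 := by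
    intro y h₀ h₁ hp
    have h3 := h2 y h₀ h₁ hp
    have h4 : F.pr (Complex.I • cvec F.p + cvec y) = Complex.I • cvec F.p + cvec y := by
      rw [map_add, map_smul, F.pr_cvec, F.prR_p, F.pr_cvec, F.prR_of_orthogonal h₀ h₁]
    rwa [Frame.tau, h4, map_sub, map_add, map_add, map_smul, map_smul, hE₁, hP, hs1, smul_zero,
      smul_zero, zero_add, zero_add, sub_zero] at h3
  refine linear_ext_real (f := D) (g := (0 : (Idx l → ℂ) →ₗ[ℂ] M)) (fun b => ?_) z
  obtain ⟨y, hyb⟩ : ∃ y, F.prR b = form b F.p • F.p + y := ⟨_, (add_sub_cancel _ _).symm⟩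
  have hy' : y = F.prR b - form b F.p • F.p := by rw [hyb, add_sub_cancel_left]
  have hb : b = form b F.e₁ • F.e₀ + form b F.e₀ • F.e₁ + form b F.p • F.p + y := by
    rw [hy', F.prR_apply]
    abel
  rw [hb]
  simp only [map_add, cvec_smul]
  simp only [map_smul D, hs1, hE₁, hP, hy y (by simp [hy', F.pe₀])
    (by simp [hy', F.pe₁]) (by simp [hy', F.form_prR_p, F.pp]), smul_zero, add_zero,
    LinearMap.zero_apply]

/-- Invariance of the Hermitian pairing gives `star κ * κ' = 1` for the multipliers at two
nonorthogonal points, so all points not orthogonal to the base point share its multiplier. Enough of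
them exist to span the space. -/
theorem exists_multiplier_const (hφ : ∀ b c, form (φ b) (φ c) = form b c)
    (hΦ : ∀ b, Φ (cvec b) = cvec (φ b))
    (hfρ : ∀ (g : SOId l) (x : Dom l), f ((g : SO l) • x) = ρ g • f x)
    (hrel : ∀ Z ∈ F.tube, Related f (F.tau Z) (Φ (F.tau Z))) (g : SOId l) :
    ∃ κ : ℂ, ∀ z, cact (ρ g) (Φ z) = κ • Φ (cact (g : SO l) z) := by
  have hmul : ∀ {z z' : Idx l → ℂ} {κ κ' : ℂ}, cact (ρ g) (Φ z) = κ • Φ (cact (g : SO l) z) →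
      cact (ρ g) (Φ z') = κ' • Φ (cact (g : SO l) z') → form (star z) z' ≠ 0 →
      star κ * κ' = 1 := by
    intro z z' κ κ' h h' h0
    have h1 := form_cact (ρ g) (star (Φ z)) (Φ z')
    rw [← star_cact, h, h', star_smul, star_complexification hΦ, star_complexification hΦ,
      form_smul_left, form_smul_right, form_complexification hφ hΦ, form_complexification hφ hΦ,
      star_cact, form_cact, ← mul_assoc] at h1
    exact mul_right_cancel₀ h0 (h1.trans (one_mul _).symm)
  have hZ₀ := F.I_smul_p_mem'
  obtain ⟨κ, hκ⟩ := exists_multiplier hfρ hrel g hZ₀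
  have hκκ : star κ * κ = 1 := hmul hκ hκ fun h => by
    have := (F.tau_mem_cone hZ₀).2
    simp [h] at this
  have key : ∀ Z ∈ F.tube,
      form (F.pr (Complex.I • cvec F.p + Z)) (F.pr (Complex.I • cvec F.p + Z)) ≠ 0 →
      (cact (ρ g) (Φ (F.tau Z)) - κ • Φ (cact (g : SO l) (F.tau Z))) = 0 := by
    intro Z hZ h0
    obtain ⟨κ', hκ'⟩ := exists_multiplier hfρ hrel g hZ
    have h1 := hmul hκ hκ' (by
      have h2 : star (Complex.I • cvec F.p) - Z = -(Complex.I • cvec F.p + Z) := by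
        simp only [star_smul, star_cvec, Complex.star_def, Complex.conj_I, neg_smul]
        abel
      rw [F.star_tau, F.form_tau, h2, map_neg, form_neg_left, form_neg_right, neg_neg]
      exact div_ne_zero (neg_ne_zero.mpr h0) two_ne_zero)
    have h2 : star κ ≠ 0 := fun h => by simp [h] at hκκ
    rw [hκ', mul_left_cancel₀ h2 (h1.trans hκκ.symm), sub_self]
  let D : (Idx l → ℂ) →ₗ[ℂ] (Idx n → ℂ) :=
    (cact (ρ g)).toLinearMap ∘ₗ Φ - κ • (Φ ∘ₗ (cact (g : SO l)).toLinearMap)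
  refine ⟨κ, fun z => sub_eq_zero.mp (F.linearMap_eq_zero D (fun s hs => ?_)
    (fun y h₀ h₁ hp => ?_) z)⟩
  · refine key _ (F.I_smul_p_mem hs) ?_
    rw [← add_smul, map_smul, F.pr_cvec, F.prR_p, form_smul_left, form_smul_right, form_cvec, F.pp]
    have h1 : ((1 + s : ℝ) : ℂ) ≠ 0 := by exact_mod_cast (by positivity)
    push_cast at h1
    rw [show Complex.I + s * Complex.I = (1 + s) * Complex.I by ring]
    simpa using h1
  · refine key _ ⟨?_, ?_⟩ ?_
    · have h1 : imv (Complex.I • cvec F.p + cvec y) = F.p := by ext i; simp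
      rw [h1, F.prR_p, F.pp]
      exact one_pos
    · have h1 : imv (Complex.I • cvec F.p + cvec y) = F.p := by ext i; simp
      rw [h1, F.pp]
      exact one_pos
    · have h2 : form y y ≤ 0 := by
        by_cases hy : y = 0
        · simp [hy]
        · exact (Frame.form_neg h₀ h₁ hp hy).le
      rw [map_add, map_add, map_smul, F.pr_cvec, F.pr_cvec, F.prR_p, F.prR_of_orthogonal h₀ h₁]
      simp only [form_add_left, form_add_right, form_smul_left, form_smul_right, form_cvec, F.pp,
        hp, form_comm F.p y]
      intro h
      have h3 := congrArg Complex.re h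
      simp at h3
      linarith

theorem continuous_form {X : Type*} [TopologicalSpace X] {u v : X → Idx n → ℝ} (hu : Continuous u)
    (hv : Continuous v) : Continuous fun t => form (u t) (v t) :=
  hu.dotProduct (continuous_const.matrix_mulVec hv)

theorem act_complexification (hρ : Continuous ρ) (F : Frame l)
    (hφ : ∀ b c, form (φ b) (φ c) = form b c)
    (hΦ : ∀ b, Φ (cvec b) = cvec (φ b))
    (hκ : ∀ g, ∃ κ : ℂ, ∀ z, cact (ρ g) (Φ z) = κ • Φ (cact (g : SO l) z)) (g : SOId l)
    (b : Idx l → ℝ) : act (ρ g) (φ b) = φ (act (g : SO l) b) := by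
  -- Pairing on a hyperbolic pair recovers the multiplier, which shows that it is real and
  -- continuous in the group element.
  let k : SOId l → ℝ := fun g => form (act (ρ g) (φ F.e₀)) (φ (act (g : SO l) F.e₁))
  have hk : ∀ g b, act (ρ g) (φ b) = k g • φ (act (g : SO l) b) := by
    intro g b
    obtain ⟨κ, h⟩ := hκ g
    have h1 : ∀ b, cvec (act (ρ g) (φ b)) = κ • cvec (φ (act (g : SO l) b)) := fun b => by
      rw [← cact_cvec, ← hΦ, h, cact_cvec, hΦ]
    have h2 : (k g : ℂ) = κ := by
      simp only [k]
      rw [← form_cvec, h1, form_smul_left, form_cvec, hφ, form_act, F.hyp.pair]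
      simp
    exact cvec_injective (by rw [h1, ← h2, cvec_smul])
  have hcont : Continuous k := by
    refine continuous_form ((continuous_act _).comp hρ) ?_
    exact (LinearMap.continuous_of_finiteDimensional φ).comp
      ((continuous_act _).comp continuous_subtype_val)
  have hsq : ∀ g, k g ^ 2 = 1 := fun g => by
    have h := form_act (ρ g) (φ F.e₀) (φ F.e₁)
    rw [hk, hk, form_smul_left, form_smul_right, hφ, hφ, form_act, F.hyp.pair] at h
    linarith
  have hone : k 1 = 1 := by simp [k, hφ, F.hyp.pair]
  have : PreconnectedSpace (SOId l) :=
    Subtype.preconnectedSpace isPreconnected_connectedComponent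
  have h1 : k g = 1 := by
    rcases isPreconnected_univ.eq_one_or_eq_neg_one_of_sq_eq hcont.continuousOn
      (fun g _ => hsq g) with h | h
    · exact h (Set.mem_univ g)
    · have := h (Set.mem_univ 1)
      rw [hone] at this
      norm_num at this
  rw [hk, h1, one_smul]

/-- The image of the embedding contains a positive plane, so its complement is negative definite.
The elements acting trivially there form a normal subgroup containing all contracted elements. -/
theorem act_eq_self_of_orthogonal (hl : 1 < l) (hρ : Continuous ρ)
    (hφ : ∀ b c, form (φ b) (φ c) = form b c)
    (hact : ∀ (g : SOId l) b, act (ρ g) (φ b) = φ (act (g : SO l) b)) (g : SOId l)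
    {w : Idx n → ℝ} (hw : ∀ b, form (φ b) w = 0) : act (ρ g) w = w := by
  let W : Submodule ℂ (Idx n → ℂ) :=
    { carrier := {v | ∀ b, form (cvec (φ b)) v = 0}
      add_mem' := fun hu hv b => by rw [form_add_right, hu b, hv b, add_zero]
      zero_mem' := fun b => form_zero_right _
      smul_mem' := fun c v hv b => by rw [form_smul_right, hv b, mul_zero] }
  have hW : ∀ v ∈ W, v ≠ 0 → (form (star v) v).re < 0 := fun v hv hv0 => by
    refine herm_neg_of_orthogonal (u := cvec (φ (Pi.single (Sum.inl 0) 1)))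
      (v := cvec (φ (Pi.single (Sum.inl 1) 1))) ?_ ?_ ?_ ?_ ?_ hv0
    · simp [hφ, form_single_inl]
    · simp [hφ, form_single_self_inl]
    · simp [hφ, form_single_self_inl]
    · rw [star_cvec]; exact hv _
    · rw [star_cvec]; exact hv _
  have hinv : ∀ (g : SOId l), ∀ v ∈ W, cact (ρ g) v ∈ W := fun g v hv b => by
    have h := form_cact_left (ρ g)⁻¹ (cvec (φ b)) v
    rw [inv_inv, ← map_inv, cact_cvec, hact] at h
    rw [← h]
    exact hv _
  let K : Subgroup (SOId l) :=
    { carrier := {g | ∀ v ∈ W, cact (ρ g) v = v}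
      one_mem' := fun v _ => by simp
      mul_mem' := fun {g h} hg hh v hv => by rw [map_mul, cact_mul_apply, hh v hv, hg v hv]
      inv_mem' := fun {g} hg v hv => by
        conv_lhs => rw [← hg v hv]
        rw [map_inv, cact_inv_apply_self] }
  have : K.Normal := ⟨fun h hh g v hv => by
    rw [map_mul ρ, map_mul ρ, cact_mul_apply, cact_mul_apply, hh _ (hinv g⁻¹ v hv), map_inv,
      cact_apply_inv_self]⟩
  have hK : K = ⊤ := eq_top_of_containsContracted hl fun g h hlim =>
    cact_eq_self_of_contracted hρ hW (fun v hv => by rw [← map_inv]; exact hinv _ v hv)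
      (hinv h) hlim
  have hg : g ∈ K := hK ▸ Subgroup.mem_top g
  refine cvec_injective ?_
  rw [← cact_cvec]
  exact hg _ fun b => by rw [form_cvec, hw b, Complex.ofReal_zero]

theorem comesFromStandard_of_inducesMap (hl : 1 < l) (hfin : l = 2 → Finite ρ.ker)
    (hρ : Continuous ρ) (hne : ρ ≠ 1) (hmap : InducesMap ρ) :
    ComesFromStandard (SOId l).subtype ρ := by
  obtain ⟨f, hf, hfρ⟩ := hmap
  obtain ⟨F⟩ := exists_frame hl
  obtain ⟨φ, Φ, hφ, hΦ, hrel⟩ := exists_model hl hfin hρ hne hf hfρ F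
  have hact := act_complexification hρ F hφ hΦ (exists_multiplier_const hφ hΦ hfρ hrel)
  refine ⟨φ, hφ, fun g x => ?_, fun g w hw => ?_⟩
  · rw [← act_apply, ← act_apply]
    exact hact g x
  · rw [← act_apply]
    exact act_eq_self_of_orthogonal hl hρ hφ hact g hw

end Equivariance

-- Zariski density and the algebraic statement

section Algebraic

variable {l n : ℕ}

/-- A polynomial expression in `a` and `a⁻¹` becomes a polynomial after multiplication by a power
of `a`. -/
theorem exists_pow_mul_eval_eq {σ : Type*} (P : MvPolynomial σ ℝ) (u v w : σ → ℝ) :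
    ∃ (N : ℕ) (Q : Polynomial ℝ), ∀ a : ℝ, a ≠ 0 →
      a ^ N * MvPolynomial.eval (fun s => u s + a * v s + a⁻¹ * w s) P = Q.eval a := by
  induction P using MvPolynomial.induction_on with
  | C c => exact ⟨0, Polynomial.C c, fun a _ => by simp⟩
  | add p q hp hq =>
    obtain ⟨N, Q, h⟩ := hp
    obtain ⟨N', Q', h'⟩ := hq
    refine ⟨N + N', Polynomial.X ^ N' * Q + Polynomial.X ^ N * Q', fun a ha => ?_⟩
    simp only [map_add, Polynomial.eval_add, Polynomial.eval_mul, Polynomial.eval_pow,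
      Polynomial.eval_X, ← h a ha, ← h' a ha]
    ring
  | mul_X p s hp =>
    obtain ⟨N, Q, h⟩ := hp
    refine ⟨N + 1, Q * (Polynomial.C (u s) * Polynomial.X + Polynomial.C (v s) * Polynomial.X ^ 2
      + Polynomial.C (w s)), fun a ha => ?_⟩
    simp only [map_mul, MvPolynomial.eval_X, Polynomial.eval_add, Polynomial.eval_mul,
      Polynomial.eval_pow, Polynomial.eval_X, Polynomial.eval_C, ← h a ha]
    linear_combination (a ^ N * MvPolynomial.eval (fun s => u s + a * v s + a⁻¹ * w s) p * w s)
      * mul_inv_cancel₀ ha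

/-- A Laurent polynomial in `a` with infinitely many zeros vanishes identically. -/
theorem eval_neg_one_eq_zero {σ : Type*} {P : MvPolynomial σ ℝ} {u v w : σ → ℝ}
    (h : ∀ a : ℝ, 0 < a → MvPolynomial.eval (fun s => u s + a * v s + a⁻¹ * w s) P = 0) :
    MvPolynomial.eval (fun s => u s + -1 * v s + (-1)⁻¹ * w s) P = 0 := by
  obtain ⟨N, Q, hQ⟩ := exists_pow_mul_eval_eq P u v w
  have hQ0 : Q = 0 := by
    refine Polynomial.eq_zero_of_infinite_isRoot Q ((Set.Ioi_infinite (0 : ℝ)).mono fun a ha => ?_)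
    have ha' : 0 < a := ha
    change Q.eval a = 0
    rw [← hQ a ha'.ne', h a ha', mul_zero]
  have h1 := hQ (-1) (by norm_num)
  rw [hQ0, Polynomial.eval_zero] at h1
  exact (mul_eq_zero.mp h1).resolve_left (pow_ne_zero _ (by norm_num))

theorem mat_apply (g : SO l) (i j : Idx l) : mat g i j = act g (Pi.single j 1) i := by
  rw [act_apply, Matrix.mulVec_single_one]
  rfl

/-- `SO₀(2, l)` is Zariski dense in `SO(2, l)`. -/
theorem eval_mat_eq_zero (hl : 1 < l) {P : MvPolynomial (Idx l × Idx l) ℝ}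
    (h : ∀ k : SOId l, MvPolynomial.eval (fun p => mat (k : SO l) p.1 p.2) P = 0) (g : SO l) :
    MvPolynomial.eval (fun p => mat g p.1 p.2) P = 0 := by
  let b : Idx l → ℝ := Pi.single (Sum.inl 0) 1
  let c : Idx l → ℝ := Pi.single (Sum.inr ⟨0, by omega⟩) 1
  have hbb : form b b = 1 := form_single_self_inl 0
  have hcc : form c c = -1 := form_single_self_inr _
  have hbc : form b c = 0 := by simp [b, c, form_single_inr]
  have hyp : IsHyp ((2⁻¹ : ℝ) • (b + c)) (b - c) := by
    constructor <;> simp [hbb, hcc, hbc, form_comm c b]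
    norm_num
  -- The representative of the second coset is the dilation of factor `-1`, so it lies in the
  -- Zariski closure of the dilations with positive factor.
  have hdil : (reflLin b * reflLin c : Module.End ℝ (Idx l → ℝ))
      = dilLin ((2⁻¹ : ℝ) • (b + c)) (b - c) (-1) := LinearMap.ext fun x => by
    rw [Module.End.mul_apply, reflLin_apply, reflLin_apply, dilLin_apply]
    simp only [form_sub_left, form_sub_right, form_add_right, form_smul_left, form_smul_right, hbb,
      hcc, hbc, form_comm c b]
    module
  obtain ⟨k, hk | hk⟩ := exists_SOId_mul hl ⟨0, by omega⟩ g
  · rw [hk]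
    exact h k
  · rw [hdil] at hk
    let v : Idx l × Idx l → ℝ := fun p =>
      form (Pi.single p.2 1) (b - c) * act (k : SO l) ((2⁻¹ : ℝ) • (b + c)) p.1
    let w : Idx l × Idx l → ℝ := fun p =>
      form (Pi.single p.2 1) ((2⁻¹ : ℝ) • (b + c)) * act (k : SO l) (b - c) p.1
    let u : Idx l × Idx l → ℝ := fun p => act (k : SO l) (Pi.single p.2 1) p.1 - v p - w p
    have hmat : ∀ (g : SO l) (a : ℝ),
        act g = act (k : SO l) * dilLin ((2⁻¹ : ℝ) • (b + c)) (b - c) a →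
        (fun p : Idx l × Idx l => mat g p.1 p.2) = fun p => u p + a * v p + a⁻¹ * w p := by
      intro g a hg
      funext p
      rw [mat_apply, hg, Module.End.mul_apply, dilLin_apply, map_add, map_add, map_smul,
        map_smul _ _ (b - c)]
      simp only [u, v, w, Pi.add_apply, Pi.smul_apply, smul_eq_mul]
      ring
    rw [hmat g (-1) hk]
    refine eval_neg_one_eq_zero fun a ha => ?_
    obtain ⟨d, hd⟩ := hyp.exists_dilation ha
    rw [← hmat ((k * d : SOId l) : SO l) a (by rw [Subgroup.coe_mul, map_mul, hd])]
    exact h _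

theorem eval_mat_congr (hl : 1 < l) {P Q : MvPolynomial (Idx l × Idx l) ℝ}
    (h : ∀ k : SOId l, MvPolynomial.eval (fun p => mat (k : SO l) p.1 p.2) P
      = MvPolynomial.eval (fun p => mat (k : SO l) p.1 p.2) Q) (g : SO l) :
    MvPolynomial.eval (fun p => mat g p.1 p.2) P = MvPolynomial.eval (fun p => mat g p.1 p.2) Q := by
  have := eval_mat_eq_zero hl (P := P - Q) (fun k => by rw [map_sub, h, sub_self]) g
  rwa [map_sub, sub_eq_zero] at this

theorem continuous_of_isAlgebraic {ρ : SO l →* SO n} (hρ : IsAlgebraic ρ) : Continuous ρ := by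
  refine Continuous.subtype_mk (Continuous.subtype_mk ?_ _) _
  refine continuous_matrix fun i j => ?_
  obtain ⟨P, hP⟩ := hρ i j
  have h : Continuous fun g : SO l => MvPolynomial.eval (fun p => mat g p.1 p.2) P :=
    (MvPolynomial.continuous_eval P).comp
      (continuous_pi fun p => continuous_mat.matrix_elem p.1 p.2)
  exact h.congr fun g => (hP g).symm

/-- The restriction to the identity component satisfies the first statement. The resulting
identities are polynomial in the entries of `g`, so they extend to the whole group with the same
embedding. -/
theorem comesFromStandard_of_isAlgebraic (hl : 1 < l) {ρ : SO l →* SO n} (hρ : IsAlgebraic ρ)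
    (hne : ρ ≠ 1) (hfin : l = 2 → Finite ρ.ker)
    (hmap : InducesMap (ρ.comp (SOId l).subtype)) :
    ComesFromStandard (MonoidHom.id (SO l)) ρ := by
  have hker : l = 2 → Finite (ρ.comp (SOId l).subtype).ker := fun h2 => by
    have := hfin h2
    refine Finite.of_injective
      (fun k : (ρ.comp (SOId l).subtype).ker => (⟨((k : SOId l) : SO l), k.2⟩ : ρ.ker)) ?_
    intro k k' h
    exact Subtype.ext (Subtype.ext (congrArg (fun z : ρ.ker => (z : SO l)) h))
  choose P hP using hρ
  -- By density, an algebraic homomorphism that is trivial on the identity component is trivial.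
  have hne' : ρ.comp (SOId l).subtype ≠ 1 := fun h1 => hne (MonoidHom.ext fun g =>
    Subtype.ext (Subtype.ext (Matrix.ext fun i j => by
      change mat (ρ g) i j = (1 : Matrix (Idx n) (Idx n) ℝ) i j
      rw [hP, eval_mat_congr hl (Q := MvPolynomial.C ((1 : Matrix (Idx n) (Idx n) ℝ) i j))
        (fun k => ?_) g, MvPolynomial.eval_C]
      rw [← hP, MvPolynomial.eval_C]
      have h2 : ρ (k : SO l) = 1 := DFunLike.congr_fun h1 k
      rw [h2]
      rfl)))
  obtain ⟨φ, hφ, hact, horth⟩ := comesFromStandard_of_inducesMap hl hker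
    ((continuous_of_isAlgebraic fun i j => ⟨P i j, hP i j⟩).comp continuous_subtype_val) hne' hmap
  have hmul : ∀ (g : SO l) (w : Idx n → ℝ) (i : Idx n), (mat (ρ g) *ᵥ w) i
      = MvPolynomial.eval (fun p => mat g p.1 p.2) (∑ j, P i j * MvPolynomial.C (w j)) := by
    intro g w i
    simp only [map_sum, map_mul, MvPolynomial.eval_C, ← hP]
    rfl
  refine ⟨φ, hφ, fun g x => funext fun i => ?_, fun g w hw => funext fun i => ?_⟩
  · have hstd : ∀ g : SO l, φ (mat g *ᵥ x) i = MvPolynomial.eval (fun p => mat g p.1 p.2)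
        (∑ a, (∑ b, MvPolynomial.X (a, b) * MvPolynomial.C (x b))
          * MvPolynomial.C (φ (Pi.single a 1) i)) := by
      intro g
      have h1 : φ (mat g *ᵥ x) = ∑ a, (mat g *ᵥ x) a • φ (Pi.single a 1) := by
        conv_lhs => rw [pi_eq_sum_univ' (mat g *ᵥ x)]
        simp only [map_sum, map_smul]
      rw [h1]
      simp only [map_sum, map_mul, MvPolynomial.eval_C, MvPolynomial.eval_X, Finset.sum_apply,
        Pi.smul_apply, smul_eq_mul]
      rfl
    rw [MonoidHom.id_apply, hmul, hstd]
    refine eval_mat_congr hl (fun k => ?_) g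
    rw [← hmul, ← hstd]
    exact congrFun (hact k x) i
  · rw [hmul, ← MvPolynomial.eval_C (f := fun p : Idx l × Idx l => mat g p.1 p.2) (w i)]
    refine eval_mat_congr hl (fun k => ?_) g
    rw [← hmul, MvPolynomial.eval_C]
    exact congrFun (horth k w hw) i

end Algebraic

end SOTwo

end

theorem mainTheorem8 (l n : ℕ) (hl : 1 < l) :
    (∀ ρ : SOTwo.SOId l →* SOTwo.SO n,
      Continuous ρ → ρ ≠ 1 → (l = 2 → Finite ρ.ker) → SOTwo.InducesMap ρ →
        SOTwo.ComesFromStandard (SOTwo.SOId l).subtype ρ) ∧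
    (∀ ρ : SOTwo.SO l →* SOTwo.SO n,
      SOTwo.IsAlgebraic ρ → ρ ≠ 1 → (l = 2 → Finite ρ.ker) →
      SOTwo.InducesMap (ρ.comp (SOTwo.SOId l).subtype) →
        SOTwo.ComesFromStandard (MonoidHom.id (SOTwo.SO l)) ρ) :=
  ⟨fun _ hρ hne hfin hmap => SOTwo.comesFromStandard_of_inducesMap hl hfin hρ hne hmap,
    fun _ hρ hne hfin hmap => SOTwo.comesFromStandard_of_isAlgebraic hl hρ hne hfin hmap⟩
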